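/- **Theorem.** An instance of Unconstrained Weighted Multicut on Trees consists of a finite tree $T$, a set $\mathcal P\subseteq V(T)\times V(T)$ of terminal pairs, a vertex weight function $\mathrm{wt}:V(T)\to\mathbb N=\{0,1,2,\dots\}$ and a weight bound $\mathbf w\in\mathbb N$. The question is whether there is a set $S\subseteq V(T)$, of arbitrary cardinality, with $\sum_{v\in S}\mathrm{wt}(v)\le\mathbf w$ that contains, for every $(s,t)\in\mathcal P$, at least one vertex of the unique $(s,t)$-path of $T$ (end points included). There is a deterministic algorithm that decides this problem in time $2^{O(\ell^2\log\ell)}\cdot n^{O(1)}$, where $\ell$ is the number of leaves (vertices of degree one) of $T$ and $n$ is the length of the input, with all numbers written in binary. That is, there are one deterministic program and constants $a,b,c\in\mathbb N$ such that on every instance the program halts with the correct answer after at most $a\cdot 2^{b\,\ell^2\log_2\ell}\cdot n^{c}$ elementary steps (where $\ell^2\log_2\ell$ is read as $0$ if $T$ is a single vertex, so that $\ell=0$). -/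

import Mathlib

/-! ## The problem -/

/-- `S` is a `P`-multicut of the tree `T`: it meets the `(s, t)`-path, for every `(s, t) ∈ P`.
(In a tree there is exactly one path between two vertices; it contains both end points.) -/
def IsTreeMulticut {V : Type*} (T : SimpleGraph V) (P : Set (V × V)) (S : Finset V) : Prop :=
  ∀ p ∈ P, ∀ q : T.Walk p.1 p.2, q.IsPath → ∃ v ∈ S, v ∈ q.support

/-- The number of leaves of a graph, that is, of its vertices of degree one. -/
noncomputable def numLeaves {V : Type*} (T : SimpleGraph V) : ℕ :=
  {v : V | (T.neighborSet v).ncard = 1}.ncard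

/-- An instance of Unconstrained Weighted Multicut on Trees. The vertices are `0, …, order - 1`;
the tree is given by a list of its edges and the set of terminal pairs by a list of its members,
each in any order. -/
structure UwMCTree where
  order : ℕ
  edges : List (Fin order × Fin order)
  pairs : List (Fin order × Fin order)
  wt : Fin order → ℕ
  bound : ℕ
  isTree : (SimpleGraph.fromEdgeSet {e | ∃ p ∈ edges, e = s(p.1, p.2)}).IsTree

namespace UwMCTree

/-- The tree of an instance. -/
def tree (I : UwMCTree) : SimpleGraph (Fin I.order) :=
  SimpleGraph.fromEdgeSet {e | ∃ p ∈ I.edges, e = s(p.1, p.2)}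

/-- The yes-instances: some multicut, of whatever cardinality, has total weight at most the
bound. -/
def IsYes (I : UwMCTree) : Prop :=
  ∃ S : Finset (Fin I.order),
    ∑ v ∈ S, I.wt v ≤ I.bound ∧ IsTreeMulticut I.tree {p | p ∈ I.pairs} S

end UwMCTree

/-! ## The machine model

Deterministic WHILE programs over binary trees (pure Lisp data). A program has finitely many
variables, each holding a binary tree, i.e. a pointer to an immutable cell; its elementary
operations copy a pointer, build a cell, read a component of a cell and test for `nil`, and each
costs one time unit. There is no arithmetic and no equality test on trees: numbers are lists of
bits. A tree that a run builds in `t` steps from an input with `n` nodes is a directed acyclic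
graph on at most `n + t + 1` cells, so the model is polynomially equivalent to Turing machines. -/

/-- Binary trees, the values that the programs compute with. -/
inductive Data where
  | nil : Data
  | cons (a b : Data) : Data

namespace Data

/-- First component of a cell. -/
def hd : Data → Data
  | nil => nil
  | cons a _ => a

/-- Second component of a cell. -/
def tl : Data → Data
  | nil => nil
  | cons _ b => b

/-- Number of nodes. -/
def size : Data → ℕ
  | nil => 1
  | cons a b => a.size + b.size + 1

end Data

/-- Expressions; variables are numbered. -/
inductive WExpr where
  | var (i : ℕ) : WExpr
  | nil : WExpr
  | cons (a b : WExpr) : WExpr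
  | hd (a : WExpr) : WExpr
  | tl (a : WExpr) : WExpr

namespace WExpr

/-- The value of an expression in a store. -/
def eval (σ : ℕ → Data) : WExpr → Data
  | var i => σ i
  | nil => Data.nil
  | cons a b => Data.cons (a.eval σ) (b.eval σ)
  | hd a => (a.eval σ).hd
  | tl a => (a.eval σ).tl

/-- The time to evaluate an expression: one unit for each operation in it. -/
def cost : WExpr → ℕ
  | var _ => 1
  | nil => 1
  | cons a b => a.cost + b.cost + 1
  | hd a => a.cost + 1
  | tl a => a.cost + 1

end WExpr

/-- Programs. A test succeeds when its value is not `nil`. -/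
inductive WProg where
  | assign (i : ℕ) (e : WExpr) : WProg
  | seq (p q : WProg) : WProg
  | ite (e : WExpr) (p q : WProg) : WProg
  | loop (e : WExpr) (p : WProg) : WProg

/-- `WExec p σ τ t`: program `p`, started in the store `σ`, halts in the store `τ` after exactly
`t` time units. Here `loop e p` is `while e do p`. -/
inductive WExec : WProg → (ℕ → Data) → (ℕ → Data) → ℕ → Prop where
  | assign (i : ℕ) (e : WExpr) (σ : ℕ → Data) :
      WExec (.assign i e) σ (Function.update σ i (e.eval σ)) (e.cost + 1)
  | seq {p q : WProg} {σ τ υ : ℕ → Data} {t u : ℕ} :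
      WExec p σ τ t → WExec q τ υ u → WExec (.seq p q) σ υ (t + u)
  | ite_true {e : WExpr} {p q : WProg} {σ τ : ℕ → Data} {t : ℕ} :
      e.eval σ ≠ Data.nil → WExec p σ τ t → WExec (.ite e p q) σ τ (e.cost + 1 + t)
  | ite_false {e : WExpr} {p q : WProg} {σ τ : ℕ → Data} {t : ℕ} :
      e.eval σ = Data.nil → WExec q σ τ t → WExec (.ite e p q) σ τ (e.cost + 1 + t)
  | loop_true {e : WExpr} {p : WProg} {σ τ υ : ℕ → Data} {t u : ℕ} :
      e.eval σ ≠ Data.nil → WExec p σ τ t → WExec (.loop e p) τ υ u →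
        WExec (.loop e p) σ υ (e.cost + 1 + t + u)
  | loop_false {e : WExpr} {p : WProg} {σ : ℕ → Data} :
      e.eval σ = Data.nil → WExec (.loop e p) σ σ (e.cost + 1)

/-- Programs are deterministic: a run has at most one result and one running time. -/
theorem WExec.unique {p : WProg} {σ τ τ' : ℕ → Data} {t t' : ℕ}
    (h : WExec p σ τ t) (h' : WExec p σ τ' t') : τ = τ' ∧ t = t' := by
  induction h generalizing τ' t' with
  | assign i e σ => cases h'; exact ⟨rfl, rfl⟩
  | seq _ _ ih₁ ih₂ =>
    cases h' with
    | seq a b =>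
      obtain ⟨rfl, rfl⟩ := ih₁ a
      obtain ⟨rfl, rfl⟩ := ih₂ b
      exact ⟨rfl, rfl⟩
  | ite_true he _ ih =>
    cases h' with
    | ite_true _ a => obtain ⟨rfl, rfl⟩ := ih a; exact ⟨rfl, rfl⟩
    | ite_false hf _ => exact absurd hf he
  | ite_false he _ ih =>
    cases h' with
    | ite_true hf _ => exact absurd he hf
    | ite_false _ a => obtain ⟨rfl, rfl⟩ := ih a; exact ⟨rfl, rfl⟩
  | loop_true he _ _ ih₁ ih₂ =>
    cases h' with
    | loop_true _ a b =>
      obtain ⟨rfl, rfl⟩ := ih₁ a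
      obtain ⟨rfl, rfl⟩ := ih₂ b
      exact ⟨rfl, rfl⟩
    | loop_false hf => exact absurd hf he
  | loop_false he =>
    cases h' with
    | loop_true hf _ _ => exact absurd he hf
    | loop_false _ => exact ⟨rfl, rfl⟩

/-- The initial store: the input is in variable `0`, every other variable is `nil`. -/
def WProg.input (d : Data) : ℕ → Data :=
  fun i => if i = 0 then d else Data.nil

/-- Program `p` halts on input `d` within `B` time units, and it accepts (leaves in variable `0`
a value other than `nil`) exactly when `A` holds. -/
def WProg.DecidesWithin (p : WProg) (d : Data) (A : Prop) (B : ℝ) : Prop :=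
  ∃ (τ : ℕ → Data) (t : ℕ),
    WExec p (WProg.input d) τ t ∧ (t : ℝ) ≤ B ∧ (τ 0 ≠ Data.nil ↔ A)

/-! ## The encoding of instances -/

/-- A bit as a tree. -/
def encodeBit : Bool → Data
  | false => Data.nil
  | true => Data.cons Data.nil Data.nil

/-- A list of trees as a tree. -/
def encodeList : List Data → Data
  | [] => Data.nil
  | a :: l => Data.cons a (encodeList l)

/-- A natural number as the list of its binary digits, the least significant one first. -/
def encodeNat (m : ℕ) : Data :=
  encodeList (m.bits.map encodeBit)

/-- A pair of vertices. -/
def encodePair {m : ℕ} (p : Fin m × Fin m) : Data :=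
  Data.cons (encodeNat p.1) (encodeNat p.2)

namespace UwMCTree

/-- The input string: the number of vertices, the edges, the terminal pairs, the weights of
`0, 1, …` in this order, and the weight bound, with all numbers in binary. -/
def encode (I : UwMCTree) : Data :=
  encodeList [encodeNat I.order, encodeList (I.edges.map encodePair),
    encodeList (I.pairs.map encodePair),
    encodeList (List.ofFn fun v => encodeNat (I.wt v)), encodeNat I.bound]

end UwMCTree

/-!
The program tries all guesses about a solution `Y`. A guess determines, in polynomial time, one
vertex set, and the program accepts if that set is a multicut of weight within the bound. So it never
accepts wrongly, and the point is that some guess leads to a multicut that is at most as heavy as `Y`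
(`TreeCuts.exists_candidate`).

*Guesses.* Call a vertex a key if its degree is not two; a tree with `ℓ` leaves has at most `2 ℓ + 1`
keys (`card_keys_le`). Rooted at a key, the tree consists of the keys and of segments, paths of
vertices of degree two, each named by the highest key below it (`TreeOrder`, `InSegment`). The keys in
`Y` are guessed, and so are the segments that `Y` meets; let `Q` be the set of the vertices in these
segments. The path of a terminal pair that the chosen keys do not separate contains a vertex of
`Y ∩ Q`. If the path contains a whole segment of `Q`, then it suffices that the constructed set meets
every such segment. Otherwise it contains pieces of at most two segments. If there are two, then each
piece lies at one end of its segment, and one of two bounds holds: the first vertex of `Y`, counted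
from that end of the segment, has at most a certain position.

*Branching.* Such alternatives between bounds form a graph on the `O(ℓ)` ends of segments. As long as
it has a closed walk of odd length, a guessed letter from an alphabet of size polynomial in `ℓ` settles
one of its edges. Let bounds be carried along the walk, each being the largest position that its
predecessor allows. One looks at the sequence of bounds that begins with the largest start value which
the walk does not lower, and at the one that begins with its successor. If `Y` violated one of any two
consecutive bounds in both sequences, it would satisfy and violate them alternately, which does not
fit the odd length; the letter says which two bounds to add. After `O(ℓ²)` letters the graph is
bipartite (`Alternatives.exists_branches`). These words account for the factor `2 ^ O(ℓ² log ℓ)`.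

*Flow.* A two-colouring of that graph yields an orientation of the segments (`orient`), guessed too,
for which each remaining path runs through its part of `Q` in the direction of the segments, forwards
or backwards throughout. The choice of a subset of `Q` that meets the required sets is relaxed
to a potential on the two sides of the vertices: it does not decrease in the direction of the
segments, and grows by at least one across each required set. The set `Y` gives such a
potential, and from a potential that minimizes the weighted growth one gets the set of the vertices
at which it grows (`TreeOrder.selection_spec`). A minimum comes from the dual, a flow problem
solved by augmentation along shortest closed walks of positive gain while the weights are revealed
bit by bit (`exists_optimal_potential`).

*Programs.* `PTW μ f` says that some program computes the function `f` on encodings in time polynomial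
in `μ`. Such functions are closed under composition and, given a bound on the size of the
accumulator, under folds over lists. So the algorithm is written as a function on lists and numbers,
and its running time is derived from its form (`PTW.solve`).
-/

/-! ### Encodings and polynomial bounds -/

/-- Types whose elements are written as trees, injectively. -/
class Enc (α : Type) where
  enc : α → Data
  inj : Function.Injective enc

open Enc (enc)

/-- The number of nodes of the encoding of `a`. -/
def esize {α : Type} [Enc α] (a : α) : ℕ := (enc a).size

theorem encodeList_injective : Function.Injective encodeList := by
  intro l
  induction l with
  | nil => intro m h; cases m <;> simp_all [encodeList]
  | cons a l ih =>
    intro m h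
    cases m with
    | nil => simp [encodeList] at h
    | cons b m =>
      simp only [encodeList, Data.cons.injEq] at h
      rw [h.1, ih h.2]

theorem encodeBit_injective : Function.Injective encodeBit := by
  intro a b h; cases a <;> cases b <;> simp_all [encodeBit]

theorem bits_injective : Function.Injective Nat.bits := by
  intro a b h
  induction a using Nat.binaryRec' generalizing b with
  | zero =>
    cases b using Nat.bitCasesOn with
    | bit c n =>
      by_cases hn : n = 0 → c = true
      · rw [Nat.bits_append_bit _ _ hn] at h; simp at h
      · push Not at hn; simp [hn.1, hn.2]
  | bit c n hn ih =>
    cases b using Nat.bitCasesOn with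
    | bit c' n' =>
      rw [Nat.bits_append_bit _ _ hn] at h
      by_cases hn' : n' = 0 → c' = true
      · rw [Nat.bits_append_bit _ _ hn'] at h
        simp only [List.cons.injEq] at h
        rw [h.1, ih h.2]
      · push Not at hn'; simp [hn'.1, hn'.2] at h

instance : Enc Data := ⟨id, Function.injective_id⟩
instance : Enc Unit := ⟨fun _ => Data.nil, fun _ _ _ => rfl⟩
instance : Enc Bool := ⟨encodeBit, encodeBit_injective⟩
instance : Enc ℕ := ⟨encodeNat, fun _ _ h =>
  bits_injective (List.map_injective_iff.2 encodeBit_injective (encodeList_injective h))⟩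
instance {α β : Type} [Enc α] [Enc β] : Enc (α × β) :=
  ⟨fun p => Data.cons (enc p.1) (enc p.2), fun p q h => by
    simp only [Data.cons.injEq] at h
    exact Prod.ext (Enc.inj h.1) (Enc.inj h.2)⟩
instance {α : Type} [Enc α] : Enc (List α) :=
  ⟨fun l => encodeList (l.map enc), fun _ _ h =>
    List.map_injective_iff.2 Enc.inj (encodeList_injective h)⟩

section programs
variable {α β γ δ ε : Type}

/-- `T` is bounded by a polynomial in `μ`. -/
def PB (μ T : α → ℕ) : Prop := ∃ C k : ℕ, ∀ a, T a ≤ C * (μ a + 1) ^ k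

namespace PB
variable {μ ν S T : α → ℕ}

theorem mono (h : PB μ T) (hST : ∀ a, S a ≤ T a) : PB μ S :=
  let ⟨C, k, H⟩ := h
  ⟨C, k, fun a => (hST a).trans (H a)⟩

theorem const (c : ℕ) : PB μ (fun _ => c) := ⟨c, 0, fun _ => by simp⟩

theorem self : PB μ μ := ⟨1, 1, fun _ => by simp⟩

theorem add (hS : PB μ S) (hT : PB μ T) : PB μ (fun a => S a + T a) := by
  obtain ⟨C, k, hS⟩ := hS
  obtain ⟨D, l, hT⟩ := hT
  refine ⟨C + D, k + l, fun a => ?_⟩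
  have h1 : (μ a + 1) ^ k ≤ (μ a + 1) ^ (k + l) := Nat.pow_le_pow_right (by omega) (by omega)
  have h2 : (μ a + 1) ^ l ≤ (μ a + 1) ^ (k + l) := Nat.pow_le_pow_right (by omega) (by omega)
  rw [add_mul]
  exact Nat.add_le_add ((hS a).trans (Nat.mul_le_mul_left _ h1))
    ((hT a).trans (Nat.mul_le_mul_left _ h2))

theorem mul (hS : PB μ S) (hT : PB μ T) : PB μ (fun a => S a * T a) := by
  obtain ⟨C, k, hS⟩ := hS
  obtain ⟨D, l, hT⟩ := hT
  refine ⟨C * D, k + l, fun a => ?_⟩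
  calc S a * T a ≤ (C * (μ a + 1) ^ k) * (D * (μ a + 1) ^ l) := Nat.mul_le_mul (hS a) (hT a)
    _ = C * D * (μ a + 1) ^ (k + l) := by ring

theorem trans (hT : PB ν T) (hν : PB μ ν) : PB μ T := by
  obtain ⟨C, k, hT⟩ := hT
  obtain ⟨D, l, hν⟩ := hν
  refine ⟨C * (D + 1) ^ k, l * k, fun a => (hT a).trans ?_⟩
  have h0 : 1 ≤ (μ a + 1) ^ l := Nat.one_le_pow _ _ (by omega)
  have h1 : ν a + 1 ≤ (D + 1) * (μ a + 1) ^ l := by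
    have := hν a
    rw [add_mul, one_mul]; omega
  calc C * (ν a + 1) ^ k ≤ C * ((D + 1) * (μ a + 1) ^ l) ^ k :=
        Nat.mul_le_mul_left _ (Nat.pow_le_pow_left h1 k)
    _ = C * (D + 1) ^ k * (μ a + 1) ^ (l * k) := by rw [mul_pow, pow_mul, mul_assoc]

theorem comp {μ T : β → ℕ} {ν : α → ℕ} (h : PB μ T) (f : α → β) (hf : PB ν (fun a => μ (f a))) :
    PB ν (fun a => T (f a)) :=
  let ⟨C, k, H⟩ := h
  trans (ν := fun a => μ (f a)) ⟨C, k, fun a => H (f a)⟩ hf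

end PB

/-! ### Sizes of encodings -/

theorem Data.size_pos (d : Data) : 1 ≤ d.size := by cases d <;> simp [Data.size]

theorem esize_pos [Enc α] (a : α) : 1 ≤ esize a := Data.size_pos _

@[simp] theorem esize_pair [Enc α] [Enc β] (a : α) (b : β) :
    esize (a, b) = esize a + esize b + 1 := rfl

theorem esize_fst_le [Enc α] [Enc β] (p : α × β) : esize p.1 ≤ esize p := by
  obtain ⟨a, b⟩ := p
  simp only [esize_pair]; omega

theorem esize_snd_le [Enc α] [Enc β] (p : α × β) : esize p.2 ≤ esize p := by
  obtain ⟨a, b⟩ := p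
  simp only [esize_pair]; omega

@[simp] theorem esize_nil [Enc α] : esize ([] : List α) = 1 := rfl

@[simp] theorem esize_cons [Enc α] (a : α) (l : List α) :
    esize (a :: l) = esize a + esize l + 1 := rfl

theorem esize_bool_le (b : Bool) : esize b ≤ 3 := by cases b <;> simp [esize, enc, encodeBit, Data.size]

theorem esize_append [Enc α] (l m : List α) : esize (l ++ m) + 1 = esize l + esize m := by
  induction l with
  | nil => simp; omega
  | cons a l ih => simp only [List.cons_append, esize_cons]; omega

theorem esize_eq_sum [Enc α] (l : List α) : esize l = (l.map fun a => esize a + 1).sum + 1 := by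
  induction l with
  | nil => rfl
  | cons a l ih => simp only [esize_cons, List.map_cons, List.sum_cons, ih]; omega

theorem esize_perm [Enc α] {l m : List α} (h : l.Perm m) : esize l = esize m := by
  rw [esize_eq_sum, esize_eq_sum, (h.map _).sum_eq]

theorem esize_sublist [Enc α] {l m : List α} (h : l.Sublist m) : esize l ≤ esize m := by
  rw [esize_eq_sum, esize_eq_sum]
  exact Nat.add_le_add_right ((h.map _).sum_le_sum (by simp)) 1

theorem length_lt_esize [Enc α] (l : List α) : l.length < esize l := by
  induction l with
  | nil => simp
  | cons a l ih => simp only [List.length_cons, esize_cons]; omega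

theorem esize_mem_le [Enc α] {a : α} {l : List α} (h : a ∈ l) : esize a ≤ esize l := by
  induction h with
  | head l => simp only [esize_cons]; omega
  | tail b _ ih => simp only [esize_cons]; omega

theorem esize_le_of_forall [Enc α] {l : List α} {M : ℕ} (h : ∀ a ∈ l, esize a ≤ M) :
    esize l ≤ l.length * (M + 1) + 1 := by
  induction l with
  | nil => simp
  | cons a l ih =>
    have h1 := h a (by simp)
    have h2 := ih fun b hb => h b (by simp [hb])
    simp only [esize_cons, List.length_cons, add_mul, one_mul]; omega

theorem esize_nat (n : ℕ) : esize n = esize n.bits := rfl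

theorem esize_nat_le {n k : ℕ} (h : n < 2 ^ k) : esize n ≤ 4 * k + 1 := by
  have h1 : n.bits.length ≤ k := by rw [Nat.size_eq_bits_len]; exact Nat.size_le.2 h
  rw [esize_nat]
  have := esize_le_of_forall (l := n.bits) (M := 3) fun b _ => esize_bool_le b
  omega

/-! ### Runs of programs on a stack held in variable `0` -/

/-- Started in any store whose variable `0` holds `d`, program `p` halts within `B` steps with `d'`
in variable `0`. -/
def Runs (p : WProg) (d d' : Data) (B : ℕ) : Prop :=
  ∀ σ : ℕ → Data, σ 0 = d → ∃ τ t, WExec p σ τ t ∧ τ 0 = d' ∧ t ≤ B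

namespace Runs
variable {p q : WProg} {d d₁ d₂ : Data} {A B : ℕ} {e : WExpr}

theorem mono (h : Runs p d d₁ A) (hAB : A ≤ B) : Runs p d d₁ B := fun σ hσ =>
  let ⟨τ, t, h1, h2, h3⟩ := h σ hσ
  ⟨τ, t, h1, h2, h3.trans hAB⟩

theorem assign (h : ∀ σ : ℕ → Data, σ 0 = d → e.eval σ = d₁) :
    Runs (.assign 0 e) d d₁ (e.cost + 1) := fun σ hσ =>
  ⟨_, _, WExec.assign 0 e σ, by simp [h σ hσ], le_rfl⟩

theorem seq (h : Runs p d d₁ A) (h' : Runs q d₁ d₂ B) : Runs (.seq p q) d d₂ (A + B) :=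
  fun σ hσ =>
  let ⟨_, _, h1, h2, h3⟩ := h σ hσ
  let ⟨υ, _, h4, h5, h6⟩ := h' _ h2
  ⟨υ, _, h1.seq h4, h5, Nat.add_le_add h3 h6⟩

theorem ite_true (he : ∀ σ : ℕ → Data, σ 0 = d → e.eval σ ≠ Data.nil) (h : Runs p d d₁ A) :
    Runs (.ite e p q) d d₁ (e.cost + 1 + A) := fun σ hσ =>
  let ⟨τ, _, h1, h2, h3⟩ := h σ hσ
  ⟨τ, _, .ite_true (he σ hσ) h1, h2, by omega⟩

theorem ite_false (he : ∀ σ : ℕ → Data, σ 0 = d → e.eval σ = Data.nil) (h : Runs q d d₁ A) :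
    Runs (.ite e p q) d d₁ (e.cost + 1 + A) := fun σ hσ =>
  let ⟨τ, _, h1, h2, h3⟩ := h σ hσ
  ⟨τ, _, .ite_false (he σ hσ) h1, h2, by omega⟩

theorem loop_true (he : ∀ σ : ℕ → Data, σ 0 = d → e.eval σ ≠ Data.nil) (h : Runs p d d₁ A)
    (h' : Runs (.loop e p) d₁ d₂ B) : Runs (.loop e p) d d₂ (e.cost + 1 + A + B) := fun σ hσ =>
  let ⟨_, _, h1, h2, h3⟩ := h σ hσ
  let ⟨υ, _, h4, h5, h6⟩ := h' _ h2
  ⟨υ, _, .loop_true (he σ hσ) h1 h4, h5, by omega⟩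

theorem loop_false (he : ∀ σ : ℕ → Data, σ 0 = d → e.eval σ = Data.nil) :
    Runs (.loop e p) d d (e.cost + 1) := fun σ hσ =>
  ⟨σ, _, .loop_false (he σ hσ), hσ, le_rfl⟩

end Runs

/-! ### Functions computed in polynomial time -/

/-- `f` is computed, on top of a stack, in time polynomial in `μ`, and so is the size of its
value. The rest `r` of the stack is left untouched, so that programs compose without renaming
variables. -/
def PTW [Enc α] [Enc β] (μ : α → ℕ) (f : α → β) : Prop :=
  ∃ (p : WProg) (T : α → ℕ), PB μ T ∧ PB μ (fun a => esize (f a)) ∧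
    ∀ a r, Runs p (Data.cons (enc a) r) (Data.cons (enc (f a)) r) (T a)

/-- `f` is computed in time polynomial in the size of its argument. -/
@[fun_prop] def PT [Enc α] [Enc β] (f : α → β) : Prop := PTW esize f

section basic
variable [Enc α] [Enc β] [Enc γ] [Enc δ] [Enc ε]

theorem PTW.comp {μ : α → ℕ} {g : β → γ} {f : α → β} (hg : PT g) (hf : PTW μ f) :
    PTW μ (fun a => g (f a)) := by
  obtain ⟨p, T, hT, hs, hp⟩ := hf
  obtain ⟨q, U, hU, hs', hq⟩ := hg
  exact ⟨.seq p q, fun a => T a + U (f a), hT.add (hU.comp f hs), hs'.comp f hs,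
    fun a r => (hp a r).seq (hq (f a) r)⟩

/-- The variable that holds the stack. -/
abbrev X0 : WExpr := .var 0

theorem PTW.of_expr {μ : α → ℕ} {f : α → β} (e : WExpr) (hs : PB μ (fun a => esize (f a)))
    (h : ∀ a r (σ : ℕ → Data), σ 0 = Data.cons (enc a) r → e.eval σ = enc (f a)) : PTW μ f :=
  ⟨.assign 0 (.cons e (.tl X0)), fun _ => (WExpr.cons e (.tl X0)).cost + 1, PB.const _, hs,
    fun a r => Runs.assign fun σ hσ => by simp [WExpr.eval, h a r σ hσ, hσ, Data.tl]⟩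

theorem PTW.pair {μ : α → ℕ} {f : α → β} {g : α → γ} (hf : PTW μ f) (hg : PTW μ g) :
    PTW μ (fun a => (f a, g a)) := by
  obtain ⟨p, T, hT, hs, hp⟩ := hf
  obtain ⟨q, U, hU, hs', hq⟩ := hg
  let e1 : WExpr := .cons (.hd X0) X0
  let e2 : WExpr := .cons (.hd (.tl X0)) (.cons (.hd X0) (.tl (.tl X0)))
  let e3 : WExpr := .cons (.cons (.hd (.tl X0)) (.hd X0)) (.tl (.tl X0))
  refine ⟨.seq (.assign 0 e1) (.seq p (.seq (.assign 0 e2) (.seq q (.assign 0 e3)))),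
    fun a => (e1.cost + 1) + (T a + ((e2.cost + 1) + (U a + (e3.cost + 1)))), ?_, ?_, ?_⟩
  · exact (PB.const _).add (hT.add ((PB.const _).add (hU.add (PB.const _))))
  · exact (hs.add hs').add (PB.const 1)
  · intro a r
    refine Runs.seq (Runs.assign (d₁ := .cons (enc a) (.cons (enc a) r)) ?_)
      (Runs.seq (hp a _) (Runs.seq
        (Runs.assign (d₁ := .cons (enc a) (.cons (enc (f a)) r)) ?_)
        (Runs.seq (hq a _) (Runs.assign ?_)))) <;>
      (intro σ hσ; simp [e1, e2, e3, WExpr.eval, hσ, Data.hd, Data.tl, enc])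

/-- An expression with a given value. -/
def WExpr.lit : Data → WExpr
  | .nil => .nil
  | .cons a b => .cons (lit a) (lit b)

theorem WExpr.eval_lit (d : Data) (σ : ℕ → Data) : (WExpr.lit d).eval σ = d := by
  induction d with
  | nil => rfl
  | cons a b iha ihb => simp [WExpr.lit, WExpr.eval, iha, ihb]

theorem PTW.const {μ : α → ℕ} (b : β) : PTW μ (fun _ : α => b) :=
  PTW.of_expr (WExpr.lit (enc b)) (PB.const _) fun _ _ _ _ => WExpr.eval_lit _ _

@[fun_prop] theorem PT.id : PT (fun a : α => a) :=
  PTW.of_expr (.hd X0) PB.self fun a r σ h => by simp [WExpr.eval, h, Data.hd]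

@[fun_prop] theorem PT.const (b : β) : PT (fun _ : α => b) := PTW.const b

@[fun_prop] theorem PT.comp {g : β → γ} {f : α → β} (hg : PT g) (hf : PT f) :
    PT (fun a => g (f a)) := PTW.comp hg hf

@[fun_prop] theorem PT.mk {f : α → β} {g : α → γ} (hf : PT f) (hg : PT g) :
    PT (fun a => (f a, g a)) := PTW.pair hf hg

theorem PT.fst' : PT (fun p : α × β => p.1) :=
  PTW.of_expr (.hd (.hd X0)) (PB.self.mono esize_fst_le)
    fun a r σ h => by simp [WExpr.eval, h, Data.hd, enc]

theorem PT.snd' : PT (fun p : α × β => p.2) :=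
  PTW.of_expr (.tl (.hd X0)) (PB.self.mono esize_snd_le)
    fun a r σ h => by simp [WExpr.eval, h, Data.hd, Data.tl, enc]

@[fun_prop] theorem PT.fst {f : α → β × γ} (hf : PT f) : PT (fun a => (f a).1) := PT.fst'.comp hf

@[fun_prop] theorem PT.snd {f : α → β × γ} (hf : PT f) : PT (fun a => (f a).2) := PT.snd'.comp hf

theorem PT.of_eq {f g : α → β} (h : PT f) (H : ∀ a, f a = g a) : PT g := by
  rwa [← funext H]

@[fun_prop] theorem PT.cond {c : α → Bool} {f g : α → β} (hc : PT c) (hf : PT f) (hg : PT g) :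
    PT (fun a => bif c a then f a else g a) := by
  obtain ⟨p, T, hT, hs, hp⟩ := hf
  obtain ⟨q, U, hU, hs', hq⟩ := hg
  obtain ⟨w, W, hW, -, hw⟩ := hc
  let e1 : WExpr := .cons (.hd X0) X0
  let e2 : WExpr := .tl X0
  refine ⟨.seq (.assign 0 e1) (.seq w (.ite (.hd X0) (.seq (.assign 0 e2) p)
      (.seq (.assign 0 e2) q))),
    fun a => (e1.cost + 1) + (W a + ((WExpr.hd X0).cost + 1 + (e2.cost + 1 + (T a + U a)))),
    ?_, ?_, ?_⟩
  · exact (PB.const _).add (hW.add ((PB.const _).add ((PB.const _).add (hT.add hU))))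
  · refine (hs.add hs').mono fun a => ?_
    cases h : c a
    · simp [h]
    · simp [h]
  · intro a r
    have h1 : Runs (.assign 0 e1) (.cons (enc a) r) (.cons (enc a) (.cons (enc a) r))
        (e1.cost + 1) :=
      Runs.assign fun σ hσ => by simp [e1, WExpr.eval, hσ, Data.hd]
    have h2 : ∀ d, Runs (.assign 0 e2) (.cons d (.cons (enc a) r)) (.cons (enc a) r)
        (e2.cost + 1) := fun d =>
      Runs.assign fun σ hσ => by simp [e2, WExpr.eval, hσ, Data.tl]
    refine h1.seq ((hw a _).seq ?_)
    cases hca : c a <;> simp only [hca, cond_false, cond_true]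
    · refine (Runs.ite_false (e := .hd X0) (fun σ hσ => ?_) ((h2 _).seq (hq a r))).mono (by omega)
      simp [WExpr.eval, hσ, Data.hd, enc, encodeBit]
    · refine (Runs.ite_true (e := .hd X0) (fun σ hσ => ?_) ((h2 _).seq (hp a r))).mono (by omega)
      simp [WExpr.eval, hσ, Data.hd, enc, encodeBit]

/-- Iteration over a list, provided that the intermediate values stay small. -/
theorem PTW.foldl {μ : δ → ℕ} {l : δ → List α} {i : δ → β} {f : δ → β → α → β}
    (hμ : PB μ esize) (hl : PTW μ l) (hi : PTW μ i)
    (hf : PT (fun p : (δ × β) × α => f p.1.1 p.1.2 p.2))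
    {M : δ → ℕ} (hM : PB μ M)
    (hb : ∀ d l₁ l₂, l d = l₁ ++ l₂ → esize (l₁.foldl (f d) (i d)) ≤ M d) :
    PTW μ (fun d => (l d).foldl (f d) (i d)) := by
  have hd : PTW μ (fun d : δ => d) :=
    PTW.of_expr (.hd X0) hμ fun a r σ h => by simp [WExpr.eval, h, Data.hd]
  obtain ⟨p, T, hT, hs, hp⟩ := hl.pair (hi.pair hd)
  obtain ⟨q, U, hU, -, hq⟩ := hf
  obtain ⟨C, k, hU⟩ := hU
  have hL : PB μ (fun d => esize (l d)) := hs.mono fun d => by simp; omega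
  -- the stack of the loop is `((l, (acc, d)), r)`
  let e1 : WExpr := .cons (.cons (.cons (.tl (.tl (.hd X0))) (.hd (.tl (.hd X0))))
    (.hd (.hd (.hd X0)))) (.cons (.cons (.tl (.hd (.hd X0))) (.tl (.tl (.hd X0)))) (.tl X0))
  let e2 : WExpr := .cons (.cons (.hd (.hd (.tl X0))) (.cons (.hd X0) (.tl (.hd (.tl X0)))))
    (.tl (.tl X0))
  let e3 : WExpr := .cons (.hd (.tl (.hd X0))) (.tl X0)
  let c : WExpr := .hd (.hd X0)
  let body : WProg := .seq (.assign 0 e1) (.seq q (.assign 0 e2))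
  let V : δ → ℕ := fun d => C * (esize d + M d + esize (l d) + 2 + 1) ^ k
  have hV : PB μ V := by
    have h1 : PB μ (fun d => esize d + M d + esize (l d) + 2) :=
      ((hμ.add hM).add hL).add (PB.const 2)
    exact PB.trans (ν := fun d => esize d + M d + esize (l d) + 2) ⟨C, k, fun _ => le_rfl⟩ h1
  let K := c.cost + 1 + (e1.cost + 1 + (e2.cost + 1))
  have loop : ∀ d (l₂ l₁ : List α) r, l d = l₁ ++ l₂ →
      Runs (.loop c body) (.cons (enc (l₂, (l₁.foldl (f d) (i d), d))) r)
        (.cons (enc (([] : List α), ((l d).foldl (f d) (i d), d))) r)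
        (l₂.length * (K + V d) + (c.cost + 1)) := by
    intro d l₂
    induction l₂ with
    | nil =>
      intro l₁ r h
      rw [List.append_nil] at h
      rw [h]
      exact (Runs.loop_false fun σ hσ => by
        simp [c, WExpr.eval, hσ, Data.hd, enc, encodeList]).mono (by omega)
    | cons a l₂ ih =>
      intro l₁ r h
      have h' : l d = (l₁ ++ [a]) ++ l₂ := by simp [h]
      have hq' := hq ((d, l₁.foldl (f d) (i d)), a) (.cons (enc (l₂, d)) r)
      have hsz : U ((d, l₁.foldl (f d) (i d)), a) ≤ V d := by
        refine (hU _).trans (Nat.mul_le_mul_left _ (Nat.pow_le_pow_left ?_ k))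
        have h1 := hb d l₁ _ h
        have h2 : esize a ≤ esize (l d) := esize_mem_le (by rw [h]; simp)
        simp only [esize_pair]
        omega
      have hbody : Runs body (.cons (enc (a :: l₂, (l₁.foldl (f d) (i d), d))) r)
          (.cons (enc (l₂, ((l₁ ++ [a]).foldl (f d) (i d), d))) r)
          (e1.cost + 1 + (V d + (e2.cost + 1))) := by
        refine Runs.seq (Runs.assign fun σ hσ => ?_)
          (Runs.seq (hq'.mono hsz) (Runs.assign fun σ hσ => ?_))
        · simp [e1, WExpr.eval, hσ, Data.hd, Data.tl, enc, encodeList]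
        · simp [e2, WExpr.eval, hσ, Data.hd, Data.tl, enc]
      refine (Runs.loop_true (fun σ hσ => ?_) hbody (ih (l₁ ++ [a]) r h')).mono ?_
      · simp [c, WExpr.eval, hσ, Data.hd, enc, encodeList]
      · simp only [List.length_cons, K, add_mul, one_mul]; omega
  refine ⟨.seq p (.seq (.loop c body) (.assign 0 e3)),
    fun d => T d + (((esize (l d)) * (K + V d) + (c.cost + 1)) + (e3.cost + 1)), ?_, ?_, ?_⟩
  · exact hT.add (((hL.mul ((PB.const _).add hV)).add (PB.const _)).add (PB.const _))
  · exact hM.mono fun d => hb d (l d) [] (by simp)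
  · intro d r
    refine (hp d r).seq (((loop d (l d) [] r rfl).mono ?_).seq (Runs.assign fun σ hσ => ?_))
    · have := length_lt_esize (l d)
      have := Nat.mul_le_mul_right (K + V d) this.le
      omega
    · simp [e3, WExpr.eval, hσ, Data.hd, Data.tl, enc]

theorem PT.foldl {l : δ → List α} {i : δ → β} {f : δ → β → α → β}
    (hl : PT l) (hi : PT i) (hf : PT (fun p : (δ × β) × α => f p.1.1 p.1.2 p.2))
    {M : δ → ℕ} (hM : PB esize M)
    (hb : ∀ d l₁ l₂, l d = l₁ ++ l₂ → esize (l₁.foldl (f d) (i d)) ≤ M d) :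
    PT (fun d => (l d).foldl (f d) (i d)) :=
  PTW.foldl PB.self hl hi hf hM hb

theorem PT.size {f : α → β} (h : PT f) : PB esize (fun a => esize (f a)) :=
  let ⟨_, _, _, hs, _⟩ := h
  hs

end basic

section lists
variable [Enc α] [Enc β] [Enc γ] [Enc δ] [Enc ε]

/-- Only the encoding of the value matters. -/
theorem PT.enc_congr {f : α → β} {g : α → γ} (h : PT f) (H : ∀ a, enc (f a) = enc (g a)) : PT g := by
  obtain ⟨p, T, hT, hs, hp⟩ := h
  refine ⟨p, T, hT, hs.mono fun a => ?_, fun a r => ?_⟩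
  · rw [esize, esize, H]
  · rw [← H]; exact hp a r

@[fun_prop] theorem PT.not {f : α → Bool} (hf : PT f) : PT (fun a => !f a) :=
  PT.of_eq (f := fun a => bif f a then false else true) (by fun_prop) fun a => by cases f a <;> rfl

@[fun_prop] theorem PT.and {f g : α → Bool} (hf : PT f) (hg : PT g) : PT (fun a => f a && g a) :=
  PT.of_eq (f := fun a => bif f a then g a else false) (by fun_prop) fun a => by cases f a <;> rfl

@[fun_prop] theorem PT.or {f g : α → Bool} (hf : PT f) (hg : PT g) : PT (fun a => f a || g a) :=
  PT.of_eq (f := fun a => bif f a then true else g a) (by fun_prop) fun a => by cases f a <;> rfl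

@[fun_prop] theorem PT.xor {f g : α → Bool} (hf : PT f) (hg : PT g) :
    PT (fun a => (f a).xor (g a)) :=
  PT.of_eq (f := fun a => bif f a then !g a else g a) (by fun_prop) fun a => by
    cases f a <;> cases g a <;> rfl

@[fun_prop] theorem PT.beq_bool {f g : α → Bool} (hf : PT f) (hg : PT g) :
    PT (fun a => f a == g a) :=
  PT.of_eq (f := fun a => bif f a then g a else !g a) (by fun_prop) fun a => by
    cases f a <;> cases g a <;> rfl

@[fun_prop] theorem PT.cons {f : α → β} {g : α → List β} (hf : PT f) (hg : PT g) :
    PT (fun a => f a :: g a) :=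
  (hf.mk hg).enc_congr fun _ => rfl

@[fun_prop] theorem PT.tail {f : α → List β} (hf : PT f) : PT (fun a => (f a).tail) := by
  have h : PT (fun l : List β => l.tail) :=
    PTW.of_expr (.tl (.hd X0)) (PB.self.mono fun l => esize_sublist l.tail_sublist)
      fun l r σ h => by cases l <;> simp [WExpr.eval, h, Data.hd, Data.tl, enc, encodeList]
  exact h.comp hf

theorem PT.foldl_cons {f g : α → List β} (hf : PT f) (hg : PT g) :
    PT (fun a => (f a).reverse ++ g a) := by
  have key : ∀ l m : List β, l.foldl (fun acc b => b :: acc) m = l.reverse ++ m := by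
    intro l
    induction l with
    | nil => simp
    | cons b l ih => intro m; simp [ih]
  have h : PT (fun p : List β × List β => p.1.foldl (fun acc b => b :: acc) p.2) := by
    refine PT.foldl (by fun_prop) (by fun_prop) (by fun_prop) (M := esize) PB.self ?_
    rintro ⟨l, m⟩ l₁ l₂ rfl
    rw [key]
    have h1 := esize_append l₁.reverse m
    have h2 := esize_perm l₁.reverse_perm
    have h3 := esize_append l₁ l₂
    have h4 := esize_pos l₂
    have h5 := esize_pos m
    simp only [esize_pair]; omega
  exact (h.comp (hf.mk hg)).of_eq fun a => key _ _

@[fun_prop] theorem PT.reverse {f : α → List β} (hf : PT f) : PT (fun a => (f a).reverse) :=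
  (PT.foldl_cons hf (PT.const [])).of_eq fun a => by simp

@[fun_prop] theorem PT.append {f g : α → List β} (hf : PT f) (hg : PT g) :
    PT (fun a => f a ++ g a) :=
  (PT.foldl_cons hf.reverse hg).of_eq fun a => by simp

@[fun_prop] theorem PT.headD {f : α → List β} {g : α → β} (hf : PT f) (hg : PT g) :
    PT (fun a => (f a).headD (g a)) := by
  have key : ∀ (l : List β) b, l.reverse.foldl (fun _ c => c) b = l.headD b := by
    intro l b; cases l <;> simp
  have h : PT (fun p : List β × β => p.1.foldl (fun _ c => c) p.2) := by
    refine PT.foldl (by fun_prop) (by fun_prop) (by fun_prop) (M := esize) PB.self ?_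
    rintro ⟨l, b⟩ l₁ l₂ h
    rcases List.eq_nil_or_concat l₁ with rfl | ⟨l₃, c, rfl⟩
    · simp; omega
    · have : esize c ≤ esize l := esize_mem_le (by simp only at h; rw [h]; simp)
      simp; omega
  exact (h.comp (hf.reverse.mk hg)).of_eq fun a => key _ _

@[fun_prop] theorem PT.any {f : α → List β} {p : α → β → Bool} (hf : PT f)
    (hp : PT (fun q : α × β => p q.1 q.2)) : PT (fun a => (f a).any (p a)) := by
  have key : ∀ (p : β → Bool) (l : List β) c, l.foldl (fun acc b => acc || p b) c = (c || l.any p) := by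
    intro p l
    induction l with
    | nil => simp
    | cons b l ih => intro c; simp [ih, Bool.or_assoc]
  have h : PT (fun a => (f a).foldl (fun acc b => acc || p a b) false) := by
    refine PT.foldl hf (by fun_prop) ?_ (PB.const 3) fun _ _ _ _ => esize_bool_le _
    have : PT (fun q : (α × Bool) × β => p q.1.1 q.2) := hp.comp (f := fun q : (α × Bool) × β =>
      (q.1.1, q.2)) (by fun_prop)
    fun_prop
  exact h.of_eq fun a => by simp [key]

@[fun_prop] theorem PT.all {f : α → List β} {p : α → β → Bool} (hf : PT f)
    (hp : PT (fun q : α × β => p q.1 q.2)) : PT (fun a => (f a).all (p a)) :=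
  (PT.any (p := fun a b => !p a b) hf (PT.not hp)).not.of_eq fun a => by
    simp [List.any_eq_not_all_not]

theorem PB.list_le {f : α → List β} {T : α → β → ℕ} (hf : PB esize fun a => esize (f a))
    (hT : PB esize (fun q : α × β => T q.1 q.2)) :
    ∃ M : α → ℕ, PB esize M ∧ ∀ a, ∀ b ∈ f a, T a b ≤ M a := by
  obtain ⟨C, k, h⟩ := hT
  refine ⟨fun a => C * (esize a + esize (f a) + 1 + 1) ^ k,
    PB.trans (ν := fun a => esize a + esize (f a) + 1) ⟨C, k, fun _ => le_rfl⟩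
      ((PB.self.add hf).add (PB.const 1)), fun a b hb => (h (a, b)).trans ?_⟩
  have := esize_mem_le hb
  simp only [esize_pair]
  exact Nat.mul_le_mul_left _ (Nat.pow_le_pow_left (by omega) _)

@[fun_prop] theorem PT.map {f : α → List β} {g : α → β → γ} (hf : PT f)
    (hg : PT (fun q : α × β => g q.1 q.2)) : PT (fun a => (f a).map (g a)) := by
  have key : ∀ (g : β → γ) (l : List β) c,
      l.foldl (fun acc b => g b :: acc) c = (l.map g).reverse ++ c := by
    intro p l
    induction l with
    | nil => simp
    | cons b l ih => intro c; simp [ih]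
  obtain ⟨M, hM, hle⟩ := PB.list_le (T := fun a b => esize (g a b)) hf.size hg.size
  have h : PT (fun a => (f a).foldl (fun acc b => g a b :: acc) []) := by
    refine PT.foldl hf (by fun_prop) ?_ (M := fun a => esize (f a) * (M a + 1) + 1)
      ((hf.size.mul (hM.add (PB.const 1))).add (PB.const 1)) fun a l₁ l₂ h => ?_
    · have : PT (fun q : (α × List γ) × β => g q.1.1 q.2) :=
        hg.comp (f := fun q : (α × List γ) × β => (q.1.1, q.2)) (by fun_prop)
      fun_prop
    · rw [key, List.append_nil, esize_perm (List.reverse_perm _)]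
      refine (esize_le_of_forall (M := M a) ?_).trans ?_
      · intro c hc
        obtain ⟨b, hb, rfl⟩ := List.mem_map.1 hc
        exact hle a b (by rw [h]; simp [hb])
      · have h1 := length_lt_esize (f a)
        rw [h, List.length_append] at h1
        rw [List.length_map]
        have : l₁.length ≤ esize (f a) := by rw [h]; omega
        have := Nat.mul_le_mul_right (M a + 1) this
        omega
  exact h.reverse.of_eq fun a => by simp [key]

@[fun_prop] theorem PT.filter {f : α → List β} {p : α → β → Bool} (hf : PT f)
    (hp : PT (fun q : α × β => p q.1 q.2)) : PT (fun a => (f a).filter (p a)) := by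
  have key : ∀ (p : β → Bool) (l : List β) c,
      l.foldl (fun acc b => bif p b then b :: acc else acc) c = (l.filter p).reverse ++ c := by
    intro p l
    induction l with
    | nil => simp
    | cons b l ih => intro c; cases h : p b <;> simp [ih, h]
  have h : PT (fun a => (f a).foldl (fun acc b => bif p a b then b :: acc else acc) []) := by
    refine PT.foldl hf (by fun_prop) ?_ hf.size fun a l₁ l₂ h => ?_
    · have : PT (fun q : (α × List β) × β => p q.1.1 q.2) :=
        hp.comp (f := fun q : (α × List β) × β => (q.1.1, q.2)) (by fun_prop)
      fun_prop
    · rw [key, List.append_nil, esize_perm (List.reverse_perm _)]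
      exact esize_sublist (List.filter_sublist.trans (by rw [h]; simp))
  exact h.reverse.of_eq fun a => by simp [key]

@[fun_prop] theorem PT.flatten {f : α → List (List β)} (hf : PT f) : PT (fun a => (f a).flatten) := by
  have key : ∀ (l : List (List β)) c, l.foldl (fun acc b => acc ++ b) c = c ++ l.flatten := by
    intro l
    induction l with
    | nil => simp
    | cons b l ih => intro c; simp [ih]
  have hsz : ∀ l : List (List β), esize l.flatten ≤ esize l := by
    intro l
    induction l with
    | nil => simp
    | cons b l ih =>
      have := esize_append b l.flatten
      simp only [List.flatten_cons, esize_cons]; omega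
  have h : PT (fun a => (f a).foldl (fun acc b => acc ++ b) []) := by
    refine PT.foldl hf (by fun_prop) (by fun_prop) hf.size fun a l₁ l₂ h => ?_
    rw [key, List.nil_append]
    exact (hsz _).trans (esize_sublist (by rw [h]; simp))
  exact h.of_eq fun a => by simp [key]

@[fun_prop] theorem PT.flatMap {f : α → List β} {g : α → β → List γ} (hf : PT f)
    (hg : PT (fun q : α × β => g q.1 q.2)) : PT (fun a => (f a).flatMap (g a)) :=
  (PT.flatten (PT.map hf hg)).of_eq fun a => by rw [List.flatMap_def]

@[fun_prop] theorem PT.product {f : α → List β} {g : α → List γ} (hf : PT f) (hg : PT g) :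
    PT (fun a => (f a).product (g a)) :=
  PT.of_eq (f := fun a => (f a).flatMap fun b => (g a).map fun c => (b, c)) (by fun_prop)
    fun a => rfl

@[fun_prop] theorem PT.isEmpty {f : α → List β} (hf : PT f) : PT (fun a => (f a).isEmpty) :=
  (PT.any (p := fun _ _ => true) hf (PT.const _)).not.of_eq fun a => by cases f a <;> simp

end lists

/-! ### Equality tests -/

section eqTest

noncomputable instance : DecidableEq Data := Classical.decEq _

/-- One step of the comparison of two trees. The stack holds a list of pairs that are still to be
compared, and a flag, which is not `nil` as long as no difference has been found. -/
def eqBody : WProg :=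
  -- stack: `((x, y) :: W, flag) :: r`
  let top := WExpr.hd X0
  let x := WExpr.hd (.hd (.hd top))
  let y := WExpr.tl (.hd (.hd top))
  let W := WExpr.tl (.hd top)
  let fl := WExpr.tl top
  let fail := WProg.assign 0 (.cons (.cons W .nil) (.tl X0))
  let next := WProg.assign 0 (.cons (.cons W fl) (.tl X0))
  let push := WProg.assign 0 (.cons (.cons (.cons (.cons (.hd x) (.hd y))
    (.cons (.cons (.tl x) (.tl y)) W)) fl) (.tl X0))
  .ite x (.ite y push fail) (.ite y fail next)

theorem eqLoop (x y W : Data) (b : Bool) (r d : Data) (B : ℕ)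
    (h : Runs (.loop (.hd (.hd X0)) eqBody)
      (.cons (.cons W (encodeBit (b && decide (x = y)))) r) d B) :
    Runs (.loop (.hd (.hd X0)) eqBody) (.cons (.cons (.cons (.cons x y) W) (encodeBit b)) r) d
      (60 * x.size + B) := by
  induction x generalizing y W b B with
  | nil =>
    cases y with
    | nil =>
      refine (Runs.loop_true (d₁ := .cons (.cons W (encodeBit b)) r) (fun σ hσ => ?_)
        (Runs.ite_false (fun σ hσ => ?_) (Runs.ite_false (fun σ hσ => ?_)
        (Runs.assign fun σ hσ => ?_))) ?_).mono (A := _ + B) ?_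
      · simp [WExpr.eval, hσ, Data.hd]
      · simp [WExpr.eval, hσ, Data.hd]
      · simp [WExpr.eval, hσ, Data.hd, Data.tl]
      · simp [WExpr.eval, hσ, Data.hd, Data.tl]
      · simpa [eqBody] using h
      · simp [WExpr.cost, Data.size]
    | cons y₁ y₂ =>
      refine (Runs.loop_true (d₁ := .cons (.cons W .nil) r) (fun σ hσ => ?_)
        (Runs.ite_false (fun σ hσ => ?_) (Runs.ite_true (fun σ hσ => ?_)
        (Runs.assign fun σ hσ => ?_))) ?_).mono (A := _ + B) ?_
      · simp [WExpr.eval, hσ, Data.hd]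
      · simp [WExpr.eval, hσ, Data.hd]
      · simp [WExpr.eval, hσ, Data.hd, Data.tl]
      · simp [WExpr.eval, hσ, Data.hd, Data.tl]
      · simpa [encodeBit, eqBody] using h
      · simp [WExpr.cost, Data.size]
  | cons x₁ x₂ ih₁ ih₂ =>
    cases y with
    | nil =>
      refine (Runs.loop_true (d₁ := .cons (.cons W .nil) r) (fun σ hσ => ?_)
        (Runs.ite_true (fun σ hσ => ?_) (Runs.ite_false (fun σ hσ => ?_)
        (Runs.assign fun σ hσ => ?_))) ?_).mono (A := _ + B) ?_
      · simp [WExpr.eval, hσ, Data.hd]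
      · simp [WExpr.eval, hσ, Data.hd]
      · simp [WExpr.eval, hσ, Data.hd, Data.tl]
      · simp [WExpr.eval, hσ, Data.hd, Data.tl]
      · simpa [encodeBit, eqBody] using h
      · have := x₁.size_pos
        simp [WExpr.cost, Data.size]; omega
    | cons y₁ y₂ =>
      have h2 := ih₂ y₂ W (b && decide (x₁ = y₁)) B (by
        convert h using 4
        by_cases h1 : x₁ = y₁ <;> by_cases h2 : x₂ = y₂ <;> simp [h1, h2])
      have h1 := ih₁ y₁ _ b _ h2
      refine (Runs.loop_true (fun σ hσ => ?_)
        (Runs.ite_true (fun σ hσ => ?_) (Runs.ite_true (fun σ hσ => ?_)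
        (Runs.assign fun σ hσ => ?_))) h1).mono ?_
      · simp [WExpr.eval, hσ, Data.hd]
      · simp [WExpr.eval, hσ, Data.hd]
      · simp [WExpr.eval, hσ, Data.hd, Data.tl]
      · simp [WExpr.eval, hσ, Data.hd, Data.tl]
      · simp [WExpr.cost, Data.size]; omega

theorem PT.data_eq : PT (fun p : Data × Data => decide (p.1 = p.2)) := by
  let e1 : WExpr := .cons (.cons (.cons (.hd X0) .nil) (.cons .nil .nil)) (.tl X0)
  let e2 : WExpr := .cons (.tl (.hd X0)) (.tl X0)
  refine ⟨.seq (.assign 0 e1) (.seq (.loop (.hd (.hd X0)) eqBody) (.assign 0 e2)),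
    fun p => e1.cost + 1 + ((60 * esize p + 4) + (e2.cost + 1)), ?_,
    (PB.const 3).mono fun _ => esize_bool_le _, ?_⟩
  · exact (PB.const _).add ((((PB.const _).mul PB.self).add (PB.const _)).add (PB.const _))
  · rintro ⟨x, y⟩ r
    refine Runs.seq (Runs.assign fun σ hσ => ?_) (((eqLoop x y .nil true r _ 4
      (Runs.loop_false fun σ hσ => ?_)).mono ?_).seq (Runs.assign fun σ hσ => ?_))
    · simp [e1, WExpr.eval, hσ, Data.hd, Data.tl, enc, encodeBit]
    · simp [WExpr.eval, hσ, Data.hd]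
    · simp only [esize_pair]
      have : x.size = esize x := rfl
      omega
    · simp [e2, WExpr.eval, hσ, Data.hd, Data.tl, enc]

@[fun_prop] theorem PT.eq [Enc α] [Enc β] {f g : α → β} [∀ a, Decidable (f a = g a)]
    (hf : PT f) (hg : PT g) : PT (fun a => decide (f a = g a)) := by
  have h : PT (fun a => decide (enc (f a) = enc (g a))) := PT.data_eq.comp
    ((hf.enc_congr (g := fun a => enc (f a)) fun _ => rfl).mk
      (hg.enc_congr (g := fun a => enc (g a)) fun _ => rfl))
  exact h.of_eq fun a => by simp [Enc.inj.eq_iff]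

end eqTest

/-! ### Arithmetic in binary -/

section arith
variable [Enc α] [Enc β] [Enc γ]

@[fun_prop] theorem PT.bits {f : α → ℕ} (hf : PT f) : PT (fun a => (f a).bits) :=
  hf.enc_congr fun _ => rfl

@[fun_prop] theorem PT.bit {b : α → Bool} {f : α → ℕ} (hb : PT b) (hf : PT f) :
    PT (fun a => Nat.bit (b a) (f a)) := by
  have h : PT (fun a => bif b a || !decide (f a = 0) then b a :: (f a).bits else []) := by
    fun_prop
  refine h.enc_congr fun a => ?_
  change _ = enc (Nat.bits _)
  by_cases h0 : f a = 0 → b a = true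
  · rw [Nat.bits_append_bit _ _ h0]
    have : (b a || !decide (f a = 0)) = true := by
      by_cases h1 : f a = 0 <;> simp [h1]
      exact h0 h1
    simp [this]
  · push Not at h0
    simp [h0.1, h0.2]

/-- The number with the given binary digits, the most significant one first. -/
def ofMSB (l : List Bool) (n : ℕ) : ℕ := l.foldl (fun n b => Nat.bit b n) n

theorem ofMSB_lt (l : List Bool) (n k : ℕ) (h : n < 2 ^ k) : ofMSB l n < 2 ^ (k + l.length) := by
  induction l generalizing n k with
  | nil => simpa [ofMSB]
  | cons b l ih =>
    have : Nat.bit b n < 2 ^ (k + 1) := by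
      rw [pow_succ]; cases b <;> simp [Nat.bit_val] <;> omega
    have := ih _ _ this
    rw [List.length_cons, add_comm l.length, ← add_assoc]
    exact this

@[fun_prop] theorem PT.ofMSB_zero {l : α → List Bool} (hl : PT l) : PT (fun a => ofMSB (l a) 0) := by
  refine PT.foldl hl (PT.const _) (by fun_prop) (M := fun a => 4 * esize (l a) + 1)
    (((PB.const 4).mul hl.size).add (PB.const 1)) fun a l₁ l₂ h => ?_
  have h1 := ofMSB_lt l₁ 0 0 (by simp)
  refine (esize_nat_le h1).trans ?_
  have := length_lt_esize (l a)
  rw [h, List.length_append, ← h] at this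
  omega

/-- The number with the given binary digits, the least significant one first. -/
def ofLSB (l : List Bool) : ℕ := l.foldr Nat.bit 0

theorem ofLSB_bits (n : ℕ) : ofLSB n.bits = n := by
  induction n using Nat.binaryRec' with
  | zero => rfl
  | bit c n hn ih => rw [Nat.bits_append_bit _ _ hn, ofLSB, List.foldr_cons, ← ofLSB, ih]

@[simp] theorem ofLSB_nil : ofLSB [] = 0 := rfl

@[simp] theorem ofLSB_cons (b : Bool) (l : List Bool) : ofLSB (b :: l) = Nat.bit b (ofLSB l) := rfl

/-- Addition with carry: the digits of both numbers, the carry, and the digits of the sum found so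
far, the most significant one first. -/
def addStep (s : (List Bool × List Bool) × (Bool × List Bool)) (_ : Bool) :
    (List Bool × List Bool) × (Bool × List Bool) :=
  let x := s.1.1.headD false
  let y := s.1.2.headD false
  ((s.1.1.tail, s.1.2.tail), ((x && y || (s.2.1 && (x || y))), (x.xor y).xor s.2.1 :: s.2.2))

theorem foldl_addStep (T : List Bool) : ∀ (x y : List Bool) (c : Bool) (out : List Bool),
    x.length ≤ T.length → y.length ≤ T.length →
    ofMSB ((T.foldl addStep ((x, y), (c, out))).2.1 :: (T.foldl addStep ((x, y), (c, out))).2.2) 0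
      = ofMSB out (ofLSB x + ofLSB y + c.toNat) := by
  induction T with
  | nil =>
    intro x y c out hx hy
    simp only [List.length_nil, Nat.le_zero, List.length_eq_zero_iff] at hx hy
    subst hx hy
    cases c <;> simp [ofMSB, Nat.bit_val]
  | cons t T ih =>
    intro x y c out hx hy
    rw [List.foldl_cons]
    change ofMSB ((T.foldl addStep ((x.tail, y.tail), (_, _))).2.1 ::
      (T.foldl addStep ((x.tail, y.tail), (_, _))).2.2) 0 = _
    simp only [List.length_cons] at hx hy
    rw [ih _ _ _ _ (by simp; omega) (by simp; omega)]
    rw [ofMSB, List.foldl_cons, ← ofMSB]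
    congr 1
    rcases x with _ | ⟨a, x⟩ <;> rcases y with _ | ⟨b, y⟩ <;>
      simp only [List.tail_nil, List.tail_cons, List.headD_nil, List.headD_cons, ofLSB_nil,
        ofLSB_cons, Nat.bit_val] <;> cases c <;> try cases a
    all_goals try cases b
    all_goals simp
    all_goals omega

theorem esize_foldl_addStep (T : List Bool) : ∀ s, esize (T.foldl addStep s) ≤
    esize s + 6 * T.length + 6 := by
  have key : ∀ (T : List Bool) (x y : List Bool) (c : Bool) (out : List Bool),
      esize (T.foldl addStep ((x, y), (c, out))) ≤
      esize x + esize y + esize out + 6 + 6 * T.length := by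
    intro T
    induction T with
    | nil => intro x y c out; have := esize_bool_le c; simp; omega
    | cons t T ih =>
      intro x y c out
      refine (ih x.tail y.tail _ _).trans ?_
      have h1 := esize_sublist x.tail_sublist
      have h2 := esize_sublist y.tail_sublist
      have h3 := esize_bool_le (((x.headD false).xor (y.headD false)).xor c)
      simp only [esize_cons, List.length_cons]; omega
  rintro ⟨⟨x, y⟩, ⟨c, out⟩⟩
  have := key T x y c out
  have := esize_pos c
  simp only [esize_pair]; omega

@[fun_prop] theorem PT.add {f g : α → ℕ} (hf : PT f) (hg : PT g) : PT (fun a => f a + g a) := by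
  have h : PT (fun a => ((f a).bits ++ (g a).bits).foldl addStep
      (((f a).bits, (g a).bits), (false, []))) := by
    refine PT.foldl (by fun_prop) (by fun_prop) ?_
      (M := fun a => esize (f a) + esize (g a) + 6 + 6 * (esize (f a) + esize (g a)) + 6)
      ?_ fun a l₁ l₂ h => (esize_foldl_addStep _ _).trans ?_
    · unfold addStep; fun_prop
    · exact (((hf.size.add hg.size).add (PB.const _)).add
        ((PB.const _).mul (hf.size.add hg.size))).add (PB.const _)
    · have h1 := length_lt_esize (f a).bits
      have h2 := length_lt_esize (g a).bits
      have h3 := congrArg List.length h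
      simp only [List.length_append] at h3
      have h4 : esize false = 1 := rfl
      simp only [esize_pair, esize_nil, ← esize_nat] at h1 h2 ⊢
      omega
  refine PT.of_eq (f := fun a => ofMSB ((((f a).bits ++ (g a).bits).foldl addStep
      (((f a).bits, (g a).bits), (false, []))).2.1 :: (((f a).bits ++ (g a).bits).foldl addStep
      (((f a).bits, (g a).bits), (false, []))).2.2) 0) (by fun_prop) fun a => ?_
  rw [foldl_addStep _ _ _ _ _ (by simp) (by simp)]
  simp [ofLSB_bits, ofMSB]

/-- One step of the comparison of two numbers by their digits, from the least significant one. -/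
def leStep (s : List Bool × Bool) (b : Bool) : List Bool × Bool :=
  (s.1.tail, bif s.1.headD false then (!b || s.2) else (!b && s.2))

theorem foldl_leStep (x : List Bool) : ∀ (y : List Bool) (c : Bool),
    ((x.foldl leStep (y, c)).1.any (fun b => b) || (x.foldl leStep (y, c)).2) =
      decide (ofLSB x < ofLSB y ∨ ofLSB x = ofLSB y ∧ c = true) := by
  induction x with
  | nil =>
    intro y c
    have h : ∀ y : List Bool, y.any (fun b => b) = decide (0 < ofLSB y) := by
      intro y
      induction y with
      | nil => rfl
      | cons b y ih => cases b <;> simp [ih, Nat.bit_val]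
    simp only [List.foldl_nil, h, ofLSB_nil]
    rcases Nat.eq_zero_or_pos (ofLSB y) with h | h <;> cases c <;> simp [h]
  | cons a x ih =>
    intro y c
    rw [List.foldl_cons]
    simp only [leStep]
    rw [ih]
    rcases y with _ | ⟨b, y⟩
    · rw [Bool.eq_iff_iff]
      cases a <;> cases c <;> simp [Nat.bit_val]
    · rw [Bool.eq_iff_iff]
      cases a <;> cases b <;> cases c <;> simp [Nat.bit_val] <;> omega

@[fun_prop] theorem PT.le {f g : α → ℕ} (hf : PT f) (hg : PT g) :
    PT (fun a => decide (f a ≤ g a)) := by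
  have h : PT (fun a => (f a).bits.foldl leStep ((g a).bits, true)) := by
    refine PT.foldl (by fun_prop) (by fun_prop) ?_ (M := fun a => esize (g a) + 4)
      (hg.size.add (PB.const 4)) fun a l₁ l₂ h => ?_
    · unfold leStep; fun_prop
    · have key : ∀ (l y : List Bool) (c : Bool), esize (l.foldl leStep (y, c)) ≤ esize y + 4 := by
        intro l
        induction l with
        | nil => intro y c; have := esize_bool_le c; simp; omega
        | cons b l ih =>
          intro y c
          exact (ih y.tail _).trans (by have := esize_sublist y.tail_sublist; omega)
      exact key _ _ _
  refine PT.of_eq (f := fun a => ((f a).bits.foldl leStep ((g a).bits, true)).1.any (fun b => b) ||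
      ((f a).bits.foldl leStep ((g a).bits, true)).2) (by fun_prop) fun a => ?_
  rw [foldl_leStep]
  simp only [ofLSB_bits, and_true]
  exact decide_eq_decide.2 (by omega)

@[fun_prop] theorem PT.div2 {f : α → ℕ} (hf : PT f) : PT (fun a => (f a).div2) :=
  PT.enc_congr (f := fun a => (f a).bits.tail) (by fun_prop) fun a => by
    rw [← Nat.div2_bits_eq_tail]; rfl

@[fun_prop] theorem PT.bodd {f : α → ℕ} (hf : PT f) : PT (fun a => (f a).bodd) :=
  PT.of_eq (f := fun a => (f a).bits.headD false) (by fun_prop) fun a => by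
    rw [Nat.bodd_eq_bits_head]; cases (f a).bits <;> rfl

/-- One step of the subtraction of one: the borrow, and the digits found so far. -/
def predStep (s : Bool × List Bool) (b : Bool) : Bool × List Bool :=
  (s.1 && !b, s.1.xor b :: s.2)

theorem foldl_predStep (x : List Bool) : ∀ (c : Bool) (out : List Bool), c.toNat ≤ ofLSB x →
    ofMSB (x.foldl predStep (c, out)).2 0 = ofMSB out (ofLSB x - c.toNat) := by
  induction x with
  | nil => intro c out h; cases c <;> simp_all
  | cons b x ih =>
    intro c out h
    rw [List.foldl_cons, predStep, ih]
    · rw [ofMSB, List.foldl_cons, ← ofMSB]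
      congr 1
      rw [ofLSB_cons] at h ⊢
      cases c <;> cases b <;> simp [Nat.bit_val] at h ⊢
      omega
    · cases c <;> cases b <;> simp [Nat.bit_val] at h ⊢
      omega

@[fun_prop] theorem PT.pred {f : α → ℕ} (hf : PT f) : PT (fun a => f a - 1) := by
  have h : PT (fun a => (f a).bits.foldl predStep (!decide (f a = 0), [])) := by
    refine PT.foldl (by fun_prop) (by fun_prop) ?_ (M := fun a => 4 * esize (f a) + 5)
      (((PB.const 4).mul hf.size).add (PB.const _)) fun a l₁ l₂ h => ?_
    · unfold predStep; fun_prop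
    · have key : ∀ (l : List Bool) (c : Bool) (out : List Bool),
          esize (l.foldl predStep (c, out)) ≤ 4 * l.length + esize out + 4 := by
        intro l
        induction l with
        | nil => intro y c; have := esize_bool_le y; simp; omega
        | cons b l ih =>
          intro c out
          refine (ih _ _).trans ?_
          have := esize_bool_le (c.xor b)
          simp only [esize_cons, List.length_cons]; omega
      refine (key _ _ _).trans ?_
      have h1 := length_lt_esize (f a).bits
      rw [h, List.length_append, ← h, ← esize_nat] at h1
      simp only [esize_nil]; omega
  refine PT.of_eq (f := fun a => ofMSB ((f a).bits.foldl predStep (!decide (f a = 0), [])).2 0)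
    (by fun_prop) fun a => ?_
  rw [foldl_predStep]
  · rw [ofLSB_bits]
    by_cases h0 : f a = 0 <;> simp [h0, ofMSB]
  · rw [ofLSB_bits]
    by_cases h0 : f a = 0 <;> simp [h0]; omega

theorem lt_two_pow_esize (n : ℕ) : n < 2 ^ esize n := by
  have h : n < 2 ^ n.bits.length := by rw [Nat.size_eq_bits_len]; exact Nat.lt_size_self n
  exact h.trans_le (Nat.pow_le_pow_right (by omega) (length_lt_esize n.bits).le)

@[fun_prop] theorem PT.sum {f : α → List ℕ} (hf : PT f) : PT (fun a => (f a).sum) := by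
  have key : ∀ l : List ℕ, l.sum < 2 ^ esize l := by
    intro l
    induction l with
    | nil => simp
    | cons n l ih =>
      have h1 := lt_two_pow_esize n
      have h2 : 2 ^ esize n ≤ 2 ^ (esize n + esize l) := Nat.pow_le_pow_right (by omega) (by omega)
      have h3 : 2 ^ esize l ≤ 2 ^ (esize n + esize l) := Nat.pow_le_pow_right (by omega) (by omega)
      rw [List.sum_cons, esize_cons, pow_succ]; omega
  refine PT.of_eq (f := fun a => (f a).foldl (fun s n => s + n) 0)
    (PT.foldl hf (PT.const _) (by fun_prop) (M := fun a => 4 * esize (f a) + 1)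
    (((PB.const 4).mul hf.size).add (PB.const 1)) fun a l₁ l₂ h => ?_) fun a => List.sum_eq_foldl.symm
  have h1 := (key l₁).trans_le (Nat.pow_le_pow_right (by omega)
    (esize_sublist (m := f a) (by rw [h]; simp)))
  rw [← List.sum_eq_foldl]
  exact esize_nat_le h1

@[fun_prop] theorem PT.length {f : α → List β} (hf : PT f) : PT (fun a => (f a).length) :=
  PT.of_eq (f := fun a => ((f a).map fun _ => 1).sum) (by fun_prop) fun a => by simp

@[fun_prop] theorem PT.range {f : α → List β} (hf : PT f) :
    PT (fun a => List.range (f a).length) := by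
  have key : ∀ l : List β, l.foldl (fun (s : List ℕ) _ => s.length :: s) [] =
      (List.range l.length).reverse := by
    intro l
    induction l using List.reverseRecOn with
    | nil => rfl
    | append_singleton l b ih => rw [List.foldl_append, ih]; simp [List.range_succ]
  have h : PT (fun a => (f a).foldl (fun (s : List ℕ) _ => s.length :: s) []) := by
    refine PT.foldl hf (PT.const _) (by fun_prop)
      (M := fun a => esize (f a) * (4 * esize (f a) + 1 + 1) + 1)
      ((hf.size.mul ((((PB.const 4).mul hf.size).add (PB.const _)).add (PB.const _))).add
        (PB.const _)) fun a l₁ l₂ h => ?_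
    rw [key, esize_perm (List.reverse_perm _)]
    have h1 := length_lt_esize (f a)
    rw [h, List.length_append, ← h] at h1
    refine (esize_le_of_forall (M := 4 * esize (f a) + 1) fun n hn => ?_).trans ?_
    · rw [List.mem_range] at hn
      exact esize_nat_le (Nat.lt_two_pow_self.trans
        (Nat.pow_lt_pow_right (by omega) (by omega)))
    · rw [List.length_range]
      exact Nat.add_le_add_right (Nat.mul_le_mul_right _ (by omega)) 1
  exact h.reverse.of_eq fun a => by rw [key, List.reverse_reverse]

@[fun_prop] theorem PT.drop {f : α → List β} {g : α → List γ} (hf : PT f) (hg : PT g) :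
    PT (fun a => (f a).drop (g a).length) := by
  have key : ∀ (m : List γ) (l : List β), m.foldl (fun l _ => l.tail) l = l.drop m.length := by
    intro m
    induction m with
    | nil => simp
    | cons b m ih => intro l; simp [ih, List.drop_tail]
  refine PT.of_eq (f := fun a => (g a).foldl (fun l _ => l.tail) (f a))
    (PT.foldl hg hf (by fun_prop) hf.size fun a l₁ l₂ h => ?_) fun a => key _ _
  rw [key]
  exact esize_sublist (List.drop_sublist _ _)

/-- One step of the pairing of two lists. -/
def zipStep [Inhabited γ] (s : List γ × List (β × γ)) (b : β) : List γ × List (β × γ) :=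
  bif s.1.isEmpty then s else (s.1.tail, (b, s.1.headD default) :: s.2)

omit [Enc β] [Enc γ] in
theorem foldl_zipStep [Inhabited γ] (l : List β) : ∀ (m : List γ) (out : List (β × γ)),
    (l.foldl zipStep (m, out)).2 = (l.zip m).reverse ++ out := by
  induction l with
  | nil => simp
  | cons b l ih =>
    intro m out
    cases m with
    | nil => rw [List.foldl_cons, zipStep]; simp [ih]
    | cons c m => rw [List.foldl_cons, zipStep]; simp [ih]

@[fun_prop] theorem PT.zip [Inhabited γ] {f : α → List β} {g : α → List γ} (hf : PT f)
    (hg : PT g) : PT (fun a => (f a).zip (g a)) := by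
  have h : PT (fun a => (f a).foldl zipStep (g a, [])) := by
    refine PT.foldl hf (by fun_prop) ?_ (M := fun a => 2 * (esize (f a) + esize (g a)) + 2)
      (((PB.const 2).mul (hf.size.add hg.size)).add (PB.const 2)) fun a l₁ l₂ h => ?_
    · unfold zipStep; fun_prop
    · have key : ∀ (l : List β) (m : List γ) (out : List (β × γ)),
          esize (l.foldl zipStep (m, out)) ≤ 2 * esize l + 2 * esize m + esize out := by
        intro l
        induction l with
        | nil => intro m out; simp; omega
        | cons b l ih =>
          intro m out
          cases m with
          | nil =>
            rw [List.foldl_cons, zipStep]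
            refine (ih _ _).trans ?_
            simp only [esize_cons]; omega
          | cons c m =>
            rw [List.foldl_cons, zipStep]
            refine (ih _ _).trans ?_
            simp; omega
      refine (key _ _ _).trans ?_
      have : esize l₁ ≤ esize (f a) := esize_sublist (by rw [h]; simp)
      simp only [esize_nil]; omega
  refine PT.of_eq (f := fun a => ((f a).foldl zipStep (g a, [])).2.reverse) (by fun_prop)
    fun a => ?_
  rw [foldl_zipStep]; simp

end arith

/-! ### Breadth-first search -/

section search
variable (U : List α) (E : α → α → Bool) (ini goal : α → Bool)

/-- `Steps U E u w v`: the list `u :: w` is a walk from `u` to `v` in the digraph `E`, and `w` stays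
in `U`. -/
def Steps : α → List α → α → Prop
  | u, [], v => u = v
  | u, x :: w, v => E u x = true ∧ x ∈ U ∧ Steps x w v

variable {U E ini goal}

theorem Steps.append {u v x : α} {w w' : List α} (h : Steps U E u w x) (h' : Steps U E x w' v) :
    Steps U E u (w ++ w') v := by
  induction w generalizing u with
  | nil => cases h; exact h'
  | cons y w ih => exact ⟨h.1, h.2.1, ih h.2.2⟩

theorem Steps.split {u v x : α} {w w' : List α} (h : Steps U E u (w ++ x :: w') v) :
    Steps U E u (w ++ [x]) x ∧ Steps U E x w' v := by
  induction w generalizing u with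
  | nil => exact ⟨⟨h.1, h.2.1, rfl⟩, h.2.2⟩
  | cons y w ih => exact ⟨⟨h.1, h.2.1, (ih h.2.2).1⟩, (ih h.2.2).2⟩

theorem Steps.subset {u v : α} {w : List α} (h : Steps U E u w v) : ∀ x ∈ w, x ∈ U := by
  induction w generalizing u with
  | nil => simp
  | cons y w ih =>
    intro x hx
    rcases List.mem_cons.1 hx with rfl | hx
    exacts [h.2.1, ih h.2.2 x hx]

theorem Steps.exists_nodup {u v : α} {w : List α} (h : Steps U E u w v) :
    ∃ w', Steps U E u w' v ∧ (u :: w').Nodup := by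
  induction w generalizing u with
  | nil => exact ⟨[], h, by simp⟩
  | cons x w ih =>
    obtain ⟨w', h1, h2⟩ := ih h.2.2
    by_cases hu : u ∈ x :: w'
    · rcases List.mem_cons.1 hu with rfl | hu
      · exact ⟨w', h1, h2⟩
      · obtain ⟨a, b, rfl⟩ := List.append_of_mem hu
        refine ⟨b, h1.split.2, ?_⟩
        exact (List.nodup_append.1 (List.nodup_cons.1 h2).2).2.1
    · exact ⟨x :: w', ⟨h.1, h.2.1, h1⟩, List.nodup_cons.2 ⟨hu, h2⟩⟩

theorem Steps.exists_short {u v : α} {w : List α} (hu : u ∈ U) (h : Steps U E u w v) :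
    ∃ w', Steps U E u w' v ∧ w'.length < U.length := by
  obtain ⟨w', h1, h2⟩ := h.exists_nodup
  refine ⟨w', h1, ?_⟩
  have := (List.Nodup.subperm h2 (l₂ := U) (fun x hx => by
    rcases List.mem_cons.1 hx with rfl | hx
    exacts [hu, h1.subset x hx])).length_le
  simpa using this

variable (U E ini goal)

/-- The vertices of `U` at the end of a walk with `i` steps that starts in a vertex with `ini`. -/
def layer : ℕ → List α
  | 0 => U.filter ini
  | i + 1 => U.filter fun v => (layer i).any fun u => E u v

/-- The layers `i, i - 1, …, 0`. -/
def layersDown : ℕ → List (List α)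
  | 0 => [layer U E ini 0]
  | i + 1 => layer U E ini (i + 1) :: layersDown i

theorem mem_layer (i : ℕ) (v : α) :
    v ∈ layer U E ini i ↔ ∃ u w, u ∈ U ∧ ini u = true ∧ w.length = i ∧ Steps U E u w v := by
  induction i generalizing v with
  | zero =>
    simp only [layer, List.mem_filter, List.length_eq_zero_iff]
    constructor
    · intro h; exact ⟨v, [], h.1, h.2, rfl, rfl⟩
    · rintro ⟨u, w, h1, h2, rfl, rfl⟩; exact ⟨h1, h2⟩
  | succ i ih =>
    simp only [layer, List.mem_filter, List.any_eq_true]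
    constructor
    · rintro ⟨hv, u, hu, huv⟩
      obtain ⟨u', w, h1, h2, h3, h4⟩ := (ih u).1 hu
      exact ⟨u', w ++ [v], h1, h2, by simp [h3], h4.append ⟨huv, hv, rfl⟩⟩
    · rintro ⟨u, w, h1, h2, h3, h4⟩
      rcases List.eq_nil_or_concat' w with rfl | ⟨w, x, rfl⟩
      · simp at h3
      · have hx := h4.split
        obtain rfl : x = v := hx.2
        have key : ∀ (w : List α) u, Steps U E u (w ++ [x]) x →
            x ∈ U ∧ ∃ y, Steps U E u w y ∧ E y x = true := by
          intro w
          induction w with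
          | nil => intro u h; exact ⟨h.2.1, u, rfl, h.1⟩
          | cons y w ih =>
            intro u h
            obtain ⟨h1, z, h2, h3⟩ := ih y h.2.2
            exact ⟨h1, z, ⟨h.1, h.2.1, h2⟩, h3⟩
        obtain ⟨hxU, y, h5, h6⟩ := key w u h4
        exact ⟨hxU, y, (ih y).2 ⟨u, w, h1, h2, by simpa using h3, h5⟩, h6⟩

/-- The layers up to the first one that meets the goal, the last one first. -/
def searchLayers : List (List α) :=
  U.foldl (fun L _ => bif (L.headD []).any goal then L else
    (U.filter fun v => (L.headD []).any fun u => E u v) :: L) [U.filter ini]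

/-- The vertices of `U` that can be reached from a vertex with `ini`. -/
def reachable [DecidableEq α] : List α :=
  U.filter fun v => (searchLayers U E ini fun _ => false).any fun L => L.any fun u => decide (u = v)

/-- One step of the search for a walk from its end: the walk found so far is extended backwards by
a vertex of the layer `M`. -/
def backStep (w M : List α) : List α :=
  (M.filter fun u => bif w.isEmpty then goal u else (w.take 1).any fun x => E u x).take 1 ++ w

/-- A shortest walk from a vertex with `ini` to one with `goal`, or `[]` if there is none. -/
def findWalk : List α := (searchLayers U E ini goal).foldl (backStep E goal) []

variable {U E ini goal}

theorem searchLayers_eq : ∃ d ≤ U.length, searchLayers U E ini goal = layersDown U E ini d ∧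
    (∀ i < d, (layer U E ini i).any goal = false) ∧
    (d = U.length ∨ (layer U E ini d).any goal = true) := by
  have hd : ∀ d, (layersDown U E ini d).headD [] = layer U E ini d := by
    intro d; cases d <;> rfl
  have key : ∀ T : List α, ∃ d ≤ T.length,
      T.foldl (fun L _ => bif (L.headD []).any goal then L else
        (U.filter fun v => (L.headD []).any fun u => E u v) :: L) [U.filter ini] =
        layersDown U E ini d ∧
      (∀ i < d, (layer U E ini i).any goal = false) ∧
      (d = T.length ∨ (layer U E ini d).any goal = true) := by
    intro T
    induction T using List.reverseRecOn with
    | nil => exact ⟨0, le_rfl, rfl, by simp, Or.inl rfl⟩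
    | append_singleton T x ih =>
      obtain ⟨d, h1, h2, h3, h4⟩ := ih
      rw [List.foldl_append, h2, List.foldl_cons, List.foldl_nil, hd, List.length_append,
        List.length_singleton]
      cases hg : (layer U E ini d).any goal with
      | true => exact ⟨d, by omega, rfl, h3, Or.inr hg⟩
      | false =>
        refine ⟨d + 1, by omega, rfl, fun i hi => ?_, ?_⟩
        · rcases Nat.lt_succ_iff_lt_or_eq.1 hi with h | rfl
          exacts [h3 i h, hg]
        · rcases h4 with rfl | h4
          · exact Or.inl rfl
          · rw [hg] at h4; simp at h4
  exact key U

theorem mem_layersDown {d : ℕ} {L : List α} : L ∈ layersDown U E ini d ↔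
    ∃ i ≤ d, L = layer U E ini i := by
  induction d with
  | zero => simp [layersDown]
  | succ d ih =>
    rw [layersDown, List.mem_cons, ih]
    constructor
    · rintro (rfl | ⟨i, hi, rfl⟩)
      exacts [⟨d + 1, le_rfl, rfl⟩, ⟨i, by omega, rfl⟩]
    · rintro ⟨i, hi, rfl⟩
      rcases Nat.lt_or_eq_of_le hi with h | rfl
      exacts [Or.inr ⟨i, by omega, rfl⟩, Or.inl rfl]

theorem mem_reachable [DecidableEq α] {v : α} : v ∈ reachable U E ini ↔
    ∃ u w, u ∈ U ∧ ini u = true ∧ Steps U E u w v := by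
  obtain ⟨d, hd, h1, h2, h3⟩ := searchLayers_eq (U := U) (E := E) (ini := ini) (goal := fun _ => false)
  have hd : d = U.length := by simpa using h3
  simp only [reachable, List.mem_filter, h1, List.any_eq_true, decide_eq_true_eq,
    mem_layersDown]
  constructor
  · rintro ⟨hv, _, ⟨i, hi, rfl⟩, u, hu, rfl⟩
    obtain ⟨u', w, h4, h5, -, h6⟩ := (mem_layer U E ini i u).1 hu
    exact ⟨u', w, h4, h5, h6⟩
  · rintro ⟨u, w, hu, hi, h⟩
    obtain ⟨w', h4, h5⟩ := h.exists_short hu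
    have hv := (mem_layer U E ini w'.length v).2 ⟨u, w', hu, hi, rfl, h4⟩
    refine ⟨?_, _, ⟨w'.length, by omega, rfl⟩, v, hv, rfl⟩
    rcases hc : w'.length with _ | k <;> rw [hc] at hv <;> exact (List.mem_filter.1 hv).1

theorem take_one_filter {p : α → Bool} {l : List α} (h : ∃ x ∈ l, p x = true) :
    ∃ x ∈ l, p x = true ∧ (l.filter p).take 1 = [x] := by
  rcases hl : l.filter p with _ | ⟨x, m⟩
  · obtain ⟨x, hx, hp⟩ := h
    exact absurd hp (by simpa using (List.filter_eq_nil_iff.1 hl) x hx)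
  · have : x ∈ l.filter p := by rw [hl]; simp
    exact ⟨x, (List.mem_filter.1 this).1, (List.mem_filter.1 this).2, rfl⟩

theorem foldl_backStep (d : ℕ) : ∀ x w, (∃ u ∈ layer U E ini d, E u x = true) →
    ∃ u w', (layersDown U E ini d).foldl (backStep E goal) (x :: w) = u :: w' ++ x :: w ∧
      u ∈ U ∧ ini u = true ∧ w'.length = d ∧ (x ∈ U → Steps U E u (w' ++ [x]) x) := by
  induction d with
  | zero =>
    intro x w h
    obtain ⟨u, hu, h1, h2⟩ := take_one_filter h
    have h3 := List.mem_filter.1 hu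
    refine ⟨u, [], ?_, h3.1, h3.2, rfl, fun hx => ⟨h1, hx, rfl⟩⟩
    simp [layersDown, backStep, h2]
  | succ d ih =>
    intro x w h
    obtain ⟨u, hu, h1, h2⟩ := take_one_filter h
    have h3 := List.mem_filter.1 hu
    obtain ⟨u', w', h4, h5, h6, h7, h8⟩ := ih u (x :: w) (List.any_eq_true.1 h3.2)
    refine ⟨u', w' ++ [u], ?_, h5, h6, by simp [h7], fun hx => ?_⟩
    · simp only [layersDown, List.foldl_cons]
      have : backStep E goal (x :: w) (layer U E ini (d + 1)) = u :: x :: w := by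
        simp [backStep, h2]
      rw [this, h4]; simp
    · exact (h8 h3.1).append ⟨h1, hx, rfl⟩

theorem findWalk_spec : (findWalk U E ini goal = [] ∧ ∀ i, (layer U E ini i).any goal = false) ∨
    ∃ u w v, findWalk U E ini goal = u :: w ∧ u ∈ U ∧ ini u = true ∧ goal v = true ∧
      Steps U E u w v ∧ ∀ i < w.length, (layer U E ini i).any goal = false := by
  obtain ⟨d, hd, h1, h2, h3⟩ := searchLayers_eq (U := U) (E := E) (ini := ini) (goal := goal)
  cases hg : (layer U E ini d).any goal with
  | true =>
    right
    obtain ⟨v, hv, hgv, h4⟩ := take_one_filter (List.any_eq_true.1 hg)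
    cases d with
    | zero =>
      have h5 := List.mem_filter.1 hv
      refine ⟨v, [], v, ?_, h5.1, h5.2, hgv, rfl, by simp⟩
      simp [findWalk, h1, layersDown, backStep, h4]
    | succ d =>
      have h5 := List.mem_filter.1 hv
      obtain ⟨u, w, h6, h7, h8, h9, h10⟩ := foldl_backStep (goal := goal) d v []
        (List.any_eq_true.1 h5.2)
      refine ⟨u, w ++ [v], v, ?_, h7, h8, hgv, h10 h5.1, by simpa [h9] using h2⟩
      rw [findWalk, h1, layersDown, List.foldl_cons]
      have : backStep E goal [] (layer U E ini (d + 1)) = [v] := by simp [backStep, h4]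
      rw [this, h6]; simp
  | false =>
    left
    obtain rfl : d = U.length := by simpa [hg] using h3
    have hall : ∀ i ≤ U.length, (layer U E ini i).any goal = false := fun i hi => by
      rcases Nat.lt_or_eq_of_le hi with h | rfl
      exacts [h2 i h, hg]
    constructor
    · rw [findWalk, h1]
      have : ∀ k ≤ U.length, (layersDown U E ini k).foldl (backStep E goal) [] = [] := by
        intro k hk
        have hb : backStep E goal [] (layer U E ini k) = [] := by
          have := hall k hk
          rw [List.any_eq_false] at this
          have h0 : (layer U E ini k).filter goal = [] := List.filter_eq_nil_iff.2 this
          simp [backStep, h0]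
        induction k with
        | zero => simpa [layersDown] using hb
        | succ k ih =>
          rw [layersDown, List.foldl_cons, hb]
          exact ih (by omega) (by
            have := hall k (by omega)
            rw [List.any_eq_false] at this
            have h0 : (layer U E ini k).filter goal = [] := List.filter_eq_nil_iff.2 this
            simp [backStep, h0])
      exact this _ le_rfl
    · intro i
      rw [List.any_eq_false]
      intro v hv hgv
      obtain ⟨u, w, h4, h5, -, h6⟩ := (mem_layer U E ini i v).1 hv
      obtain ⟨w', h7, h8⟩ := h6.exists_short h4
      have := hall w'.length (by omega)
      rw [List.any_eq_false] at this
      exact this v ((mem_layer U E ini _ v).2 ⟨u, w', h4, h5, rfl, h7⟩) hgv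

theorem findWalk_ne_nil {u v : α} {w : List α} (hu : u ∈ U) (hi : ini u = true)
    (hg : goal v = true) (h : Steps U E u w v) : findWalk U E ini goal ≠ [] := by
  rcases findWalk_spec (U := U) (E := E) (ini := ini) (goal := goal) with h1 | h1
  · have := h1.2 w.length
    rw [List.any_eq_false] at this
    exact absurd hg (this v ((mem_layer U E ini _ v).2 ⟨u, w, hu, hi, rfl, h⟩))
  · obtain ⟨u, w, v, h1, -⟩ := h1
    rw [h1]; simp

/-- The walk found is a walk from `ini` to `goal`, and there is no shorter one. -/
theorem findWalk_eq_cons {u : α} {w : List α} (h : findWalk U E ini goal = u :: w) :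
    u ∈ U ∧ ini u = true ∧ (∃ v, goal v = true ∧ Steps U E u w v) ∧
      ∀ u' w' v', u' ∈ U → ini u' = true → goal v' = true → Steps U E u' w' v' →
        w.length ≤ w'.length := by
  rcases findWalk_spec (U := U) (E := E) (ini := ini) (goal := goal) with h1 | h1
  · rw [h1.1] at h; simp at h
  · obtain ⟨u₁, w₁, v, h1, h2, h3, h4, h5, h6⟩ := h1
    rw [h1, List.cons.injEq] at h
    obtain ⟨rfl, rfl⟩ := h
    refine ⟨h2, h3, ⟨v, h4, h5⟩, fun u' w' v' h7 h8 h9 h10 => ?_⟩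
    by_contra hlt
    have := h6 w'.length (by omega)
    rw [List.any_eq_false] at this
    exact this v' ((mem_layer U E ini _ v').2 ⟨u', w', h7, h8, rfl, h10⟩) h9

theorem length_findWalk_le : (findWalk U E ini goal).length ≤ U.length := by
  rcases h : findWalk U E ini goal with _ | ⟨u, w⟩
  · simp
  · obtain ⟨h1, h2, ⟨v, h3, h4⟩, h5⟩ := findWalk_eq_cons h
    obtain ⟨w', h6, h7⟩ := h4.exists_short h1
    have := h5 u w' v h1 h2 h3 h6
    simp only [List.length_cons]; omega

end search

section searchTime
variable [Enc α] [Enc δ]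

@[fun_prop] theorem PT.take_one {f : δ → List α} (hf : PT f) : PT (fun d => (f d).take 1) :=
  PT.of_eq (f := fun d => (f d).reverse.drop (f d).tail.length) (by fun_prop) fun d => by
    rcases f d with _ | ⟨a, l⟩
    · simp
    · simp

variable {U : δ → List α} {E : δ → α → α → Bool} {ini goal : δ → α → Bool}

@[fun_prop] theorem PT.searchLayers (hU : PT U) (hE : PT (fun q : (δ × α) × α => E q.1.1 q.1.2 q.2))
    (hi : PT (fun q : δ × α => ini q.1 q.2)) (hg : PT (fun q : δ × α => goal q.1 q.2)) :
    PT (fun d => searchLayers (U d) (E d) (ini d) (goal d)) := by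
  refine PT.foldl hU (by fun_prop) ?_ (M := fun d => (esize (U d) + 1) * (esize (U d) + 1) + 1)
    (((hU.size.add (PB.const 1)).mul (hU.size.add (PB.const 1))).add (PB.const 1))
    fun d l₁ l₂ h => ?_
  · have h1 : PT (fun q : (((δ × List (List α)) × α) × α) × α => E q.1.1.1.1 q.2 q.1.2) :=
      hE.comp (f := fun q : (((δ × List (List α)) × α) × α) × α => ((q.1.1.1.1, q.2), q.1.2))
        (by fun_prop)
    have h2 : PT (fun q : ((δ × List (List α)) × α) × α => goal q.1.1.1 q.2) :=
      hg.comp (f := fun q : ((δ × List (List α)) × α) × α => (q.1.1.1, q.2)) (by fun_prop)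
    have h3 : PT (fun q : (δ × List (List α)) × α => (q.1.2.headD []).any (goal q.1.1)) :=
      PT.any (by fun_prop) h2
    have h4 : PT (fun q : (δ × List (List α)) × α => (U q.1.1).filter fun v =>
        (q.1.2.headD []).any fun u => E q.1.1 u v) :=
      PT.filter (hU.comp (by fun_prop)) (PT.any (by fun_prop) h1)
    exact h3.cond (by fun_prop) (h4.cons (by fun_prop))
  · have key : ∀ T : List α, ∀ L : List (List α), (∀ M ∈ L, esize M ≤ esize (U d)) →
        (T.foldl (fun L _ => bif (L.headD []).any (goal d) then L else
          ((U d).filter fun v => (L.headD []).any fun u => E d u v) :: L) L).length ≤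
            T.length + L.length ∧
        ∀ M ∈ T.foldl (fun L _ => bif (L.headD []).any (goal d) then L else
          ((U d).filter fun v => (L.headD []).any fun u => E d u v) :: L) L,
          esize M ≤ esize (U d) := by
      intro T
      induction T with
      | nil => intro L hL; exact ⟨by simp, hL⟩
      | cons x T ih =>
        intro L hL
        rw [List.foldl_cons]
        cases (L.headD []).any (goal d) with
        | true =>
          have := ih L hL
          exact ⟨by simp only [cond_true, List.length_cons] at this ⊢; omega, this.2⟩
        | false =>
          have := ih (((U d).filter fun v => (L.headD []).any fun u => E d u v) :: L)
            (fun M hM => by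
              rcases List.mem_cons.1 hM with rfl | hM
              exacts [esize_sublist List.filter_sublist, hL M hM])
          exact ⟨by simp only [cond_false, List.length_cons] at this ⊢; omega, this.2⟩
    obtain ⟨h1, h2⟩ := key l₁ [(U d).filter (ini d)] (by
      intro M hM
      rw [List.mem_singleton.1 hM]
      exact esize_sublist List.filter_sublist)
    refine (esize_le_of_forall h2).trans ?_
    have h3 := length_lt_esize (U d)
    rw [h, List.length_append, ← h] at h3
    simp only [List.length_singleton] at h1
    exact Nat.add_le_add_right (Nat.mul_le_mul_right _ (by omega)) 1

@[fun_prop] theorem PT.reachable [DecidableEq α] (hU : PT U)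
    (hE : PT (fun q : (δ × α) × α => E q.1.1 q.1.2 q.2)) (hi : PT (fun q : δ × α => ini q.1 q.2)) :
    PT (fun d => reachable (U d) (E d) (ini d)) := by
  have := PT.searchLayers (goal := fun _ _ => false) hU hE hi (PT.const _)
  exact PT.filter hU (PT.any (this.comp PT.fst') (by fun_prop))

@[fun_prop] theorem PT.findWalk (hU : PT U) (hE : PT (fun q : (δ × α) × α => E q.1.1 q.1.2 q.2))
    (hi : PT (fun q : δ × α => ini q.1 q.2)) (hg : PT (fun q : δ × α => goal q.1 q.2)) :
    PT (fun d => findWalk (U d) (E d) (ini d) (goal d)) := by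
  have hL := PT.searchLayers hU hE hi hg
  refine PT.foldl hL (PT.const []) ?_ hL.size fun d l₁ l₂ h => ?_
  · have h1 : PT (fun q : (((δ × List α) × List α) × α) × α => E q.1.1.1.1 q.1.2 q.2) :=
      hE.comp (f := fun q : (((δ × List α) × List α) × α) × α => ((q.1.1.1.1, q.1.2), q.2))
        (by fun_prop)
    have h2 : PT (fun q : ((δ × List α) × List α) × α => goal q.1.1.1 q.2) :=
      hg.comp (f := fun q : ((δ × List α) × List α) × α => (q.1.1.1, q.2)) (by fun_prop)
    exact PT.append (PT.take_one (PT.filter (by fun_prop) (PT.cond (by fun_prop) h2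
      (PT.any (by fun_prop) h1)))) (by fun_prop)
  · have key : ∀ T : List (List α), ∀ w : List α,
        esize (T.foldl (backStep (E d) (goal d)) w) + 1 ≤ esize T + esize w := by
      intro T
      induction T with
      | nil => intro w; simp [add_comm]
      | cons M T ih =>
        intro w
        rw [List.foldl_cons]
        refine (ih _).trans ?_
        have h1 := esize_append ((M.filter fun u => bif w.isEmpty then goal d u else
          (w.take 1).any fun x => E d u x).take 1) w
        have h2 : esize ((M.filter fun u => bif w.isEmpty then goal d u else
          (w.take 1).any fun x => E d u x).take 1) ≤ esize M :=
          esize_sublist ((List.take_sublist _ _).trans List.filter_sublist)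
        rw [← backStep] at h1
        simp only [esize_cons]; omega
    have h1 := key l₁ []
    have h2 : esize l₁ ≤ esize (_root_.searchLayers (U d) (E d) (ini d) (goal d)) :=
      esize_sublist (by rw [h]; simp)
    simp only [esize_nil] at h1
    omega

end searchTime

end programs

/-! ### Choosing positions subject to alternatives between two bounds -/

/-- An end of a segment: the key that names the segment, and `true` for the end that is closer to
the root. -/
abbrev Half := ℕ × Bool

/-- The bound `x h ≤ m` on the unknown position `x h`, as a pair `(h, m)`. -/
abbrev Bound := Half × ℕ

section defs
variable (H : List Half) (C : List (Bound × Bound)) (cands A : List ℕ) (B : List Bound)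

/-- The bounds in `B` imply the bound `b`. -/
def implied (b : Bound) : Bool := B.any fun c => decide (c.1 = b.1) && decide (c.2 ≤ b.2)

/-- Some alternative between bounds on `h` and `h'` is not settled by `B`. -/
def isEdge (h h' : Half) : Bool :=
  C.any fun c => decide (c.1.1 = h) && decide (c.2.1 = h') && !implied B c.1 && !implied B c.2

/-- The positions `m` and `t` satisfy all alternatives between bounds on `h` and `h'`. -/
def compatible (h h' : Half) (m t : ℕ) : Bool :=
  C.all fun c => !(decide (c.1.1 = h) && decide (c.2.1 = h')) || decide (m ≤ c.1.2) ||
    decide (t ≤ c.2.2)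

/-- The largest position for `h'` that is compatible with position `m` for `h`. -/
def best (h h' : Half) (m : ℕ) : ℕ := (cands.filter fun t => compatible C h h' m t).headD 0

/-- One step of `boundSeq`. -/
def seqStep (l : List Bound) (h : Half) : List Bound :=
  (h, best C cands (l.headD (h, 0)).1 h (l.headD (h, 0)).2) :: l

/-- Bounds along the walk `hs`, the last one first: they start with `t`, and each is the largest
one compatible with its predecessor. -/
def boundSeq (hs : List Half) (t : ℕ) : List Bound :=
  hs.tail.foldl (seqStep C cands) ((hs.take 1).map fun h => (h, t))

/-- The last value of `boundSeq`. -/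
def finalBound (hs : List Half) (t : ℕ) : ℕ := ((boundSeq C cands hs t).map Prod.snd).headD 0

/-- The states `(h₀, h, b)` of the search for an odd closed walk: the start of the walk, its current
vertex and the parity of its length. -/
def walkStates : List (Half × (Half × Bool)) := H.product (H.product [false, true])

/-- A shortest closed walk of odd length in the graph of unsettled alternatives, if there is one. -/
def oddWalk : List Half :=
  (findWalk (walkStates H)
    (fun s t => decide (s.1 = t.1) && isEdge C B s.2.1 t.2.1 && s.2.2.xor t.2.2)
    (fun s => decide (s.1 = s.2.1) && !s.2.2) (fun s => decide (s.1 = s.2.1) && s.2.2)).map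
  fun s => s.2.1

/-- The largest start value that the closed walk `hs` does not lower. -/
def pivot (hs : List Half) : ℕ :=
  (cands.filter fun t => decide (t ≤ finalBound C cands hs t)).headD 0

/-- Pairs of bounds such that every solution satisfies both bounds of one of the pairs. -/
def options (hs : List Half) : List (Bound × Bound) :=
  let l := boundSeq C cands hs (pivot C cands hs)
  let l' := boundSeq C cands hs (pivot C cands hs + 1)
  l.zip l.tail ++ l'.zip l'.tail

/-- The bounds `B`, and the option with number `a`. -/
def branch (a : ℕ) : List Bound :=
  (H.product cands).filter fun b => B.any (fun c => decide (c = b)) ||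
    (A.zip (options C cands (oddWalk H C B))).any fun o => decide (o.1 = a) &&
      (decide (b = o.2.1) || decide (b = o.2.2))

/-- The bounds after a sequence of choices. -/
def branches (w : List ℕ) : List Bound :=
  w.foldl (branch H C cands A) ((H.product cands).filter fun b => decide (b.2 = cands.headD 0))

end defs

section time
variable {δ : Type} [Enc δ] {H : δ → List Half} {C : δ → List (Bound × Bound)}
  {cands A : δ → List ℕ} {B : δ → List Bound}

@[fun_prop] theorem PT.implied {b : δ → Bound} (hB : PT B) (hb : PT b) :
    PT (fun d => implied (B d) (b d)) := by unfold _root_.implied; fun_prop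

@[fun_prop] theorem PT.isEdge {h h' : δ → Half} (hC : PT C) (hB : PT B) (hh : PT h) (hh' : PT h') :
    PT (fun d => isEdge (C d) (B d) (h d) (h' d)) := by unfold _root_.isEdge; fun_prop

@[fun_prop] theorem PT.compatible {h h' : δ → Half} {m t : δ → ℕ} (hC : PT C) (hh : PT h)
    (hh' : PT h') (hm : PT m) (ht : PT t) :
    PT (fun d => compatible (C d) (h d) (h' d) (m d) (t d)) := by
  unfold _root_.compatible; fun_prop

@[fun_prop] theorem PT.best {h h' : δ → Half} {m : δ → ℕ} (hC : PT C) (hc : PT cands) (hh : PT h)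
    (hh' : PT h') (hm : PT m) : PT (fun d => best (C d) (cands d) (h d) (h' d) (m d)) := by
  unfold _root_.best; fun_prop

@[fun_prop] theorem PT.seqStep {l : δ → List Bound} {h : δ → Half} (hC : PT C) (hc : PT cands)
    (hl : PT l) (hh : PT h) : PT (fun d => seqStep (C d) (cands d) (l d) (h d)) := by
  unfold _root_.seqStep; fun_prop

theorem esize_headD_le {α : Type} [Enc α] (l : List α) (a : α) :
    esize (l.headD a) ≤ esize l + esize a := by
  cases l with
  | nil => simp
  | cons b l => simp; omega

@[fun_prop] theorem PT.boundSeq {hs : δ → List Half} {t : δ → ℕ} (hC : PT C) (hc : PT cands)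
    (hh : PT hs) (ht : PT t) : PT (fun d => boundSeq (C d) (cands d) (hs d) (t d)) := by
  refine PT.foldl (by fun_prop) (by fun_prop) (by fun_prop)
    (M := fun d => esize (hs d) * (esize (hs d) + esize (cands d) + 4) +
      (esize (hs d) + esize (t d) + 4)) ?_ fun d l₁ l₂ h => ?_
  · exact (hh.size.mul ((hh.size.add hc.size).add (PB.const 4))).add
      ((hh.size.add ht.size).add (PB.const 4))
  · have key : ∀ (T : List Half) (l : List Bound), (∀ h ∈ T, esize h ≤ esize (hs d)) →
        esize (T.foldl (_root_.seqStep (C d) (cands d)) l) ≤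
          T.length * (esize (hs d) + esize (cands d) + 4) + esize l := by
      intro T
      induction T with
      | nil => simp
      | cons h T ih =>
        intro l hT
        refine (ih _ fun h hh => hT h (by simp [hh])).trans ?_
        have h1 := hT h (by simp)
        have h2 := esize_headD_le ((cands d).filter fun t =>
          _root_.compatible (C d) (l.headD (h, 0)).1 h (l.headD (h, 0)).2 t) 0
        rw [← _root_.best] at h2
        have h3 : esize ((cands d).filter fun t =>
          _root_.compatible (C d) (l.headD (h, 0)).1 h (l.headD (h, 0)).2 t) ≤ esize (cands d) :=
          esize_sublist List.filter_sublist
        have h4 : esize 0 = 1 := rfl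
        rw [_root_.seqStep, esize_cons, esize_pair, List.length_cons, add_mul, one_mul]
        omega
    have hlen : l₁.length ≤ esize (hs d) := by
      have h1 := congrArg List.length h
      have h2 := length_lt_esize (hs d)
      simp only [List.length_append, List.length_tail] at h1
      omega
    refine (key _ _ fun h' hh' => esize_mem_le ?_).trans ?_
    · exact List.mem_of_mem_tail (by rw [h]; simp [hh'])
    · refine Nat.add_le_add (Nat.mul_le_mul_right _ hlen) ?_
      cases hs d with
      | nil => simp
      | cons a l => simp; omega

@[fun_prop] theorem PT.finalBound {hs : δ → List Half} {t : δ → ℕ} (hC : PT C) (hc : PT cands)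
    (hh : PT hs) (ht : PT t) : PT (fun d => finalBound (C d) (cands d) (hs d) (t d)) := by
  unfold _root_.finalBound; fun_prop

@[fun_prop] theorem PT.oddWalk (hH : PT H) (hC : PT C) (hB : PT B) :
    PT (fun d => oddWalk (H d) (C d) (B d)) := by
  unfold _root_.oddWalk walkStates
  exact PT.map (PT.findWalk (by fun_prop) (by fun_prop) (by fun_prop) (by fun_prop)) (by fun_prop)

@[fun_prop] theorem PT.pivot {hs : δ → List Half} (hC : PT C) (hc : PT cands) (hh : PT hs) :
    PT (fun d => pivot (C d) (cands d) (hs d)) := by unfold _root_.pivot; fun_prop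

@[fun_prop] theorem PT.options {hs : δ → List Half} (hC : PT C) (hc : PT cands) (hh : PT hs) :
    PT (fun d => options (C d) (cands d) (hs d)) := by unfold _root_.options; fun_prop

@[fun_prop] theorem PT.branch {a : δ → ℕ} (hH : PT H) (hC : PT C) (hc : PT cands) (hA : PT A)
    (hB : PT B) (ha : PT a) : PT (fun d => branch (H d) (C d) (cands d) (A d) (B d) (a d)) := by
  unfold _root_.branch; fun_prop

@[fun_prop] theorem PT.branches {w : δ → List ℕ} (hH : PT H) (hC : PT C) (hc : PT cands) (hA : PT A)
    (hw : PT w) : PT (fun d => branches (H d) (C d) (cands d) (A d) (w d)) := by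
  refine PT.foldl hw (by fun_prop) (by fun_prop) (M := fun d => esize ((H d).product (cands d)))
    (PT.size (by fun_prop)) fun d l₁ l₂ h => ?_
  rcases List.eq_nil_or_concat' l₁ with rfl | ⟨l₁, a, rfl⟩
  · exact esize_sublist List.filter_sublist
  · rw [List.foldl_append]
    exact esize_sublist List.filter_sublist

end time

section branching
variable {H : List Half} {C : List (Bound × Bound)} {cands A : List ℕ} {B : List Bound}

theorem implied_mono {B B' : List Bound} (h : ∀ b ∈ B, b ∈ B') {b : Bound}
    (hb : implied B b = true) : implied B' b = true := by
  simp only [implied, List.any_eq_true] at hb ⊢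
  obtain ⟨c, hc, h1⟩ := hb
  exact ⟨c, h c hc, h1⟩

theorem isEdge_iff {h h' : Half} : isEdge C B h h' = true ↔
    ∃ c ∈ C, c.1.1 = h ∧ c.2.1 = h' ∧ implied B c.1 = false ∧ implied B c.2 = false := by
  simp [isEdge, and_assoc]

theorem isEdge_mono {B B' : List Bound} (h : ∀ b ∈ B, b ∈ B') {u v : Half}
    (hb : isEdge C B' u v = true) : isEdge C B u v = true := by
  rw [isEdge_iff] at hb ⊢
  obtain ⟨c, hc, h1, h2, h3, h4⟩ := hb
  refine ⟨c, hc, h1, h2, ?_, ?_⟩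
  · by_contra h5
    rw [implied_mono h (by simpa using h5)] at h3; simp at h3
  · by_contra h5
    rw [implied_mono h (by simpa using h5)] at h4; simp at h4

/-- `cands` lists the numbers up to `n`, in decreasing order. -/
theorem headD_filter_max (n : ℕ) (p : ℕ → Bool) (h0 : p 0 = true) :
    let m := (((List.range (n + 1)).reverse).filter p).headD 0
    m ≤ n ∧ p m = true ∧ ∀ t ≤ n, p t = true → t ≤ m := by
  induction n with
  | zero => simp [h0]
  | succ n ih =>
    rw [List.range_succ, List.reverse_append]
    simp only [List.reverse_singleton, List.singleton_append, List.filter_cons]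
    by_cases hp : p (n + 1) = true
    · refine ⟨by simp [hp], by simp [hp], fun t ht _ => by simpa [hp] using ht⟩
    · simp only [hp]
      obtain ⟨h1, h2, h3⟩ := ih
      refine ⟨Nat.le_succ_of_le h1, h2, fun t ht hpt => ?_⟩
      rcases Nat.lt_or_eq_of_le ht with h | rfl
      exacts [h3 t (by omega) hpt, absurd hpt hp]

/-- A list of bounds, the last one first, along a walk of unsettled alternatives, each bound being
the best one compatible with its predecessor. -/
def IsBoundSeq (C : List (Bound × Bound)) (cands : List ℕ) (B : List Bound) (b₀ : Bound) :
    List Bound → Prop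
  | [] => False
  | [b] => b = b₀
  | b' :: b :: l => b'.2 = best C cands b.1 b'.1 b.2 ∧ isEdge C B b.1 b'.1 = true ∧
      IsBoundSeq C cands B b₀ (b :: l)

/-- The vertices of a list are joined by unsettled alternatives to their predecessors. -/
def EdgeChain (C : List (Bound × Bound)) (B : List Bound) : Half → List Half → Prop
  | _, [] => True
  | u, v :: l => isEdge C B u v = true ∧ EdgeChain C B v l

theorem isBoundSeq_foldl {b₀ : Bound} (hs : List Half) : ∀ (b : Bound) (l : List Bound),
    IsBoundSeq C cands B b₀ (b :: l) → EdgeChain C B b.1 hs →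
    ∃ b' l', hs.foldl (seqStep C cands) (b :: l) = b' :: l' ∧ IsBoundSeq C cands B b₀ (b' :: l') ∧
      l'.length = l.length + hs.length ∧ b'.1 = hs.getLastD b.1 := by
  induction hs with
  | nil => intro b l h _; exact ⟨b, l, rfl, h, by simp, by simp⟩
  | cons h hs ih =>
    intro b l hb hc
    obtain ⟨b', l', h1, h2, h3, h4⟩ := ih (h, best C cands b.1 h b.2) (b :: l) ⟨rfl, hc.1, hb⟩ hc.2
    refine ⟨b', l', h1, h2, ?_, ?_⟩
    · simp only [List.length_cons] at h3 ⊢; omega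
    · rw [h4, List.getLastD_cons]

/-- Along the sequence, a solution that violates one of the bounds in each pair of neighbours
satisfies and violates the bounds alternately. -/
theorem IsBoundSeq.alternate {b₀ : Bound} {x : Half → ℕ}
    (hbest : ∀ h h' m, m ≤ x h → isEdge C B h h' = true → x h' ≤ best C cands h h' m) :
    ∀ (l : List Bound) (b : Bound), IsBoundSeq C cands B b₀ (b :: l) →
    (∀ p ∈ (b :: l).zip l, ¬(x p.1.1 ≤ p.1.2 ∧ x p.2.1 ≤ p.2.2)) →
    (x b₀.1 ≤ b₀.2 → if Even l.length then x b.1 ≤ b.2 else b.2 < x b.1) ∧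
    (b₀.2 ≤ x b₀.1 → if Even l.length then b.2 ≤ x b.1 else x b.1 ≤ b.2) := by
  intro l
  induction l with
  | nil => intro b hb _; cases hb; simp
  | cons b' l ih =>
    intro b hb hz
    obtain ⟨ih1, ih2⟩ := ih b' hb.2.2 fun p hp => hz p (by
      cases l with
      | nil => simp at hp
      | cons c l => rw [List.zip_cons_cons]; exact List.mem_cons_of_mem _ hp)
    have h1 : ¬(x b.1 ≤ b.2 ∧ x b'.1 ≤ b'.2) := hz (b, b') (by rw [List.zip_cons_cons]; simp)
    have h2 : b'.2 ≤ x b'.1 → x b.1 ≤ b.2 := fun h => hb.1 ▸ hbest _ _ _ h hb.2.1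
    simp only [List.length_cons, Nat.even_add_one]
    constructor
    · intro h0
      have := ih1 h0
      by_cases he : Even l.length
      · simp only [he, if_true, not_true, if_false] at this ⊢; omega
      · simp only [he, if_false, not_false_iff, if_true] at this ⊢; omega
    · intro h0
      have := ih2 h0
      by_cases he : Even l.length
      · simp only [he, if_true, not_true, if_false] at this ⊢; omega
      · simp only [he, if_false, not_false_iff, if_true] at this ⊢; omega

theorem IsBoundSeq.pairs {b₀ : Bound} : ∀ (l : List Bound) (b : Bound),
    IsBoundSeq C cands B b₀ (b :: l) → ∀ p ∈ (b :: l).zip l,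
    p.1.2 = best C cands p.2.1 p.1.1 p.2.2 ∧ isEdge C B p.2.1 p.1.1 = true ∧
      (p.2 = b₀ ∨ ∃ h m, p.2.2 = best C cands h p.2.1 m) := by
  intro l
  induction l with
  | nil => intro b _ p hp; simp at hp
  | cons b' l ih =>
    intro b hb p hp
    rw [List.zip_cons_cons, List.mem_cons] at hp
    rcases hp with rfl | hp
    · refine ⟨hb.1, hb.2.1, ?_⟩
      cases l with
      | nil => exact Or.inl hb.2.2
      | cons c l => exact Or.inr ⟨_, _, hb.2.2.1⟩
    · exact ih b' hb.2.2 p (by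
        cases l with
        | nil => simp at hp
        | cons c l => exact hp)

/-- Consistency of the alternatives `C` with the halves `H`, and a solution `x`. -/
structure Alternatives (H : List Half) (C : List (Bound × Bound)) (n : ℕ) (x : Half → ℕ) : Prop where
  symm : ∀ c ∈ C, (c.2, c.1) ∈ C
  mem : ∀ c ∈ C, c.1.1 ∈ H ∧ c.2.1 ∈ H
  le : ∀ h ∈ H, x h ≤ n
  sat : ∀ c ∈ C, x c.1.1 ≤ c.1.2 ∨ x c.2.1 ≤ c.2.2

variable {n : ℕ} {x : Half → ℕ}

theorem best_spec (C : List (Bound × Bound)) (n : ℕ) (h h' : Half) (m : ℕ) :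
    best C (List.range (n + 1)).reverse h h' m ≤ n ∧
    compatible C h h' m (best C (List.range (n + 1)).reverse h h' m) = true ∧
    ∀ t ≤ n, compatible C h h' m t = true → t ≤ best C (List.range (n + 1)).reverse h h' m :=
  headD_filter_max n (fun t => compatible C h h' m t) (by simp [compatible])

theorem Alternatives.le_best (hx : Alternatives H C n x) {h h' : Half} {m : ℕ} (hm : m ≤ x h)
    (hh : h' ∈ H) : x h' ≤ best C (List.range (n + 1)).reverse h h' m := by
  refine (best_spec C n h h' m).2.2 _ (hx.le _ hh) ?_
  simp only [compatible, List.all_eq_true]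
  intro c hc
  by_cases h1 : c.1.1 = h
  · by_cases h2 : c.2.1 = h'
    · have := hx.sat c hc
      rw [h1, h2] at this
      rcases this with h3 | h3
      · simp [hm.trans h3]
      · simp [h3]
    · simp [h2]
  · simp [h1]

theorem Alternatives.mem_of_isEdge (hx : Alternatives H C n x) {h h' : Half}
    (he : isEdge C B h h' = true) : h ∈ H ∧ h' ∈ H := by
  obtain ⟨c, hc, rfl, rfl, -⟩ := isEdge_iff.1 he
  exact hx.mem c hc

theorem mem_walkStates {s : Half × (Half × Bool)} :
    s ∈ walkStates H ↔ s.1 ∈ H ∧ s.2.1 ∈ H := by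
  obtain ⟨a, b, c⟩ := s
  simp only [walkStates]
  cases c <;> simp

theorem oddWalk_eq_cons {hs : List Half} (hne : oddWalk H C B = hs)
    (hs0 : hs ≠ []) : ∃ h₀ l, hs = h₀ :: l ∧ h₀ ∈ H ∧ EdgeChain C B h₀ l ∧ Odd l.length ∧
      l.getLastD h₀ = h₀ := by
  subst hne
  rcases hw : findWalk (walkStates H)
    (fun s t => decide (s.1 = t.1) && isEdge C B s.2.1 t.2.1 && s.2.2.xor t.2.2)
    (fun s => decide (s.1 = s.2.1) && !s.2.2) (fun s => decide (s.1 = s.2.1) && s.2.2) with _ | ⟨u, w⟩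
  · rw [oddWalk, hw] at hs0; simp at hs0
  · obtain ⟨h1, h2, ⟨v, h3, h4⟩, -⟩ := findWalk_eq_cons hw
    simp only [Bool.and_eq_true, decide_eq_true_eq, Bool.not_eq_true'] at h2 h3
    have key : ∀ (w : List (Half × (Half × Bool))) u, Steps (walkStates H)
        (fun s t => decide (s.1 = t.1) && isEdge C B s.2.1 t.2.1 && s.2.2.xor t.2.2) u w v →
        v.1 = u.1 ∧ EdgeChain C B u.2.1 (w.map fun s => s.2.1) ∧
        (u.2.2.xor v.2.2 = true ↔ Odd w.length) ∧ (w.map fun s => s.2.1).getLastD u.2.1 = v.2.1 := by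
      intro w
      induction w with
      | nil => intro u h; cases h; simp [EdgeChain]
      | cons y w ih =>
        intro u h
        obtain ⟨h5, h6, h7, h8⟩ := ih y h.2.2
        have h9 := h.1
        simp only [Bool.and_eq_true, decide_eq_true_eq] at h9
        refine ⟨h5.trans h9.1.1.symm, ⟨h9.1.2, h6⟩, ?_, ?_⟩
        · rw [List.length_cons, Nat.odd_add_one, ← h7]
          have := h9.2
          cases hu : u.2.2 <;> cases hy : y.2.2 <;> cases v.2.2 <;> simp [hu, hy] at this ⊢
        · rw [List.map_cons, List.getLastD_cons]
          exact h8
    obtain ⟨h5, h6, h7, h8⟩ := key w u h4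
    refine ⟨u.2.1, w.map fun s => s.2.1, ?_, (mem_walkStates.1 h1).2, h6, ?_, ?_⟩
    · rw [oddWalk, hw]; rfl
    · rw [List.length_map, ← h7, h2.2, h3.2]; rfl
    · rw [h8, ← h3.1, h5, h2.1]

/-- If no odd closed walk is found, then the graph of unsettled alternatives is bipartite. -/
theorem exists_coloring (hx : Alternatives H C n x) (hne : oddWalk H C B = []) :
    ∃ col : Half → Bool, ∀ h h', isEdge C B h h' = true → col h ≠ col h' := by
  have hsymm : ∀ h h', isEdge C B h h' = true → isEdge C B h' h = true := by
    intro h h' he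
    obtain ⟨c, hc, h1, h2, h3, h4⟩ := isEdge_iff.1 he
    exact isEdge_iff.2 ⟨_, hx.symm c hc, h2, h1, h4, h3⟩
  have noOdd : ∀ (h₀ u v : Half) (b : Bool) (w : List (Half × (Half × Bool))), h₀ ∈ H →
      Steps (walkStates H)
        (fun s t => decide (s.1 = t.1) && isEdge C B s.2.1 t.2.1 && s.2.2.xor t.2.2)
        (h₀, (h₀, false)) w (h₀, (h₀, true)) → False := by
    intro h₀ u v b w hh hw
    have := findWalk_ne_nil (ini := fun s => decide (s.1 = s.2.1) && !s.2.2)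
      (goal := fun s => decide (s.1 = s.2.1) && s.2.2) (mem_walkStates.2 ⟨hh, hh⟩) (by simp)
      (by simp) hw
    rw [oddWalk, List.map_eq_nil_iff] at hne
    exact this hne
  let G : SimpleGraph Half :=
    { Adj := fun h h' => h ≠ h' ∧ isEdge C B h h' = true
      symm := ⟨fun h h' he => ⟨he.1.symm, hsymm _ _ he.2⟩⟩
      loopless := ⟨fun h he => he.1 rfl⟩ }
  have hcol : G.Colorable 2 := by
    rw [SimpleGraph.two_colorable_iff_forall_loop_even]
    intro h₀ p
    by_contra hodd
    rw [Nat.not_even_iff_odd] at hodd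
    have key : ∀ (u v : Half) (p : G.Walk u v) (b : Bool), h₀ ∈ H → ∃ w, Steps (walkStates H)
        (fun s t => decide (s.1 = t.1) && isEdge C B s.2.1 t.2.1 && s.2.2.xor t.2.2)
        (h₀, (u, b)) w (h₀, (v, b.xor (decide (Odd p.length)))) := by
      intro u v p
      induction p with
      | nil => intro b _; exact ⟨[], by simp [Steps]⟩
      | @cons u y v hadj p ih =>
        intro b hH
        obtain ⟨w, hw⟩ := ih (!b) hH
        refine ⟨(h₀, (y, !b)) :: w, ?_, mem_walkStates.2 ⟨hH, (hx.mem_of_isEdge hadj.2).2⟩, ?_⟩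
        · have := hadj.2
          cases b <;> simp [this]
        · convert hw using 3
          rw [SimpleGraph.Walk.length_cons]
          by_cases ho : Odd p.length <;> cases b <;> simp [Nat.odd_add_one, ho]
    have hH : h₀ ∈ H := by
      cases p with
      | nil => simp at hodd
      | cons hadj p => exact (hx.mem_of_isEdge hadj.2).1
    obtain ⟨w, hw⟩ := key h₀ h₀ p false hH
    exact noOdd h₀ h₀ h₀ false w hH (by simpa [hodd] using hw)
  obtain ⟨c⟩ := hcol
  refine ⟨fun h => decide (c h = 0), fun h h' he heq => ?_⟩
  by_cases hhh : h = h'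
  · subst hhh
    exact noOdd h h h false [(h, (h, true))] (hx.mem_of_isEdge he).1
      ⟨by simp [he], mem_walkStates.2 ⟨(hx.mem_of_isEdge he).1, (hx.mem_of_isEdge he).1⟩, rfl⟩
  · have h1 := c.valid (v := h) (w := h') ⟨hhh, he⟩
    have h2 : c h = 0 ↔ c h' = 0 := by simpa using heq
    omega

/-- Every solution satisfies both bounds of one of the options, all bounds of options are
admissible, and the options settle an alternative. -/
theorem Alternatives.exists_option (hx : Alternatives H C n x) (hne : oddWalk H C B ≠ []) :
    ∃ p ∈ options C (List.range (n + 1)).reverse (oddWalk H C B),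
      (x p.1.1 ≤ p.1.2 ∧ x p.2.1 ≤ p.2.2) ∧ p.1.2 ≤ n ∧ p.2.2 ≤ n ∧
      isEdge C B p.2.1 p.1.1 = true ∧ compatible C p.2.1 p.1.1 p.2.2 p.1.2 = true := by
  obtain ⟨h₀, l, hs, hH, hch, hodd, hlast⟩ := oddWalk_eq_cons rfl hne
  rw [hs]
  set cands := (List.range (n + 1)).reverse
  have hseq : ∀ t, ∃ m l', boundSeq C cands (h₀ :: l) t = (h₀, m) :: l' ∧
      IsBoundSeq C cands B (h₀, t) ((h₀, m) :: l') ∧ l'.length = l.length ∧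
      finalBound C cands (h₀ :: l) t = m := by
    intro t
    obtain ⟨⟨b1, b2⟩, l', h1, h2, h3, h4⟩ := isBoundSeq_foldl (cands := cands) (b₀ := (h₀, t)) l
      (h₀, t) [] rfl hch
    obtain rfl : b1 = h₀ := by rw [← hlast]; exact h4
    refine ⟨b2, l', h1, h2, by simpa using h3, ?_⟩
    have : boundSeq C cands (b1 :: l) t = (b1, b2) :: l' := h1
    rw [finalBound, this]; rfl
  have hp := headD_filter_max n (fun t => decide (t ≤ finalBound C cands (h₀ :: l) t)) (by simp)
  change (pivot C cands (h₀ :: l)) ≤ n ∧ decide (pivot C cands (h₀ :: l) ≤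
    finalBound C cands (h₀ :: l) (pivot C cands (h₀ :: l))) = true ∧ ∀ t ≤ n, _ → t ≤ pivot C cands (h₀ :: l) at hp
  obtain ⟨hp1, hp2, hp3⟩ := hp
  have hbest : ∀ h h' m, m ≤ x h → isEdge C B h h' = true → x h' ≤ best C cands h h' m :=
    fun h h' m hm he => hx.le_best hm (hx.mem_of_isEdge he).2
  have hnot : ¬Even l.length := Nat.not_even_iff_odd.2 hodd
  -- one of the two sequences has a pair of neighbours whose bounds hold
  have main : ∃ t ≤ n, ∃ p ∈ (boundSeq C cands (h₀ :: l) t).zip (boundSeq C cands (h₀ :: l) t).tail,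
      (t = pivot C cands (h₀ :: l) ∨ t = pivot C cands (h₀ :: l) + 1) ∧
      x p.1.1 ≤ p.1.2 ∧ x p.2.1 ≤ p.2.2 := by
    by_contra hcon
    push Not at hcon
    rcases Nat.lt_or_ge (pivot C cands (h₀ :: l)) (x h₀) with hlt | hge
    · have hn : pivot C cands (h₀ :: l) + 1 ≤ n := hlt.trans_le (hx.le _ hH)
      obtain ⟨m, l', h1, h2, h3, h4⟩ := hseq (pivot C cands (h₀ :: l) + 1)
      have h5 := (h2.alternate hbest l' (h₀, m) (fun p hpm hb => by
        have := hcon _ hn p (by rw [h1]; exact hpm) (Or.inr rfl) hb.1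
        omega)).2 hlt
      rw [h3, if_neg hnot] at h5
      have h6 := hp3 _ hn (by rw [h4]; exact decide_eq_true (le_trans hlt h5))
      omega
    · obtain ⟨m, l', h1, h2, h3, h4⟩ := hseq (pivot C cands (h₀ :: l))
      have h5 := (h2.alternate hbest l' (h₀, m) (fun p hpm hb => by
        have := hcon _ hp1 p (by rw [h1]; exact hpm) (Or.inl rfl) hb.1
        omega)).1 hge
      rw [h3, if_neg hnot] at h5
      rw [h4, decide_eq_true_eq] at hp2
      simp only at h5 hge
      omega
  obtain ⟨t, ht, p, hpm, hpt, hxp⟩ := main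
  obtain ⟨m, l', h1, h2, h3, h4⟩ := hseq t
  have hpm' : p ∈ ((h₀, m) :: l').zip l' := by rw [h1] at hpm; exact hpm
  obtain ⟨h5, h6, h7⟩ := h2.pairs l' _ p hpm'
  refine ⟨p, ?_, hxp, ?_, ?_, h6, ?_⟩
  · rw [options, List.mem_append]
    rcases hpt with rfl | rfl
    exacts [Or.inl hpm, Or.inr hpm]
  · rw [h5]; exact (best_spec C n _ _ _).1
  · rcases h7 with h7 | ⟨h, m', h7⟩
    · rw [h7]; exact ht
    · rw [h7]; exact (best_spec C n _ _ _).1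
  · rw [h5]; exact (best_spec C n _ _ _).2.1

theorem filter_mem_filter {α : Type} [DecidableEq α] (L : List α) (p : α → Bool) :
    L.filter (fun b => (L.filter p).any fun c => decide (c = b)) = L.filter p :=
  List.filter_congr fun b hb => by
    rw [Bool.eq_iff_iff]
    simp [hb]

/-- The number of pairs of halves with an unsettled alternative. -/
def edgeCount (H : List Half) (C : List (Bound × Bound)) (B : List Bound) : ℕ :=
  ((H.product H).toFinset.filter fun p => isEdge C B p.1 p.2 = true).card

theorem length_boundSeq (hs : List Half) (t : ℕ) :
    (boundSeq C cands hs t).length = hs.length := by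
  have key : ∀ (T : List Half) (l : List Bound),
      (T.foldl (seqStep C cands) l).length = T.length + l.length := by
    intro T
    induction T with
    | nil => simp
    | cons h T ih => intro l; rw [List.foldl_cons, ih]; simp [seqStep]; omega
  rw [boundSeq, key]
  cases hs <;> simp

theorem length_options_le (hs : List Half) : (options C cands hs).length ≤ 2 * hs.length := by
  simp only [options, List.length_append, List.length_zip, List.length_tail, length_boundSeq]
  omega

theorem length_oddWalk_le : (oddWalk H C B).length ≤ (walkStates H).length := by
  rw [oddWalk, List.length_map]
  exact length_findWalk_le

/-- For every solution there is a sequence of choices that leads to bounds that hold for it and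
leave a bipartite graph of unsettled alternatives. -/
theorem Alternatives.exists_branches (hx : Alternatives H C n x) :
    ∃ w : List ℕ, w.length = (H.product H).length ∧ (∀ a ∈ w, a < 2 * (walkStates H).length) ∧
      let B := branches H C (List.range (n + 1)).reverse
        (List.range (2 * (walkStates H).length)) w
      (∀ b ∈ B, b.1 ∈ H ∧ x b.1 ≤ b.2 ∧ b.2 ≤ n) ∧ (∀ h ∈ H, (h, n) ∈ B) ∧
      ∃ col : Half → Bool, ∀ h h', isEdge C B h h' = true → col h ≠ col h' := by
  set cands := (List.range (n + 1)).reverse with hcands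
  have hmc : ∀ m, m ∈ cands ↔ m ≤ n := fun m => by simp [cands]
  have hhead : cands.headD 0 = n := by
    rw [hcands, List.range_succ, List.reverse_append]; rfl
  set q := 2 * (walkStates H).length
  have key : ∀ k ≤ (H.product H).length, ∃ w : List ℕ, w.length = k ∧ (∀ a ∈ w, a < q) ∧
      (∀ b ∈ branches H C cands (List.range q) w, b.1 ∈ H ∧ x b.1 ≤ b.2 ∧ b.2 ≤ n) ∧
      (∀ h ∈ H, (h, n) ∈ branches H C cands (List.range q) w) ∧
      (oddWalk H C (branches H C cands (List.range q) w) = [] ∨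
        edgeCount H C (branches H C cands (List.range q) w) + k ≤ (H.product H).length) := by
    intro k
    induction k with
    | zero =>
      intro _
      refine ⟨[], rfl, by simp, ?_, ?_, Or.inr ?_⟩
      · rintro ⟨b1, b2⟩ hb
        rw [branches, List.foldl_nil, List.mem_filter, hhead, decide_eq_true_eq] at hb
        obtain ⟨hb1, rfl⟩ := hb
        have hb1 := (List.mem_product.1 hb1).1
        exact ⟨hb1, hx.le _ hb1, le_rfl⟩
      · intro h hh
        rw [branches, List.foldl_nil, List.mem_filter, hhead]
        exact ⟨List.mem_product.2 ⟨hh, (hmc n).2 le_rfl⟩, by simp⟩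
      · exact (Finset.card_filter_le _ _).trans (List.toFinset_card_le _)
    | succ k ih =>
      intro hk
      obtain ⟨w, h1, h2, h3, h4, h5⟩ := ih (by omega)
      have hq : 0 < q := by
        have h0 : H ≠ [] := by
          rintro rfl; exact absurd hk (by simp [List.product])
        obtain ⟨h, H', rfl⟩ := List.exists_cons_of_ne_nil h0
        exact Nat.mul_pos two_pos (List.length_pos_of_mem
          ((mem_walkStates (s := (h, (h, true)))).2 ⟨by simp, by simp⟩))
      set B := branches H C cands (List.range q) w with hB
      have hstep : ∀ a, branches H C cands (List.range q) (w ++ [a]) =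
          branch H C cands (List.range q) B a := fun a => by
        rw [branches, List.foldl_append]; rfl
      have hBU : ∀ b ∈ B, b ∈ H.product cands := fun ⟨b1, b2⟩ hb =>
        List.mem_product.2 ⟨(h3 _ hb).1, (hmc _).2 (h3 _ hb).2.2⟩
      have hsub : ∀ a, ∀ b ∈ B, b ∈ branch H C cands (List.range q) B a := fun a b hb =>
        List.mem_filter.2 ⟨hBU b hb, by
          simp only [Bool.or_eq_true, List.any_eq_true, decide_eq_true_eq]
          exact Or.inl ⟨b, hb, rfl⟩⟩
      by_cases hne : oddWalk H C B = []
      · have hopt : options C cands (oddWalk H C B) = [] := by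
          rw [hne]; rfl
        have heq : branch H C cands (List.range q) B 0 = B := by
          rw [branch, hopt]
          simp only [List.zip_nil_right, List.any_nil, Bool.or_false]
          rcases List.eq_nil_or_concat' w with hw | ⟨w', a, hw⟩
          · rw [hB, hw, branches, List.foldl_nil]
            exact filter_mem_filter _ _
          · rw [hB, hw, branches, List.foldl_append, List.foldl_cons, List.foldl_nil, branch]
            exact filter_mem_filter _ _
        refine ⟨w ++ [0], by simp [h1], ?_, ?_⟩
        · simpa [or_imp, forall_and, hq] using h2
        · rw [hstep, heq]
          exact ⟨h3, h4, Or.inl hne⟩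
      · obtain ⟨p, hp, hxp, hp1, hp2, hpe, hpc⟩ := hx.exists_option hne
        obtain ⟨i, hi, rfl⟩ := List.getElem_of_mem hp
        set p := (options C cands (oddWalk H C B))[i] with hpdef
        have hiq : i < q := hi.trans_le ((length_options_le _).trans
          (Nat.mul_le_mul_left 2 length_oddWalk_le))
        have hmem : ∀ b, b ∈ branch H C cands (List.range q) B i ↔
            b ∈ B ∨ b = p.1 ∨ b = p.2 := by
          intro b
          constructor
          · intro hb
            have := (List.mem_filter.1 hb).2
            simp only [Bool.or_eq_true, List.any_eq_true, decide_eq_true_eq, Bool.and_eq_true] at this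
            rcases this with ⟨c, hc, rfl⟩ | ⟨⟨a, o⟩, ho, rfl, ho2⟩
            · exact Or.inl hc
            · right
              obtain ⟨j, hj, hj2⟩ := List.getElem_of_mem ho
              rw [List.getElem_zip, Prod.mk.injEq, List.getElem_range] at hj2
              obtain ⟨rfl, rfl⟩ := hj2
              exact ho2
          · rintro (hb | hb)
            · exact hsub i b hb
            · refine List.mem_filter.2 ⟨?_, ?_⟩
              · have he := hx.mem_of_isEdge hpe
                rcases hb with rfl | rfl
                · exact List.mem_product.2 ⟨he.2, (hmc _).2 hp1⟩
                · exact List.mem_product.2 ⟨he.1, (hmc _).2 hp2⟩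
              · simp only [Bool.or_eq_true, List.any_eq_true, decide_eq_true_eq, Bool.and_eq_true]
                refine Or.inr ⟨(i, p), ?_, rfl, hb⟩
                have : ((List.range q).zip (options C cands (oddWalk H C B)))[i]'(by
                    rw [List.length_zip, List.length_range]; exact lt_min hiq hi) = (i, p) := by
                  rw [List.getElem_zip, List.getElem_range]
                rw [← this]
                exact List.getElem_mem _
        refine ⟨w ++ [i], by simp [h1], ?_, ?_⟩
        · simpa [or_imp, forall_and, hiq] using h2
        · rw [hstep]
          refine ⟨fun b hb => ?_, fun h hh => hsub i _ (h4 h hh), Or.inr ?_⟩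
          · have he := hx.mem_of_isEdge hpe
            rcases (hmem b).1 hb with hb | rfl | rfl
            exacts [h3 b hb, ⟨he.2, hxp.1, hp1⟩, ⟨he.1, hxp.2, hp2⟩]
          · have hlt : edgeCount H C (branch H C cands (List.range q) B i) < edgeCount H C B := by
              refine Finset.card_lt_card (Finset.ssubset_iff_subset_ne.2 ⟨?_, ?_⟩)
              · intro r hr
                rw [Finset.mem_filter] at hr ⊢
                exact ⟨hr.1, isEdge_mono (hsub i) hr.2⟩
              · intro heq
                have he := hx.mem_of_isEdge hpe
                have h6 : (p.2.1, p.1.1) ∈ (H.product H).toFinset.filter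
                    fun r => isEdge C B r.1 r.2 = true :=
                  Finset.mem_filter.2 ⟨List.mem_toFinset.2 (List.mem_product.2 he), hpe⟩
                rw [← heq, Finset.mem_filter] at h6
                obtain ⟨c, hc, h7, h8, h9, h10⟩ := isEdge_iff.1 h6.2
                have h11 := List.all_eq_true.1 hpc c hc
                simp only [h7, h8, decide_true, Bool.and_self, Bool.not_true, Bool.false_or,
                  Bool.or_eq_true, decide_eq_true_eq] at h11
                rcases h11 with h11 | h11
                · have : implied (branch H C cands (List.range q) B i) c.1 = true :=
                    List.any_eq_true.2 ⟨p.2, (hmem _).2 (Or.inr (Or.inr rfl)), by simp [h7, h11]⟩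
                  rw [this] at h9; simp at h9
                · have : implied (branch H C cands (List.range q) B i) c.2 = true :=
                    List.any_eq_true.2 ⟨p.1, (hmem _).2 (Or.inr (Or.inl rfl)), by simp [h8, h11]⟩
                  rw [this] at h10; simp at h10
            rcases h5 with h5 | h5
            · exact absurd h5 hne
            · omega
  obtain ⟨w, h1, h2, h3, h4, h5⟩ := key _ le_rfl
  refine ⟨w, h1, h2, h3, h4, exists_coloring hx ?_⟩
  rcases h5 with h5 | h5
  · exact h5
  · by_contra hne
    obtain ⟨p, -, -, -, -, hpe, -⟩ := hx.exists_option hne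
    have he := hx.mem_of_isEdge hpe
    have : 0 < edgeCount H C (branches H C cands (List.range q) w) :=
      Finset.card_pos.2 ⟨(p.2.1, p.1.1), Finset.mem_filter.2
        ⟨List.mem_toFinset.2 (List.mem_product.2 he), hpe⟩⟩
    omega

end branching

/-! ### Scaling algorithm for the dual of a flow problem -/

/-- The side of a vertex: `(v, false)` lies before `v` and `(v, true)` after it. -/
abbrev Node := ℕ × Bool

/-- The constraint that the potential grows by at least `c` from `i` to `j`, as `((i, j), c)`;
here `c` is `0` or `1`. -/
abbrev Item := (Node × Node) × Bool

/-- A constraint, traversed forwards (`true`) or backwards (`false`). -/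
abbrev Arc := Item × Bool

section defs

instance : DecidableEq (Node × (Arc × ℕ)) := @instDecidableEqProd _ _ _ instDecidableEqProd

/-- The node where an arc starts. -/
def Arc.src (a : Arc) : Node := bif a.2 then a.1.1.1 else a.1.1.2

/-- The node where an arc ends. -/
def Arc.dst (a : Arc) : Node := bif a.2 then a.1.1.2 else a.1.1.1

/-- A backward arc can be used if the counter of its constraint is positive. -/
def avail (Z : List (Item × ℕ)) (a : Arc) : Bool :=
  a.2 || Z.any fun e => decide (e.1 = a.1) && !decide (e.2 = 0)

/-- The value `v'` arises from `v` by adding the gain of the arc `a`. -/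
def shift (a : Arc) (v v' : ℕ) : Bool :=
  bif a.1.2 then (bif a.2 then decide (v' = v + 1) else decide (v = v' + 1)) else decide (v = v')

/-- The states `(i, a, v)` of a search for residual walks: the start of the walk, its last arc, and
its gain, shifted by the number of nodes. -/
def flowStates (nodes : List Node) (Z : List (Item × ℕ)) : List (Node × (Arc × ℕ)) :=
  nodes.product (((Z.map Prod.fst).product [true, false]).product
    (List.range (default :: (nodes ++ nodes)).length))

/-- A residual walk goes on with another arc. -/
def flowStep (Z : List (Item × ℕ)) (s t : Node × (Arc × ℕ)) : Bool :=
  decide (s.1 = t.1) && decide (s.2.1.dst = t.2.1.src) && avail Z t.2.1 && shift t.2.1 s.2.2 t.2.2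

/-- A residual walk consists of one arc. -/
def flowInit (nodes : List Node) (Z : List (Item × ℕ)) (s : Node × (Arc × ℕ)) : Bool :=
  decide (s.1 = s.2.1.src) && avail Z s.2.1 && shift s.2.1 nodes.length s.2.2

/-- A shortest closed residual walk of positive gain, if there is one. -/
def posCycle (nodes : List Node) (Z : List (Item × ℕ)) : List Arc :=
  (findWalk (flowStates nodes Z) (flowStep Z) (flowInit nodes Z) fun s =>
    decide (s.2.1.dst = s.1) && decide (nodes.length + 1 ≤ s.2.2)).map fun s => s.2.1

/-- The counter of an item after the arcs in `w` have been used. -/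
def bump (w : List Arc) (e : Item × ℕ) : ℕ :=
  bif w.any (fun a => decide (a = (e.1, true))) then
    (bif w.any (fun a => decide (a = (e.1, false))) then e.2 else e.2 + 1)
  else (bif w.any (fun a => decide (a = (e.1, false))) then e.2 - 1 else e.2)

/-- Pushes one unit along a shortest closed residual walk of positive gain. -/
def augment (nodes : List Node) (Z : List (Item × ℕ)) : List (Item × ℕ) :=
  Z.map fun e => (e.1, bump (posCycle nodes Z) e)

/-- Doubles the counters and adds the lowest bits of the weights `W`. -/
def rescale (W Z : List (Item × ℕ)) : List (Item × ℕ) :=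
  Z.map fun e => (e.1, Nat.bit (W.any fun f => decide (f.1 = e.1) && f.2.bodd) e.2)

/-- The weights `W` divided by the powers of two, down to `0`. -/
def scales (W : List (Item × ℕ)) : List (List (Item × ℕ)) :=
  (W.flatMap fun e => e.2.bits).foldl
    (fun L _ => ((L.headD []).map fun e => (e.1, e.2.div2)) :: L) [W]

/-- For each scale, a rescaling followed by sufficiently many augmentations. -/
def flowOps (nodes : List Node) (W : List (Item × ℕ)) : List (Bool × List (Item × ℕ)) :=
  (scales W).flatMap fun V => (true, V) :: (W.product nodes).map fun _ => (false, [])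

/-- The counters after the operations `ops`. -/
def runOps (nodes : List Node) (ops : List (Bool × List (Item × ℕ))) (W : List (Item × ℕ)) :
    List (Item × ℕ) :=
  ops.foldl (fun Z op => bif op.1 then rescale op.2 Z else augment nodes Z)
    (W.map fun e => (e.1, 0))

/-- The final counters. -/
def flow (nodes : List Node) (W : List (Item × ℕ)) : List (Item × ℕ) :=
  runOps nodes (flowOps nodes W) W

/-- The nodes with the shifted gains of residual walks that end there. -/
def gains (nodes : List Node) (Z : List (Item × ℕ)) : List (Node × ℕ) :=
  (reachable (flowStates nodes Z) (flowStep Z) (flowInit nodes Z)).map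
    (fun s => (s.2.1.dst, s.2.2)) ++ nodes.map fun i => (i, nodes.length)

/-- The potential of node `i` is smaller than that of node `j`. -/
def potLT (R : List (Node × ℕ)) (i j : Node) : Bool :=
  R.any fun x => decide (x.1 = j) && R.all fun y => !decide (y.1 = i) || decide (y.2 + 1 ≤ x.2)

end defs

section time
variable {δ : Type} [Enc δ] {nodes : δ → List Node} {W Z : δ → List (Item × ℕ)}

@[fun_prop] theorem PT.src {a : δ → Arc} (ha : PT a) : PT (fun d => (a d).src) := by
  unfold Arc.src; fun_prop

@[fun_prop] theorem PT.dst {a : δ → Arc} (ha : PT a) : PT (fun d => (a d).dst) := by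
  unfold Arc.dst; fun_prop

@[fun_prop] theorem PT.avail {a : δ → Arc} (hZ : PT Z) (ha : PT a) :
    PT (fun d => avail (Z d) (a d)) := by
  unfold _root_.avail; fun_prop

@[fun_prop] theorem PT.shift {a : δ → Arc} {v v' : δ → ℕ} (ha : PT a) (hv : PT v) (hv' : PT v') :
    PT (fun d => shift (a d) (v d) (v' d)) := by
  unfold _root_.shift; fun_prop

@[fun_prop] theorem PT.flowStates (hn : PT nodes) (hZ : PT Z) :
    PT (fun d => flowStates (nodes d) (Z d)) := by
  unfold _root_.flowStates; fun_prop

@[fun_prop] theorem PT.flowStep {s t : δ → Node × (Arc × ℕ)} (hZ : PT Z) (hs : PT s) (ht : PT t) :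
    PT (fun d => flowStep (Z d) (s d) (t d)) := by
  unfold _root_.flowStep; fun_prop

@[fun_prop] theorem PT.flowInit {s : δ → Node × (Arc × ℕ)} (hn : PT nodes) (hZ : PT Z) (hs : PT s) :
    PT (fun d => flowInit (nodes d) (Z d) (s d)) := by
  unfold _root_.flowInit; fun_prop

@[fun_prop] theorem PT.posCycle (hn : PT nodes) (hZ : PT Z) :
    PT (fun d => posCycle (nodes d) (Z d)) := by
  unfold _root_.posCycle
  exact PT.map (PT.findWalk (by fun_prop) (by fun_prop) (by fun_prop) (by fun_prop)) (by fun_prop)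

@[fun_prop] theorem PT.bump {w : δ → List Arc} {e : δ → Item × ℕ} (hw : PT w) (he : PT e) :
    PT (fun d => bump (w d) (e d)) := by
  unfold _root_.bump; fun_prop

@[fun_prop] theorem PT.augment (hn : PT nodes) (hZ : PT Z) :
    PT (fun d => augment (nodes d) (Z d)) := by
  unfold _root_.augment; fun_prop

@[fun_prop] theorem PT.rescale (hW : PT W) (hZ : PT Z) :
    PT (fun d => rescale (W d) (Z d)) := by
  unfold _root_.rescale; fun_prop

theorem esize_div2_le (n : ℕ) : esize n.div2 ≤ esize n := by
  rw [esize_nat, Nat.div2_bits_eq_tail]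
  exact esize_sublist (List.tail_sublist _)

theorem esize_halve_le (W : List (Item × ℕ)) :
    esize (W.map fun e => (e.1, e.2.div2)) ≤ esize W := by
  induction W with
  | nil => simp
  | cons e W ih =>
    obtain ⟨a, n⟩ := e
    have := esize_div2_le n
    simp only [List.map_cons, esize_cons, esize_pair (α := Item)]
    omega

@[fun_prop] theorem PT.scales (hW : PT W) : PT (fun d => scales (W d)) := by
  have hbits : PT fun d => (W d).flatMap fun e => e.2.bits := by fun_prop
  refine PT.foldl hbits (by fun_prop) (by fun_prop)
    (M := fun d => (esize ((W d).flatMap fun e => e.2.bits) + 1) * (esize (W d) + 1) + 1)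
    (((hbits.size.add (PB.const 1)).mul (hW.size.add (PB.const 1))).add (PB.const 1))
    fun d l₁ l₂ h => ?_
  have key : ∀ (T : List Bool) (L : List (List (Item × ℕ))), L ≠ [] →
      (∀ M ∈ L, esize M ≤ esize (W d)) →
      (T.foldl (fun L _ => ((L.headD []).map fun e => (e.1, e.2.div2)) :: L) L).length =
        T.length + L.length ∧
      ∀ M ∈ T.foldl (fun L _ => ((L.headD []).map fun e => (e.1, e.2.div2)) :: L) L,
        esize M ≤ esize (W d) := by
    intro T
    induction T with
    | nil => intro L _ hL; exact ⟨by simp, hL⟩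
    | cons b T ih =>
      intro L hne hL
      obtain ⟨M, L, rfl⟩ := List.exists_cons_of_ne_nil hne
      have := ih ((M.map fun e => (e.1, e.2.div2)) :: M :: L) (by simp) (by
        intro M' hM'
        rcases List.mem_cons.1 hM' with rfl | hM'
        · exact (esize_halve_le M).trans (hL M (by simp))
        · exact hL M' hM')
      refine ⟨?_, this.2⟩
      have h1 := this.1
      simp only [List.length_cons, List.foldl_cons, List.headD_cons] at h1 ⊢
      omega
  obtain ⟨h1, h2⟩ := key l₁ [W d] (by simp) (by simp)
  refine (esize_le_of_forall h2).trans ?_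
  have h3 := length_lt_esize ((W d).flatMap fun e => e.2.bits)
  rw [h, List.length_append, ← h] at h3
  simp only [List.length_singleton] at h1
  exact Nat.add_le_add_right (Nat.mul_le_mul_right _ (by omega)) 1

@[fun_prop] theorem PT.flowOps (hn : PT nodes) (hW : PT W) :
    PT (fun d => flowOps (nodes d) (W d)) := by
  unfold _root_.flowOps; fun_prop

theorem bump_le (w : List Arc) (e : Item × ℕ) : bump w e ≤ e.2 + 1 := by
  unfold bump
  cases w.any (fun a => decide (a = (e.1, true))) <;>
    cases w.any (fun a => decide (a = (e.1, false))) <;> simp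
  omega

theorem runOps_bound (nodes : List Node) (W : List (Item × ℕ)) (T : List (Bool × List (Item × ℕ))) :
    (runOps nodes T W).map Prod.fst = W.map Prod.fst ∧
    ∀ e ∈ runOps nodes T W, e.2 < 2 ^ T.length := by
  induction T using List.reverseRecOn with
  | nil =>
    refine ⟨by simp [runOps, Function.comp_def], fun e he => ?_⟩
    obtain ⟨f, _, rfl⟩ := List.mem_map.1 he
    simp
  | append_singleton T op ih =>
    have hrec : runOps nodes (T ++ [op]) W =
      bif op.1 then rescale op.2 (runOps nodes T W) else augment nodes (runOps nodes T W) := by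
      rw [runOps, List.foldl_append]; rfl
    rw [hrec, List.length_append, List.length_singleton, pow_succ]
    cases op.1 with
    | true =>
      refine ⟨by rw [← ih.1]; simp [rescale, Function.comp_def], fun e he => ?_⟩
      obtain ⟨f, hf, rfl⟩ := List.mem_map.1 he
      have := ih.2 f hf
      simp only [Nat.bit_val]
      cases (op.2.any fun g => decide (g.1 = f.1) && g.2.bodd) <;> simp <;> omega
    | false =>
      refine ⟨by rw [← ih.1]; simp [augment, Function.comp_def], fun e he => ?_⟩
      obtain ⟨f, hf, rfl⟩ := List.mem_map.1 he
      have h1 := ih.2 f hf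
      have h2 := bump_le (posCycle nodes (runOps nodes T W)) f
      simp only
      omega

@[fun_prop] theorem PT.flow (hn : PT nodes) (hW : PT W) : PT (fun d => flow (nodes d) (W d)) := by
  have hops := PT.flowOps hn hW
  refine PT.foldl hops (by fun_prop) (by fun_prop)
    (M := fun d => esize (W d) * (esize (W d) + 4 * esize (_root_.flowOps (nodes d) (W d)) + 3) + 1)
    ((hW.size.mul ((hW.size.add ((PB.const 4).mul hops.size)).add (PB.const 3))).add (PB.const 1))
    fun d l₁ l₂ h => ?_
  obtain ⟨h1, h2⟩ := runOps_bound (nodes d) (W d) l₁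
  have h3 := length_lt_esize (_root_.flowOps (nodes d) (W d))
  rw [h, List.length_append, ← h] at h3
  refine (esize_le_of_forall (M := esize (W d) + 4 * esize (_root_.flowOps (nodes d) (W d)) + 2)
    fun e he => ?_).trans ?_
  · have h4 := esize_nat_le (h2 e he)
    have h5 : e.1 ∈ (W d).map Prod.fst := by rw [← h1]; exact List.mem_map_of_mem he
    obtain ⟨f, hf, hfe⟩ := List.mem_map.1 h5
    have h6 : esize e.1 ≤ esize (W d) := by
      rw [← hfe]; exact (esize_fst_le f).trans (esize_mem_le hf)
    obtain ⟨a, n⟩ := e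
    rw [esize_pair]
    simp only at h4 h6
    omega
  · have h4 := congrArg List.length h1
    have h5 := length_lt_esize (W d)
    rw [List.length_map, List.length_map] at h4
    change (runOps (nodes d) l₁ (W d)).length * _ + 1 ≤ _
    rw [h4]
    exact Nat.add_le_add_right (Nat.mul_le_mul_right _ h5.le) 1

@[fun_prop] theorem PT.gains (hn : PT nodes) (hZ : PT Z) : PT (fun d => gains (nodes d) (Z d)) := by
  unfold _root_.gains
  exact PT.append (PT.map (PT.reachable (by fun_prop) (by fun_prop) (by fun_prop)) (by fun_prop))
    (by fun_prop)

@[fun_prop] theorem PT.potLT {R : δ → List (Node × ℕ)} {i j : δ → Node} (hR : PT R) (hi : PT i)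
    (hj : PT j) : PT (fun d => potLT (R d) (i d) (j d)) := by
  unfold _root_.potLT; fun_prop

end time

/-! ### Correctness of the scaling algorithm -/

section residual

/-- `1` for a forward arc, `-1` for a backward arc. -/
def Arc.sign (r : Arc) : ℤ := if r.2 then 1 else -1

/-- The required growth of an item, as an integer. -/
def Item.req (a : Item) : ℤ := if a.2 then 1 else 0

/-- The gain of a list of arcs. -/
def gain (w : List Arc) : ℤ := (w.map fun r => r.sign * r.1.req).sum

/-- `ResWalk I ζ i w j`: the arcs `w` form a walk from `i` to `j` in the residual graph of the
counters `ζ` on the items `I`. -/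
def ResWalk (I : List Item) (ζ : Item → ℕ) : Node → List Arc → Node → Prop
  | i, [], j => i = j
  | i, r :: w, j => r.src = i ∧ r.1 ∈ I ∧ (r.2 = true ∨ 0 < ζ r.1) ∧ ResWalk I ζ r.dst w j

/-- There is no closed residual walk of positive gain. -/
def Optimal (I : List Item) (ζ : Item → ℕ) : Prop := ∀ i w, ResWalk I ζ i w i → gain w ≤ 0

@[simp] theorem gain_nil : gain [] = 0 := rfl

@[simp] theorem gain_cons (r : Arc) (w : List Arc) : gain (r :: w) = r.sign * r.1.req + gain w := by
  simp [gain]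

@[simp] theorem gain_append (w w' : List Arc) : gain (w ++ w') = gain w + gain w' := by
  simp [gain]

theorem abs_gain_le (w : List Arc) : |gain w| ≤ w.length := by
  induction w with
  | nil => simp
  | cons r w ih =>
    rw [gain_cons, List.length_cons]
    have : |r.sign * r.1.req| ≤ 1 := by
      unfold Arc.sign Item.req
      split_ifs <;> simp
    have := abs_add_le (r.sign * r.1.req) (gain w)
    push_cast
    omega

variable {I : List Item} {ζ : Item → ℕ} {nodes : List Node}

theorem resWalk_append {i j : Node} {w w' : List Arc} :
    ResWalk I ζ i (w ++ w') j ↔ ∃ k, ResWalk I ζ i w k ∧ ResWalk I ζ k w' j := by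
  induction w generalizing i with
  | nil => simp [ResWalk]
  | cons r w ih =>
    simp only [List.cons_append, ResWalk, ih]
    constructor
    · rintro ⟨h1, h2, h3, k, h4, h5⟩; exact ⟨k, ⟨h1, h2, h3, h4⟩, h5⟩
    · rintro ⟨k, ⟨h1, h2, h3, h4⟩, h5⟩; exact ⟨h1, h2, h3, k, h4, h5⟩

theorem ResWalk.mem {i j : Node} {w : List Arc} (h : ResWalk I ζ i w j) :
    ∀ r ∈ w, r.1 ∈ I ∧ (r.2 = true ∨ 0 < ζ r.1) := by
  induction w generalizing i with
  | nil => simp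
  | cons r w ih =>
    intro x hx
    rcases List.mem_cons.1 hx with rfl | hx
    exacts [⟨h.2.1, h.2.2.1⟩, ih h.2.2.2 x hx]

theorem exists_split_of_not_nodup {α β : Type*} [DecidableEq β] (f : α → β) {w : List α}
    (h : ¬ (w.map f).Nodup) : ∃ u a v b t, w = u ++ (a :: v) ++ (b :: t) ∧ f a = f b := by
  induction w with
  | nil => simp at h
  | cons x w ih =>
    by_cases hx : f x ∈ w.map f
    · obtain ⟨b, hb, hbx⟩ := List.mem_map.1 hx
      obtain ⟨v, t, rfl⟩ := List.append_of_mem hb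
      exact ⟨[], x, v, b, t, by simp, hbx.symm⟩
    · rw [List.map_cons, List.nodup_cons] at h
      obtain ⟨u, a, v, b, t, rfl, hab⟩ := ih fun h' => h ⟨hx, h'⟩
      exact ⟨x :: u, a, v, b, t, by simp, hab⟩

/-- A walk that visits a node twice splits into a closed walk and a shorter walk with the same
ends. -/
theorem ResWalk.exists_split {i j : Node} {w : List Arc} (h : ResWalk I ζ i w j)
    (hw : ¬ (w.map Arc.src).Nodup) : ∃ k c d, ResWalk I ζ k c k ∧ ResWalk I ζ i d j ∧
      gain w = gain c + gain d ∧ c.length < w.length ∧ d.length < w.length := by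
  obtain ⟨u, a, v, b, t, rfl, hab⟩ := exists_split_of_not_nodup _ hw
  obtain ⟨k, h1, h2⟩ := resWalk_append.1 h
  obtain ⟨l, h3, h4⟩ := resWalk_append.1 h1
  obtain rfl : a.src = l := h4.1
  obtain rfl : b.src = k := h2.1
  rw [← hab] at h2 h4
  refine ⟨a.src, a :: v, u ++ b :: t, h4, resWalk_append.2 ⟨_, h3, h2⟩, ?_, ?_, ?_⟩
  · simp only [gain_append]; ring
  · simp only [List.length_append, List.length_cons]; omega
  · simp only [List.length_append, List.length_cons]; omega

theorem ResWalk.nodup_length (hI : ∀ a ∈ I, a.1.1 ∈ nodes ∧ a.1.2 ∈ nodes) {i j : Node}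
    {w : List Arc} (h : ResWalk I ζ i w j) (hw : (w.map Arc.src).Nodup) :
    w.length ≤ nodes.length := by
  have := (hw.subperm (l₂ := nodes) fun x hx => by
    obtain ⟨r, hr, rfl⟩ := List.mem_map.1 hx
    have := hI _ (h.mem r hr).1
    unfold Arc.src
    cases r.2
    exacts [this.2, this.1]).length_le
  simpa using this

theorem exists_short_cycle {i : Node} {w : List Arc} (h : ResWalk I ζ i w i) (hg : 0 < gain w) :
    ∃ k c, ResWalk I ζ k c k ∧ 0 < gain c ∧ (c.map Arc.src).Nodup ∧ c.length ≤ w.length := by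
  induction hn : w.length using Nat.strong_induction_on generalizing i w with
  | _ n ih =>
    by_cases hw : (w.map Arc.src).Nodup
    · exact ⟨i, w, h, hg, hw, hn.le⟩
    · obtain ⟨k, c, d, h1, h2, h3, h4, h5⟩ := h.exists_split hw
      rcases lt_or_ge 0 (gain c) with hc | hc
      · obtain ⟨k, e, h6, h7, h8, h9⟩ := ih _ (hn ▸ h4) h1 hc rfl
        exact ⟨k, e, h6, h7, h8, by omega⟩
      · obtain ⟨k, e, h6, h7, h8, h9⟩ := ih _ (hn ▸ h5) h2 (by omega) rfl
        exact ⟨k, e, h6, h7, h8, by omega⟩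

theorem Optimal.exists_short (ho : Optimal I ζ) {i j : Node} {w : List Arc}
    (h : ResWalk I ζ i w j) :
    ∃ d, ResWalk I ζ i d j ∧ gain w ≤ gain d ∧ (d.map Arc.src).Nodup := by
  induction hn : w.length using Nat.strong_induction_on generalizing w with
  | _ n ih =>
    by_cases hw : (w.map Arc.src).Nodup
    · exact ⟨w, h, le_rfl, hw⟩
    · obtain ⟨k, c, d, h1, h2, h3, h4, h5⟩ := h.exists_split hw
      obtain ⟨e, h6, h7, h8⟩ := ih _ (hn ▸ h5) h2 rfl
      exact ⟨e, h6, by have := ho _ _ h1; omega, h8⟩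

/-- The largest gains of residual walks form an optimal potential. -/
theorem Optimal.exists_potential (ho : Optimal I ζ)
    (hI : ∀ a ∈ I, a.1.1 ∈ nodes ∧ a.1.2 ∈ nodes) : ∃ π : Node → ℤ,
      (∀ i w j, ResWalk I ζ i w j → gain w ≤ π j) ∧
      (∀ j, ∃ i w, ResWalk I ζ i w j ∧ gain w = π j ∧ w.length ≤ nodes.length) ∧
      (∀ j, 0 ≤ π j ∧ π j ≤ nodes.length) ∧
      (∀ a ∈ I, a.req ≤ π a.1.2 - π a.1.1) ∧
      ∀ a ∈ I, 0 < ζ a → π a.1.2 - π a.1.1 = a.req := by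
  have hex : ∀ j, ∃ m : ℤ, (∃ i w, ResWalk I ζ i w j ∧ gain w = m) ∧
      ∀ z : ℤ, (∃ i w, ResWalk I ζ i w j ∧ gain w = z) → z ≤ m := by
    intro j
    refine Int.exists_greatest_of_bdd ⟨nodes.length, ?_⟩ ⟨0, j, [], rfl, rfl⟩
    rintro z ⟨i, w, h, rfl⟩
    obtain ⟨d, h1, h2, h3⟩ := ho.exists_short h
    have := h1.nodup_length hI h3
    have := (abs_le.1 (abs_gain_le d)).2
    omega
  choose π hπ hmax using hex
  have h1 : ∀ i w j, ResWalk I ζ i w j → gain w ≤ π j := fun i w j h => hmax j _ ⟨i, w, h, rfl⟩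
  have h2 : ∀ j, ∃ i w, ResWalk I ζ i w j ∧ gain w = π j ∧ w.length ≤ nodes.length := by
    intro j
    obtain ⟨i, w, h, hg⟩ := hπ j
    obtain ⟨d, h3, h4, h5⟩ := ho.exists_short h
    exact ⟨i, d, h3, le_antisymm (h1 _ _ _ h3) (by omega), h3.nodup_length hI h5⟩
  have h3 : ∀ r : Arc, r.1 ∈ I → (r.2 = true ∨ 0 < ζ r.1) → π r.src + r.sign * r.1.req ≤ π r.dst := by
    intro r hr hr'
    obtain ⟨i, w, h, hg, -⟩ := h2 r.src
    have := h1 i (w ++ [r]) r.dst (resWalk_append.2 ⟨_, h, rfl, hr, hr', rfl⟩)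
    simpa [hg] using this
  refine ⟨π, h1, h2, fun j => ⟨h1 j [] j rfl, ?_⟩, fun a ha => ?_, fun a ha hz => ?_⟩
  · obtain ⟨i, w, h, hg, hl⟩ := h2 j
    have := (abs_le.1 (abs_gain_le w)).2
    omega
  · have := h3 (a, true) ha (Or.inl rfl)
    simp only [Arc.src, Arc.dst, Arc.sign, cond_true, if_true, one_mul] at this
    omega
  · have e1 := h3 (a, true) ha (Or.inl rfl)
    have e2 := h3 (a, false) ha (Or.inr hz)
    simp only [Arc.src, Arc.dst, Arc.sign, cond_true, cond_false, if_true, one_mul,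
      Bool.false_eq_true, if_false] at e1 e2
    omega

/-! ### Residual walks found by the search -/

theorem avail_iff (r : Arc) (hr : r.1 ∈ I) :
    avail (I.map fun a => (a, ζ a)) r = true ↔ r.2 = true ∨ 0 < ζ r.1 := by
  simp only [avail, Bool.or_eq_true, List.any_map, List.any_eq_true, Function.comp_apply,
    Bool.and_eq_true, decide_eq_true_eq, Bool.not_eq_true', decide_eq_false_iff_not]
  refine or_congr_right ⟨?_, fun h => ⟨r.1, hr, rfl, by omega⟩⟩
  rintro ⟨a, -, rfl, h⟩
  omega

theorem shift_iff (r : Arc) (v v' : ℕ) :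
    shift r v v' = true ↔ (v' : ℤ) = v + r.sign * r.1.req := by
  unfold shift Arc.sign Item.req
  cases r.1.2 <;> cases r.2 <;> simp <;> omega

theorem mem_flowStates (s : Node × (Arc × ℕ)) :
    s ∈ flowStates nodes (I.map fun a => (a, ζ a)) ↔
      s.1 ∈ nodes ∧ s.2.1.1 ∈ I ∧ s.2.2 ≤ 2 * nodes.length := by
  obtain ⟨i, ⟨a, b⟩, v⟩ := s
  simp only [flowStates, List.map_map, List.pair_mem_product, List.mem_range, List.length_cons,
    List.length_append]
  have : List.map (Prod.fst ∘ fun a => (a, ζ a)) I = I := by simp [Function.comp_def]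
  rw [this]
  cases b <;> simp <;> omega

theorem flowStep_iff (s t : Node × (Arc × ℕ)) (ht : t.2.1.1 ∈ I) :
    flowStep (I.map fun a => (a, ζ a)) s t = true ↔ s.1 = t.1 ∧ t.2.1.src = s.2.1.dst ∧
      (t.2.1.2 = true ∨ 0 < ζ t.2.1.1) ∧ (t.2.2 : ℤ) = s.2.2 + t.2.1.sign * t.2.1.1.req := by
  simp only [flowStep, Bool.and_eq_true, decide_eq_true_eq, avail_iff _ ht, shift_iff, and_assoc]
  rw [eq_comm (a := s.2.1.dst)]

theorem flowInit_iff (s : Node × (Arc × ℕ)) (hs : s.2.1.1 ∈ I) :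
    flowInit nodes (I.map fun a => (a, ζ a)) s = true ↔ s.2.1.src = s.1 ∧
      (s.2.1.2 = true ∨ 0 < ζ s.2.1.1) ∧
      (s.2.2 : ℤ) = nodes.length + s.2.1.sign * s.2.1.1.req := by
  simp only [flowInit, Bool.and_eq_true, decide_eq_true_eq, avail_iff _ hs, shift_iff, and_assoc]
  rw [eq_comm (a := s.1)]

theorem resWalk_of_steps {u v : Node × (Arc × ℕ)} {l : List (Node × (Arc × ℕ))}
    (h : Steps (flowStates nodes (I.map fun a => (a, ζ a)))
      (flowStep (I.map fun a => (a, ζ a))) u l v) :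
    v.1 = u.1 ∧ ResWalk I ζ u.2.1.dst (l.map fun s => s.2.1) v.2.1.dst ∧
      (v.2.2 : ℤ) = u.2.2 + gain (l.map fun s => s.2.1) := by
  induction l generalizing u with
  | nil => cases h; exact ⟨rfl, rfl, by simp⟩
  | cons x l ih =>
    obtain ⟨h1, h2, h3⟩ := h
    have hx := ((mem_flowStates x).1 h2).2.1
    obtain ⟨e1, e2, e3, e4⟩ := (flowStep_iff u x hx).1 h1
    obtain ⟨f1, f2, f3⟩ := ih h3
    refine ⟨f1.trans e1.symm, ⟨e2, hx, e3, f2⟩, ?_⟩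
    rw [List.map_cons, gain_cons]
    omega

theorem steps_of_resWalk {w : List Arc} {j : Node} {u : Node × (Arc × ℕ)} (hu : u.1 ∈ nodes)
    (h : ResWalk I ζ u.2.1.dst w j) (h1 : w.length ≤ u.2.2)
    (h2 : u.2.2 + w.length ≤ 2 * nodes.length) :
    ∃ l v, Steps (flowStates nodes (I.map fun a => (a, ζ a)))
      (flowStep (I.map fun a => (a, ζ a))) u l v ∧ l.length = w.length ∧ v.1 = u.1 ∧
      v.2.1.dst = j ∧ (v.2.2 : ℤ) = u.2.2 + gain w := by
  induction w generalizing u with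
  | nil => exact ⟨[], u, rfl, rfl, rfl, h, by simp⟩
  | cons r w ih =>
    obtain ⟨e1, e2, e3, e4⟩ := h
    have hr : |r.sign * r.1.req| ≤ 1 := by
      have := abs_gain_le [r]
      simpa using this
    rw [List.length_cons] at h1 h2
    have hr := abs_le.1 hr
    obtain ⟨m, hm⟩ : ∃ m : ℕ, (m : ℤ) = u.2.2 + r.sign * r.1.req :=
      ⟨(u.2.2 + r.sign * r.1.req).toNat, Int.toNat_of_nonneg (by omega)⟩
    obtain ⟨l, v, f1, f2, f3, f4, f5⟩ := ih (u := (u.1, r, m)) hu e4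
      (by simp only; omega) (by simp only; omega)
    refine ⟨(u.1, r, m) :: l, v, ⟨(flowStep_iff _ _ e2).2 ⟨rfl, e1, e3, hm⟩,
      (mem_flowStates _).2 ⟨hu, e2, by simp only; omega⟩, f1⟩, by simp [f2], f3, f4, ?_⟩
    rw [gain_cons]
    simp only at f5
    omega

/-- Short residual walks are found by the search. -/
theorem exists_steps {r : Arc} {w : List Arc} {i j : Node}
    (hI : ∀ a ∈ I, a.1.1 ∈ nodes ∧ a.1.2 ∈ nodes) (h : ResWalk I ζ i (r :: w) j)
    (hl : (r :: w).length ≤ nodes.length) :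
    ∃ u l v, u ∈ flowStates nodes (I.map fun a => (a, ζ a)) ∧
      flowInit nodes (I.map fun a => (a, ζ a)) u = true ∧
      Steps (flowStates nodes (I.map fun a => (a, ζ a)))
      (flowStep (I.map fun a => (a, ζ a))) u l v ∧ l.length = w.length ∧ v.1 = i ∧
      v.2.1.dst = j ∧ (v.2.2 : ℤ) = nodes.length + gain (r :: w) := by
  obtain ⟨e1, e2, e3, e4⟩ := h
  have hr : |r.sign * r.1.req| ≤ 1 := by
    have := abs_gain_le [r]
    simpa using this
  rw [List.length_cons] at hl
  have hr := abs_le.1 hr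
  obtain ⟨m, hm⟩ : ∃ m : ℕ, (m : ℤ) = nodes.length + r.sign * r.1.req :=
    ⟨(nodes.length + r.sign * r.1.req).toNat, Int.toNat_of_nonneg (by omega)⟩
  have hi : i ∈ nodes := by
    rw [← e1]
    unfold Arc.src
    cases r.2
    exacts [(hI _ e2).2, (hI _ e2).1]
  obtain ⟨l, v, f1, f2, f3, f4, f5⟩ := steps_of_resWalk (u := (i, r, m)) hi e4
      (by simp only; omega) (by simp only; omega)
  refine ⟨(i, r, m), l, v, (mem_flowStates _).2 ⟨hi, e2, by simp only; omega⟩,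
    (flowInit_iff _ e2).2 ⟨e1, e3, hm⟩, f1, f2, f3, f4, ?_⟩
  rw [gain_cons]
  simp only at f5
  omega

theorem resWalk_of_init {u v : Node × (Arc × ℕ)} {l : List (Node × (Arc × ℕ))}
    (hu : u ∈ flowStates nodes (I.map fun a => (a, ζ a)))
    (hi : flowInit nodes (I.map fun a => (a, ζ a)) u = true)
    (h : Steps (flowStates nodes (I.map fun a => (a, ζ a)))
      (flowStep (I.map fun a => (a, ζ a))) u l v) :
    ResWalk I ζ v.1 ((u :: l).map fun s => s.2.1) v.2.1.dst ∧
      (v.2.2 : ℤ) = nodes.length + gain ((u :: l).map fun s => s.2.1) := by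
  have hu' := ((mem_flowStates u).1 hu).2.1
  obtain ⟨e1, e2, e3⟩ := (flowInit_iff u hu').1 hi
  obtain ⟨f1, f2, f3⟩ := resWalk_of_steps h
  refine ⟨⟨e1.trans f1.symm, hu', e2, f2⟩, ?_⟩
  rw [List.map_cons, gain_cons]
  omega

theorem posCycle_spec (hI : ∀ a ∈ I, a.1.1 ∈ nodes ∧ a.1.2 ∈ nodes) :
    (posCycle nodes (I.map fun a => (a, ζ a)) = [] ∧ Optimal I ζ) ∨
    ∃ i, ResWalk I ζ i (posCycle nodes (I.map fun a => (a, ζ a))) i ∧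
      0 < gain (posCycle nodes (I.map fun a => (a, ζ a))) ∧
      ((posCycle nodes (I.map fun a => (a, ζ a))).map Arc.src).Nodup := by
  set f := findWalk (flowStates nodes (I.map fun a => (a, ζ a)))
    (flowStep (I.map fun a => (a, ζ a))) (flowInit nodes (I.map fun a => (a, ζ a))) fun s =>
    decide (s.2.1.dst = s.1) && decide (nodes.length + 1 ≤ s.2.2) with hf
  have hp : posCycle nodes (I.map fun a => (a, ζ a)) = f.map fun s => s.2.1 := rfl
  rw [hp]
  -- every closed walk of positive gain gives a walk of the search that is not longer
  have key : ∀ i w, ResWalk I ζ i w i → 0 < gain w → ∃ u l v,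
      u ∈ flowStates nodes (I.map fun a => (a, ζ a)) ∧
      flowInit nodes (I.map fun a => (a, ζ a)) u = true ∧
      Steps (flowStates nodes (I.map fun a => (a, ζ a)))
      (flowStep (I.map fun a => (a, ζ a))) u l v ∧ l.length + 1 ≤ w.length ∧
      (decide (v.2.1.dst = v.1) && decide (nodes.length + 1 ≤ v.2.2)) = true := by
    intro i w h hg
    obtain ⟨k, c, h1, h2, h3, h4⟩ := exists_short_cycle h hg
    rcases c with _ | ⟨r, c⟩
    · simp at h2
    obtain ⟨u, l, v, e1, e2, e3, e4, e5, e6, e7⟩ := exists_steps hI h1 (h1.nodup_length hI h3)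
    refine ⟨u, l, v, e1, e2, e3, by simpa [e4] using h4, ?_⟩
    rw [e5, e6]
    simp
    omega
  rcases hc : f with _ | ⟨u, l⟩
  · left
    refine ⟨rfl, fun i w h => ?_⟩
    by_contra hg
    obtain ⟨u, l, v, e1, e2, e3, -, e5⟩ := key i w h (by omega)
    exact findWalk_ne_nil e1 e2 e5 e3 hc
  · right
    obtain ⟨h1, h2, ⟨v, h4, h3⟩, h5⟩ := findWalk_eq_cons hc
    obtain ⟨e1, e2⟩ := resWalk_of_init h1 h2 h3
    simp only [Bool.and_eq_true, decide_eq_true_eq] at h4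
    rw [h4.1] at e1
    refine ⟨v.1, e1, by omega, ?_⟩
    by_contra hn
    obtain ⟨k, c, d, f1, f2, f3, f4, f5⟩ := e1.exists_split hn
    simp only [List.length_map, List.length_cons] at f4 f5
    rcases lt_or_ge 0 (gain c) with hg | hg
    · obtain ⟨u', l', v', g1, g2, g3, g4, g5⟩ := key _ _ f1 hg
      have := h5 _ _ _ g1 g2 g5 g3
      omega
    · obtain ⟨u', l', v', g1, g2, g3, g4, g5⟩ := key _ _ f2 (by omega)
      have := h5 _ _ _ g1 g2 g5 g3
      omega

theorem resWalk_congr {ζ' : Item → ℕ} (hz : ∀ a ∈ I, ζ a = ζ' a) {i j : Node} {w : List Arc}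
    (h : ResWalk I ζ' i w j) : ResWalk I ζ i w j := by
  induction w generalizing i with
  | nil => exact h
  | cons r w ih => exact ⟨h.1, h.2.1, by rw [hz _ h.2.1]; exact h.2.2.1, ih h.2.2.2⟩

/-! ### Balanced counters and the phases of the algorithm -/

/-- The counters `ζ` and the weights `ω` have the same net flow through each node. -/
def SameFlow (I : List Item) (ζ ω : Item → ℕ) : Prop :=
  ∀ p : Node → ℤ, ∑ a ∈ I.toFinset, (ζ a : ℤ) * (p a.1.2 - p a.1.1) =
    ∑ a ∈ I.toFinset, (ω a : ℤ) * (p a.1.2 - p a.1.1)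

/-- The value of the counters `ζ`, the objective of the flow problem. -/
def profit (I : List Item) (ζ : Item → ℕ) : ℤ := ∑ a ∈ I.toFinset, (ζ a : ℤ) * a.req

theorem bump_sub {w : List Arc} (hw : w.Nodup) (hmem : ∀ r ∈ w, r.1 ∈ I ∧ (r.2 = true ∨ 0 < ζ r.1))
    (f : Item → ℤ) : ∑ a ∈ I.toFinset, ((bump w (a, ζ a) : ℕ) : ℤ) * f a =
      ∑ a ∈ I.toFinset, (ζ a : ℤ) * f a + (w.map fun r => r.sign * f r.1).sum := by
  have h1 : ∀ a ∈ I.toFinset, ((bump w (a, ζ a) : ℕ) : ℤ) * f a = (ζ a : ℤ) * f a +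
      ∑ b : Bool, if (a, b) ∈ w then Arc.sign (a, b) * f a else 0 := by
    intro a _
    have hz : (a, false) ∈ w → 0 < ζ a := fun h => by simpa using (hmem _ h).2
    have ht : ∀ b, (w.any fun r => decide (r = (a, b))) = decide ((a, b) ∈ w) := by
      intro b
      rw [Bool.eq_iff_iff]
      simp
    rw [Fintype.sum_bool]
    unfold bump Arc.sign
    simp only [ht]
    by_cases h1 : (a, true) ∈ w <;> by_cases h2 : (a, false) ∈ w <;> simp [h1, h2]
    · ring
    · have := hz h2
      push_cast [Nat.cast_sub (show 1 ≤ ζ a from this)]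
      ring
  rw [Finset.sum_congr rfl h1, Finset.sum_add_distrib]
  congr 1
  rw [← List.sum_toFinset _ hw, ← Finset.sum_product' (f := fun a b =>
    if (a, b) ∈ w then Arc.sign (a, b) * f a else 0), ← Finset.sum_filter]
  refine Finset.sum_congr ?_ fun r _ => rfl
  ext r
  simp only [Finset.mem_filter, Finset.mem_product, List.mem_toFinset, Finset.mem_univ, and_true]
  exact ⟨fun h => h.2, fun h => ⟨(hmem r h).1, h⟩⟩

theorem ResWalk.telescope {i j : Node} {w : List Arc} (h : ResWalk I ζ i w j) (p : Node → ℤ) :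
    (w.map fun r => r.sign * (p r.1.1.2 - p r.1.1.1)).sum = p j - p i := by
  induction w generalizing i with
  | nil => cases h; simp
  | cons r w ih =>
    obtain ⟨rfl, -, -, h4⟩ := h
    rw [List.map_cons, List.sum_cons, ih h4]
    unfold Arc.sign Arc.src Arc.dst
    cases r.2 <;> simp

theorem any_weight (ω : Item → ℕ) {a : Item} (ha : a ∈ I) :
    ((I.map fun a => (a, ω a)).any fun f => decide (f.1 = a) && f.2.bodd) = (ω a).bodd := by
  rw [Bool.eq_iff_iff]
  simp only [List.any_map, List.any_eq_true, Function.comp_apply, Bool.and_eq_true,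
    decide_eq_true_eq]
  exact ⟨by rintro ⟨b, -, rfl, h⟩; exact h, fun h => ⟨a, ha, rfl, h⟩⟩

theorem rescale_eq (ζ ω : Item → ℕ) :
    rescale (I.map fun a => (a, ω a)) (I.map fun a => (a, ζ a)) =
      I.map fun a => (a, Nat.bit (ω a).bodd (ζ a)) := by
  rw [rescale, List.map_map]
  refine List.map_congr_left fun a ha => ?_
  simp only [Function.comp_apply, any_weight ω ha]

theorem augment_eq (ζ : Item → ℕ) :
    augment nodes (I.map fun a => (a, ζ a)) =
      I.map fun a => (a, bump (posCycle nodes (I.map fun a => (a, ζ a))) (a, ζ a)) := by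
  rw [augment, List.map_map]; rfl

theorem bump_nil (e : Item × ℕ) : bump [] e = e.2 := by simp [bump]

/-- An augmentation keeps optimal counters, and increases the profit of all others. -/
theorem augment_spec (hI : ∀ a ∈ I, a.1.1 ∈ nodes ∧ a.1.2 ∈ nodes) (ζ ω : Item → ℕ)
    (hb : SameFlow I ζ ω) : ∃ ζ' : Item → ℕ,
      augment nodes (I.map fun a => (a, ζ a)) = I.map (fun a => (a, ζ' a)) ∧ SameFlow I ζ' ω ∧
      (Optimal I ζ ∧ ζ' = ζ ∨ profit I ζ + 1 ≤ profit I ζ') := by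
  refine ⟨_, augment_eq ζ, ?_⟩
  rcases posCycle_spec (ζ := ζ) hI with ⟨h1, h2⟩ | ⟨i, h1, h2, h3⟩
  · have : (fun a => bump (posCycle nodes (I.map fun a => (a, ζ a))) (a, ζ a)) = ζ := by
      funext a; rw [h1, bump_nil]
    rw [this]
    exact ⟨hb, Or.inl ⟨h2, rfl⟩⟩
  · have hd : (posCycle nodes (I.map fun a => (a, ζ a))).Nodup := List.Nodup.of_map _ h3
    refine ⟨fun p => ?_, Or.inr ?_⟩
    · rw [bump_sub hd h1.mem fun a => p a.1.2 - p a.1.1, h1.telescope p, sub_self, add_zero, hb p]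
    · unfold profit
      rw [bump_sub hd h1.mem]
      have : gain (posCycle nodes (I.map fun a => (a, ζ a))) =
        ((posCycle nodes (I.map fun a => (a, ζ a))).map fun r => r.sign * r.1.req).sum := rfl
      omega

/-- Weak duality. -/
theorem profit_le {ζ ω : Item → ℕ} (hb : SameFlow I ζ ω) {p : Node → ℤ}
    (hp : ∀ a ∈ I, a.req ≤ p a.1.2 - p a.1.1) :
    profit I ζ ≤ ∑ a ∈ I.toFinset, (ω a : ℤ) * (p a.1.2 - p a.1.1) := by
  rw [← hb p]
  exact Finset.sum_le_sum fun a ha =>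
    mul_le_mul_of_nonneg_left (hp a (List.mem_toFinset.1 ha)) (Int.natCast_nonneg _)

theorem augments_spec (hI : ∀ a ∈ I, a.1.1 ∈ nodes ∧ a.1.2 ∈ nodes) (ω : Item → ℕ) (k : ℕ) :
    ∀ ζ : Item → ℕ, SameFlow I ζ ω → ∃ ζ' : Item → ℕ,
      (List.replicate k (false, ([] : List (Item × ℕ)))).foldl
        (fun Z op => bif op.1 then rescale op.2 Z else augment nodes Z)
        (I.map fun a => (a, ζ a)) = I.map (fun a => (a, ζ' a)) ∧ SameFlow I ζ' ω ∧
      (Optimal I ζ' ∨ profit I ζ + k ≤ profit I ζ') := by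
  induction k with
  | zero => intro ζ hb; exact ⟨ζ, rfl, hb, Or.inr (by simp)⟩
  | succ k ih =>
    intro ζ hb
    obtain ⟨ζ₁, h1, h2, h3⟩ := augment_spec hI ζ ω hb
    obtain ⟨ζ₂, h4, h5, h6⟩ := ih ζ₁ h2
    refine ⟨ζ₂, ?_, h5, ?_⟩
    · rw [List.replicate_succ, List.foldl_cons]
      simpa only [cond_false, h1] using h4
    · rcases h3 with ⟨h3, rfl⟩ | h3
      · have hst : ∀ k, (List.replicate k (false, ([] : List (Item × ℕ)))).foldl
            (fun Z op => bif op.1 then rescale op.2 Z else augment nodes Z)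
            (I.map fun a => (a, ζ₁ a)) = I.map fun a => (a, ζ₁ a) := by
          intro k
          induction k with
          | zero => rfl
          | succ k ihk =>
            rw [List.replicate_succ, List.foldl_cons]
            rw [show (bif false then rescale [] (I.map fun a => (a, ζ₁ a)) else
              augment nodes (I.map fun a => (a, ζ₁ a))) = I.map fun a => (a, ζ₁ a) from h1]
            exact ihk
        left
        rw [hst k] at h4
        intro i w hw
        refine h3 i w ?_
        have hz : ∀ a ∈ I, ζ₁ a = ζ₂ a := fun a ha => by
          have := List.map_inj_left.1 h4 a ha
          simpa using this
        exact resWalk_congr hz hw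
      · rcases h6 with h6 | h6
        · exact Or.inl h6
        · right; push_cast; omega

/-- If the counters are optimal for the halved weights, then one phase makes them optimal for the
weights. -/
theorem phase_spec (hn : I.Nodup) (hI : ∀ a ∈ I, a.1.1 ∈ nodes ∧ a.1.2 ∈ nodes) {ζ ω : Item → ℕ}
    (hb : SameFlow I ζ fun a => (ω a).div2) (ho : Optimal I ζ) : ∃ ζ' : Item → ℕ,
      ((true, I.map fun a => (a, ω a)) ::
        List.replicate (I.length * nodes.length) (false, ([] : List (Item × ℕ)))).foldl
        (fun Z op => bif op.1 then rescale op.2 Z else augment nodes Z)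
        (I.map fun a => (a, ζ a)) = I.map (fun a => (a, ζ' a)) ∧ SameFlow I ζ' ω ∧
      Optimal I ζ' := by
  obtain ⟨π, -, -, h1, h2, h3⟩ := ho.exists_potential hI
  have hbit : ∀ (b : Bool) (m : ℕ), ((Nat.bit b m : ℕ) : ℤ) = 2 * m + (if b then 1 else 0) := by
    intro b m; cases b <;> simp [Nat.bit_val]
  have hω : ∀ a, (ω a : ℤ) = 2 * (ω a).div2 + (if (ω a).bodd then 1 else 0) := by
    intro a
    rw [← hbit, Nat.bit_bodd_div2]
  have hb' : SameFlow I (fun a => Nat.bit (ω a).bodd (ζ a)) ω := by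
    intro p
    simp only [hbit]
    simp_rw [hω]
    simp only [add_mul, mul_assoc, Finset.sum_add_distrib, ← Finset.mul_sum]
    rw [hb p]
  obtain ⟨ζ', h4, h5, h6⟩ := augments_spec hI ω (I.length * nodes.length) _ hb'
  refine ⟨ζ', ?_, h5, ?_⟩
  · rw [List.foldl_cons]
    simp only [cond_true, rescale_eq]
    exact h4
  · rcases h6 with h6 | h6
    · exact h6
    -- the profit cannot grow beyond the bound given by the previous potential
    have h7 : ∑ a ∈ I.toFinset, (ω a : ℤ) * (π a.1.2 - π a.1.1) ≤
        profit I (fun a => Nat.bit (ω a).bodd (ζ a)) + (I.length * nodes.length : ℕ) := by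
      rw [← hb' π, ← sub_le_iff_le_add']
      unfold profit
      rw [← Finset.sum_sub_distrib]
      have : ∀ a ∈ I.toFinset, ((Nat.bit (ω a).bodd (ζ a) : ℕ) : ℤ) * (π a.1.2 - π a.1.1) -
          ((Nat.bit (ω a).bodd (ζ a) : ℕ) : ℤ) * a.req ≤ nodes.length := by
        intro a ha
        have ha := List.mem_toFinset.1 ha
        have e1 := h1 a.1.2
        have e2 := h1 a.1.1
        have e3 := h2 a ha
        have e5 : 0 ≤ a.req := by unfold Item.req; split_ifs <;> simp
        rw [hbit, ← mul_sub]
        have e4 : (ζ a : ℤ) * (π a.1.2 - π a.1.1 - a.req) = 0 := by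
          rcases Nat.eq_zero_or_pos (ζ a) with h | h
          · rw [h]; simp
          · rw [h3 a ha h]; simp
        rw [add_mul, mul_assoc, e4]
        split_ifs
        · omega
        · omega
      refine (Finset.sum_le_card_nsmul _ _ _ this).trans ?_
      rw [List.toFinset_card_of_nodup hn]
      simp
    obtain ⟨ζ'', -, h8, h9⟩ := augment_spec hI ζ' ω h5
    rcases h9 with ⟨h9, -⟩ | h9
    · exact h9
    · have := profit_le h8 h2
      omega

theorem div2_iterate (k m : ℕ) : Nat.div2^[k] m = m / 2 ^ k := by
  induction k generalizing m with
  | zero => simp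
  | succ k ih => rw [Function.iterate_succ_apply, ih, Nat.div2_val, Nat.div_div_eq_div_mul, pow_succ']

/-- The algorithm finds optimal counters. -/
theorem flow_spec (hn : I.Nodup) (hI : ∀ a ∈ I, a.1.1 ∈ nodes ∧ a.1.2 ∈ nodes) (ω : Item → ℕ)
    {p : Node → ℤ} (hp : ∀ a ∈ I, a.req ≤ p a.1.2 - p a.1.1) : ∃ ζ : Item → ℕ,
      flow nodes (I.map fun a => (a, ω a)) = I.map (fun a => (a, ζ a)) ∧ SameFlow I ζ ω ∧
      Optimal I ζ := by
  set step := fun (Z : List (Item × ℕ)) (op : Bool × List (Item × ℕ)) =>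
    bif op.1 then rescale op.2 Z else augment nodes Z with hstep
  set ops := fun V : List (Item × ℕ) =>
    (true, V) :: ((I.map fun a => (a, ω a)).product nodes).map fun _ => (false, ([] : List (Item × ℕ)))
    with hops
  have hrep : ∀ V, ops V = (true, V) ::
      List.replicate (I.length * nodes.length) (false, ([] : List (Item × ℕ))) := by
    intro V
    simp only [hops, List.map_const']
    rw [show ((I.map fun a => (a, ω a)).product nodes).length = I.length * nodes.length from
      (List.length_product _ _).trans (by rw [List.length_map])]
  have key : ∀ T : List Bool, ∃ L, T.foldl
      (fun L _ => ((L.headD []).map fun e : Item × ℕ => (e.1, e.2.div2)) :: L)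
        [I.map fun a => (a, ω a)] = L ∧
      L.headD [] = I.map (fun a => (a, Nat.div2^[T.length] (ω a))) ∧
      ∀ ζ : Item → ℕ, SameFlow I ζ (fun a => (Nat.div2^[T.length] (ω a)).div2) → Optimal I ζ →
        ∃ ζ' : Item → ℕ, (L.flatMap ops).foldl step (I.map fun a => (a, ζ a)) =
          I.map (fun a => (a, ζ' a)) ∧ SameFlow I ζ' ω ∧ Optimal I ζ' := by
    intro T
    induction T using List.reverseRecOn with
    | nil =>
      refine ⟨_, rfl, rfl, fun ζ hb ho => ?_⟩
      obtain ⟨ζ', h1, h2, h3⟩ := phase_spec hn hI hb ho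
      refine ⟨ζ', ?_, h2, h3⟩
      rw [← h1, List.foldl_nil, List.flatMap_cons, List.flatMap_nil, List.append_nil, hrep]
      rfl
    | append_singleton T b ih =>
      obtain ⟨L, h1, h2, h3⟩ := ih
      refine ⟨_, rfl, ?_, fun ζ hb ho => ?_⟩
      · rw [List.foldl_append, h1, List.foldl_cons, List.foldl_nil, List.headD_cons, h2,
          List.map_map, List.length_append, List.length_singleton]
        refine List.map_congr_left fun a _ => ?_
        rw [Function.iterate_succ_apply']; rfl
      · rw [List.foldl_append, h1, List.foldl_cons, List.foldl_nil, List.flatMap_cons,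
          List.foldl_append, h2, List.map_map]
        rw [List.length_append, List.length_singleton] at hb
        have hb' : SameFlow I ζ fun a => (Nat.div2 (Nat.div2^[T.length] (ω a))).div2 := by
          simpa only [Function.iterate_succ_apply'] using hb
        obtain ⟨ζ', h4, h5, h6⟩ := phase_spec hn hI hb' ho
        obtain ⟨ζ'', h7, h8⟩ := h3 ζ' h5 h6
        refine ⟨ζ'', ?_, h8⟩
        rw [← h7, hrep]
        congr 1
  obtain ⟨L, h1, -, h3⟩ := key ((I.map fun a => (a, ω a)).flatMap fun e => e.2.bits)
  obtain ⟨ζ, h4, h5⟩ := h3 (fun _ => 0) (fun q => by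
    refine Finset.sum_congr rfl fun a ha => ?_
    simp only [div2_iterate]
    have : ω a < 2 ^ ((I.map fun a => (a, ω a)).flatMap fun e => e.2.bits).length := by
      have h6 : ω a < 2 ^ (ω a).bits.length := by
        rw [Nat.size_eq_bits_len]; exact Nat.lt_size_self _
      refine h6.trans_le (Nat.pow_le_pow_right (by norm_num) ?_)
      rw [List.length_flatMap]
      refine List.single_le_sum (by simp) _ ?_
      rw [List.mem_map]
      exact ⟨(a, ω a), List.mem_map_of_mem (List.mem_toFinset.1 ha), rfl⟩
    rw [Nat.div_eq_of_lt this]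
    simp) (fun i w hw => by
      have hf : ∀ i j w, ResWalk I (fun _ => 0) i w j → gain w ≤ p j - p i := by
        intro i j w
        induction w generalizing i with
        | nil => intro h; cases h; simp
        | cons r w ih =>
          rintro ⟨rfl, e2, e3, e4⟩
          have e5 := ih _ e4
          have e6 := hp _ e2
          have e7 : r.2 = true := by simpa using e3
          rw [gain_cons]
          simp only [Arc.sign, Arc.src, Arc.dst, e7, if_true, cond_true, one_mul] at e5 ⊢
          omega
      have := hf i i w hw
      omega)
  refine ⟨ζ, ?_, h5⟩
  rw [← h4, ← h1, flow, runOps, flowOps, scales, List.map_map]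
  rfl

theorem mem_gains {j : Node} {v : ℕ} : (j, v) ∈ gains nodes (I.map fun a => (a, ζ a)) →
    ∃ i w, ResWalk I ζ i w j ∧ (v : ℤ) = nodes.length + gain w := by
  intro h
  rcases List.mem_append.1 h with h | h
  · obtain ⟨s, hs, he⟩ := List.mem_map.1 h
    obtain ⟨rfl, rfl⟩ := Prod.mk.inj he
    obtain ⟨u, l, h1, h2, h3⟩ := mem_reachable.1 hs
    obtain ⟨h4, h5⟩ := resWalk_of_init h1 h2 h3
    exact ⟨_, _, h4, h5⟩
  · obtain ⟨i, hi, he⟩ := List.mem_map.1 h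
    obtain ⟨rfl, rfl⟩ := Prod.mk.inj he
    exact ⟨i, [], rfl, by simp⟩

/-- The algorithm finds the order of the values of an optimal solution of the linear program dual
to the flow problem: to minimize the weighted growth under the requirements `I`. -/
theorem exists_optimal_potential (hn : I.Nodup) (hI : ∀ a ∈ I, a.1.1 ∈ nodes ∧ a.1.2 ∈ nodes)
    (ω : Item → ℕ) {p : Node → ℤ} (hp : ∀ a ∈ I, a.req ≤ p a.1.2 - p a.1.1) : ∃ π : Node → ℤ,
      (∀ a ∈ I, a.req ≤ π a.1.2 - π a.1.1) ∧
      ∑ a ∈ I.toFinset, (ω a : ℤ) * (π a.1.2 - π a.1.1) ≤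
        ∑ a ∈ I.toFinset, (ω a : ℤ) * (p a.1.2 - p a.1.1) ∧
      ∀ i ∈ nodes, ∀ j ∈ nodes,
        potLT (gains nodes (flow nodes (I.map fun a => (a, ω a)))) i j = true ↔ π i < π j := by
  obtain ⟨ζ, h1, h2, h3⟩ := flow_spec hn hI ω hp
  obtain ⟨π, e1, e2, e3, e4, e5⟩ := h3.exists_potential hI
  refine ⟨π, e4, ?_, fun i hi j hj => ?_⟩
  · refine le_trans (le_of_eq ?_) (profit_le h2 hp)
    rw [← h2 π]
    refine Finset.sum_congr rfl fun a ha => ?_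
    rcases Nat.eq_zero_or_pos (ζ a) with h | h
    · rw [h]; simp
    · rw [e5 a (List.mem_toFinset.1 ha) h]
  · rw [h1]
    have hle : ∀ {j v}, (j, v) ∈ gains nodes (I.map fun a => (a, ζ a)) →
        (v : ℤ) ≤ nodes.length + π j := by
      intro j v h
      obtain ⟨i, w, h6, h7⟩ := mem_gains h
      have := e1 _ _ _ h6
      omega
    have hex : ∀ j ∈ nodes, ∃ v : ℕ, (j, v) ∈ gains nodes (I.map fun a => (a, ζ a)) ∧
        (v : ℤ) = nodes.length + π j := by
      intro j hj
      obtain ⟨i, w, h6, h7, h8⟩ := e2 j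
      rcases w with _ | ⟨r, w⟩
      · exact ⟨nodes.length, List.mem_append_right _ (List.mem_map_of_mem hj), by simp [← h7]⟩
      · obtain ⟨u, l, v, f1, f2, f3, -, f5, f6, f7⟩ := exists_steps hI h6 h8
        refine ⟨v.2.2, List.mem_append_left _ (List.mem_map.2
          ⟨v, mem_reachable.2 ⟨u, l, f1, f2, f3⟩, by rw [f6]⟩), by rw [f7, h7]⟩
    obtain ⟨vi, hvi, hi'⟩ := hex i hi
    obtain ⟨vj, hvj, hj'⟩ := hex j hj
    simp only [potLT, List.any_eq_true, List.all_eq_true, Bool.and_eq_true, decide_eq_true_eq,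
      Bool.or_eq_true, Bool.not_eq_true', decide_eq_false_iff_not]
    constructor
    · rintro ⟨⟨k, v⟩, hx, rfl, hall⟩
      have f1 := hle hx
      have f2 := (hall _ hvi).resolve_left (by simp)
      change vi + 1 ≤ v at f2
      change π i < π k
      omega
    · intro hlt
      refine ⟨_, hvj, rfl, fun ⟨k, v⟩ hy => ?_⟩
      by_cases hk : k = i
      · subst hk
        have := hle hy
        have hlt' : π k < π j := hlt
        simp only at hi' this ⊢
        omega
      · exact Or.inl hk

end residual

/-! ### The algorithm -/

/-- An instance as the program reads it: the number of vertices, the edges, the terminal pairs, the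
weights and the bound. -/
abbrev Inst := ℕ × (List (ℕ × ℕ) × (List (ℕ × ℕ) × (List ℕ × (ℕ × Unit))))

/-- What the algorithm guesses about a solution: the chosen keys, the keys that name segments with a
chosen vertex, the keys of the segments that are oriented towards the root, and choices between
bounds. -/
abbrev Cert := (List ℕ × List ℕ) × (List ℕ × List ℕ)

section defs

/-- Membership in a list, as a Boolean. -/
def has {α : Type} [DecidableEq α] (l : List α) (a : α) : Bool := l.any fun b => decide (b = a)

variable (V : List ℕ) (E : List (ℕ × ℕ))

/-- Adjacency in the simple graph with the edges `E`. -/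
def adj (u v : ℕ) : Bool := (has E (u, v) || has E (v, u)) && !decide (u = v)

/-- The vertices `s` and `t` are connected after the deletion of `X`. -/
def conn (X : List ℕ) (s t : ℕ) : Bool :=
  has (reachable (V.filter fun v => !has X v) (adj E) fun v => decide (v = s)) t

/-- The keys: the vertices whose degree is not two. -/
def keys : List ℕ := V.filter fun v => !decide ((V.filter (adj E v)).length = 2)

/-- The pairs `(u, z)` such that `z` lies on the path from `u` to the root `r`. -/
def ancestors (r : ℕ) : List (ℕ × ℕ) :=
  (V.product V).filter fun e => decide (e.1 = e.2) || !conn V E [e.2] e.1 r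

/-- The pairs `(κ, z)` such that `z` is not a key, and `κ` is the highest key below `z`. The vertices
`z` with the same `κ` form a segment. -/
def segments (K : List ℕ) (L : List (ℕ × ℕ)) : List (ℕ × ℕ) :=
  (K.product V).filter fun e => !has K e.2 && has L e &&
    K.all fun k => decide (k = e.1) || !(has L (e.1, k) && has L (k, e.2))

variable (L G : List (ℕ × ℕ)) (P : List (ℕ × ℕ)) (K O Q : List ℕ)

/-- The vertices in the segments named by `K`. -/
def cutVertices : List ℕ := V.filter fun z => G.any fun e => decide (e.2 = z) && has K e.1

/-- The vertex `z`, not a key, lies on the path between the vertices of the pair `p`. -/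
def onPath (p : ℕ × ℕ) (z : ℕ) : Bool :=
  decide (z = p.1) || decide (z = p.2) || (has L (p.1, z)).xor (has L (p.2, z))

/-- The position of `z` in its segment, counted from the upper (`true`) or lower end. -/
def position (d : Bool) (z : ℕ) : ℕ := (V.filter fun w => has L (z, w) == d).length

/-- The vertex `z` is among those of its segment that the bound `b` is about. -/
def inBound (b : Bound) (z : ℕ) : Bool :=
  has G (b.1.1, z) && decide (position V L b.1.2 z ≤ b.2)

/-- The ends of the segments named by `K`. -/
def halves : List Half := K.product [true, false]

/-- The pairs of bounds such that, because of a terminal pair, each solution satisfies at least one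
of them. -/
def alternatives : List (Bound × Bound) :=
  (((halves K).product (List.range (0 :: V).length)).product
    ((halves K).product (List.range (0 :: V).length))).filter fun c =>
      P.any fun p => Q.all fun z => onPath L p z == (inBound V L G c.1 z || inBound V L G c.2 z)

/-- The bounds that result from the choices `w`. -/
def chosenBounds (w : List ℕ) : List Bound :=
  branches (halves K) (alternatives V L G P K Q) (List.range (0 :: V).length).reverse
    (List.range (walkStates (halves K) ++ walkStates (halves K)).length)
    ((w.zip ((halves K).product (halves K))).map Prod.fst)

/-- The sets that a solution has to meet. -/
def demands (B : List Bound) : List (List ℕ) :=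
  (P.map fun p => Q.filter fun z => onPath L p z) ++ B.map fun b => Q.filter fun z => inBound V L G b z

/-- The node `i` lies after the vertex `z`, where `z` has the orientation of its segment. -/
def side (z : ℕ) (i : Node) : Bool :=
  bif decide (i.1 = z) then i.2
  else (has L (i.1, z)).xor (G.any fun e => decide (e.2 = z) && has O e.1)

/-- The nodes of the flow problem. -/
def flowNodes : List Node := V.product [false, true]

/-- The requirements on the potential: it does not decrease from `i` to `j` if no vertex of `Q` is
crossed backwards on the way, and it grows if moreover all members of a demand are crossed. -/
def flowItems (D : List (List ℕ)) : List Item :=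
  (((flowNodes V).product (flowNodes V)).product [false, true]).filter fun a =>
    (Q.all fun z => !side L G O z a.1.1 || side L G O z a.1.2) &&
      (!a.2 || D.any fun T => T.all fun z => !side L G O z a.1.1 && side L G O z a.1.2)

variable (ω : List (ℕ × ℕ))

/-- The weight of a vertex, looked up in the table `ω`. -/
def weight (v : ℕ) : ℕ := ((ω.filter fun e => decide (e.1 = v)).map Prod.snd).sum

/-- The weight of a requirement: that of the vertex `z` if the requirement is that the potential
does not decrease from before `z` to after `z`. -/
def itemWeight (a : Item) : ℕ :=
  bif !a.2 && has Q a.1.1.1 && decide (a.1 = ((a.1.1.1, false), (a.1.1.1, true)))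
  then weight ω a.1.1.1 else 0

/-- The largest gains, for the requirements given by the demands `D`. -/
def gainTable (D : List (List ℕ)) : List (Node × ℕ) :=
  gains (flowNodes V) (flow (flowNodes V)
    ((flowItems V L G O Q D).map fun a => (a, itemWeight Q ω a)))

/-- The vertices in `X`, and those at which the potential grows. -/
def selection (X : List ℕ) (R : List (Node × ℕ)) : List ℕ :=
  V.filter fun z => has X z || (has Q z && potLT R (z, false) (z, true))

/-- The terminal pairs that are not separated by `X`. -/
def unhit (X : List ℕ) : List (ℕ × ℕ) := P.filter fun p => conn V E X p.1 p.2

/-- The vertex set that results from a guess. -/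
def candidate (c : Cert) : List ℕ :=
  selection V (cutVertices V G c.1.2) c.1.1 (gainTable V L G c.2.1 (cutVertices V G c.1.2) ω
    (demands V L G (unhit V E P c.1.1) (cutVertices V G c.1.2)
      (chosenBounds V L G (unhit V E P c.1.1) c.1.2 (cutVertices V G c.1.2) c.2.2)))

/-- The set `S` separates all terminal pairs, and its weight is at most `b`. -/
def isSolution (b : ℕ) (S : List ℕ) : Bool :=
  (P.all fun p => !conn V E S p.1 p.2) && decide ((S.map (weight ω)).sum ≤ b)

end defs

/-- The vertices of an instance. -/
def Inst.verts (d : Inst) : List ℕ := List.range d.2.2.2.1.length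

/-- The keys of an instance. -/
def Inst.keys (d : Inst) : List ℕ := _root_.keys d.verts d.2.1

/-- The table of ancestors, for the first key as the root. -/
def Inst.anc (d : Inst) : List (ℕ × ℕ) := ancestors d.verts d.2.1 (d.keys.headD 0)

/-- The table of segments. -/
def Inst.segs (d : Inst) : List (ℕ × ℕ) := segments d.verts d.keys d.anc

/-- The table of weights. -/
def Inst.wts (d : Inst) : List (ℕ × ℕ) := d.verts.zip d.2.2.2.1

/-- A guess leads to a solution. -/
def Inst.check (d : Inst) (c : Cert) : Bool :=
  isSolution d.verts d.2.1 d.2.2.1 d.wts d.2.2.2.2.1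
    (candidate d.verts d.2.1 d.anc d.segs d.2.2.1 d.wts c)

section time
variable {δ : Type} [Enc δ]

@[fun_prop] theorem PT.has {α : Type} [Enc α] [DecidableEq α] {l : δ → List α} {a : δ → α}
    (hl : PT l) (ha : PT a) : PT (fun d => has (l d) (a d)) := by
  unfold _root_.has; fun_prop

variable {V : δ → List ℕ} {E L G P ω : δ → List (ℕ × ℕ)} {K O Q X w : δ → List ℕ}

@[fun_prop] theorem PT.adj {u v : δ → ℕ} (hE : PT E) (hu : PT u) (hv : PT v) :
    PT (fun d => adj (E d) (u d) (v d)) := by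
  unfold _root_.adj; fun_prop

@[fun_prop] theorem PT.conn {u v : δ → ℕ} (hV : PT V) (hE : PT E) (hX : PT X) (hu : PT u)
    (hv : PT v) : PT (fun d => conn (V d) (E d) (X d) (u d) (v d)) := by
  unfold _root_.conn
  exact PT.has (PT.reachable (by fun_prop) (by fun_prop) (by fun_prop)) hv

@[fun_prop] theorem PT.keys (hV : PT V) (hE : PT E) : PT (fun d => keys (V d) (E d)) := by
  unfold _root_.keys; fun_prop

@[fun_prop] theorem PT.ancestors {r : δ → ℕ} (hV : PT V) (hE : PT E) (hr : PT r) :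
    PT (fun d => ancestors (V d) (E d) (r d)) := by
  unfold _root_.ancestors; fun_prop

@[fun_prop] theorem PT.segments (hV : PT V) (hK : PT K) (hL : PT L) :
    PT (fun d => segments (V d) (K d) (L d)) := by
  unfold _root_.segments; fun_prop

@[fun_prop] theorem PT.cutVertices (hV : PT V) (hG : PT G) (hK : PT K) :
    PT (fun d => cutVertices (V d) (G d) (K d)) := by
  unfold _root_.cutVertices; fun_prop

@[fun_prop] theorem PT.onPath {p : δ → ℕ × ℕ} {z : δ → ℕ} (hL : PT L) (hp : PT p) (hz : PT z) :
    PT (fun d => onPath (L d) (p d) (z d)) := by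
  unfold _root_.onPath; fun_prop

@[fun_prop] theorem PT.position {b : δ → Bool} {z : δ → ℕ} (hV : PT V) (hL : PT L) (hb : PT b)
    (hz : PT z) : PT (fun d => position (V d) (L d) (b d) (z d)) := by
  unfold _root_.position; fun_prop

@[fun_prop] theorem PT.inBound {b : δ → Bound} {z : δ → ℕ} (hV : PT V) (hL : PT L) (hG : PT G)
    (hb : PT b) (hz : PT z) : PT (fun d => inBound (V d) (L d) (G d) (b d) (z d)) := by
  unfold _root_.inBound; fun_prop

@[fun_prop] theorem PT.halves (hK : PT K) : PT (fun d => halves (K d)) := by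
  unfold _root_.halves; fun_prop

@[fun_prop] theorem PT.alternatives (hV : PT V) (hL : PT L) (hG : PT G) (hP : PT P) (hK : PT K)
    (hQ : PT Q) : PT (fun d => alternatives (V d) (L d) (G d) (P d) (K d) (Q d)) := by
  unfold _root_.alternatives; fun_prop

@[fun_prop] theorem PT.walkStates {H : δ → List Half} (hH : PT H) :
    PT (fun d => walkStates (H d)) := by
  unfold _root_.walkStates; fun_prop

@[fun_prop] theorem PT.chosenBounds (hV : PT V) (hL : PT L) (hG : PT G) (hP : PT P) (hK : PT K)
    (hQ : PT Q) (hw : PT w) :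
    PT (fun d => chosenBounds (V d) (L d) (G d) (P d) (K d) (Q d) (w d)) := by
  unfold _root_.chosenBounds; fun_prop

@[fun_prop] theorem PT.demands {B : δ → List Bound} (hV : PT V) (hL : PT L) (hG : PT G) (hP : PT P)
    (hQ : PT Q) (hB : PT B) :
    PT (fun d => demands (V d) (L d) (G d) (P d) (Q d) (B d)) := by
  unfold _root_.demands; fun_prop

@[fun_prop] theorem PT.side {z : δ → ℕ} {i : δ → Node} (hL : PT L) (hG : PT G) (hO : PT O)
    (hz : PT z) (hi : PT i) : PT (fun d => side (L d) (G d) (O d) (z d) (i d)) := by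
  unfold _root_.side; fun_prop

@[fun_prop] theorem PT.flowNodes (hV : PT V) : PT (fun d => flowNodes (V d)) := by
  unfold _root_.flowNodes; fun_prop

@[fun_prop] theorem PT.flowItems {D : δ → List (List ℕ)} (hV : PT V) (hL : PT L) (hG : PT G)
    (hO : PT O) (hQ : PT Q) (hD : PT D) :
    PT (fun d => flowItems (V d) (L d) (G d) (O d) (Q d) (D d)) := by
  unfold _root_.flowItems; fun_prop

@[fun_prop] theorem PT.weight {v : δ → ℕ} (hω : PT ω) (hv : PT v) :
    PT (fun d => weight (ω d) (v d)) := by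
  unfold _root_.weight; fun_prop

@[fun_prop] theorem PT.itemWeight {a : δ → Item} (hQ : PT Q) (hω : PT ω) (ha : PT a) :
    PT (fun d => itemWeight (Q d) (ω d) (a d)) := by
  unfold _root_.itemWeight; fun_prop

@[fun_prop] theorem PT.gainTable {D : δ → List (List ℕ)} (hV : PT V) (hL : PT L) (hG : PT G)
    (hO : PT O) (hQ : PT Q) (hω : PT ω) (hD : PT D) :
    PT (fun d => gainTable (V d) (L d) (G d) (O d) (Q d) (ω d) (D d)) := by
  unfold _root_.gainTable; fun_prop

@[fun_prop] theorem PT.selection {R : δ → List (Node × ℕ)} (hV : PT V) (hQ : PT Q) (hX : PT X)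
    (hR : PT R) : PT (fun d => selection (V d) (Q d) (X d) (R d)) := by
  unfold _root_.selection; fun_prop

@[fun_prop] theorem PT.unhit (hV : PT V) (hE : PT E) (hP : PT P) (hX : PT X) :
    PT (fun d => unhit (V d) (E d) (P d) (X d)) := by
  unfold _root_.unhit; fun_prop

@[fun_prop] theorem PT.candidate {c : δ → Cert} (hV : PT V) (hE : PT E) (hL : PT L) (hG : PT G)
    (hP : PT P) (hω : PT ω) (hc : PT c) :
    PT (fun d => candidate (V d) (E d) (L d) (G d) (P d) (ω d) (c d)) := by
  unfold _root_.candidate; fun_prop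

@[fun_prop] theorem PT.isSolution {b : δ → ℕ} {S : δ → List ℕ} (hV : PT V) (hE : PT E) (hP : PT P)
    (hω : PT ω) (hb : PT b) (hS : PT S) :
    PT (fun d => isSolution (V d) (E d) (P d) (ω d) (b d) (S d)) := by
  unfold _root_.isSolution; fun_prop

variable {I : δ → Inst}

@[fun_prop] theorem PT.instVerts (hI : PT I) : PT (fun d => (I d).verts) := by
  unfold Inst.verts; fun_prop

@[fun_prop] theorem PT.instKeys (hI : PT I) : PT (fun d => (I d).keys) := by
  unfold Inst.keys; fun_prop

@[fun_prop] theorem PT.instAnc (hI : PT I) : PT (fun d => (I d).anc) := by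
  unfold Inst.anc; fun_prop

@[fun_prop] theorem PT.instSegs (hI : PT I) : PT (fun d => (I d).segs) := by
  unfold Inst.segs; fun_prop

@[fun_prop] theorem PT.instWts (hI : PT I) : PT (fun d => (I d).wts) := by
  unfold Inst.wts; fun_prop

@[fun_prop] theorem PT.instCheck {c : δ → Cert} (hI : PT I) (hc : PT c) :
    PT (fun d => (I d).check (c d)) := by
  unfold Inst.check; fun_prop

end time

/-! ### Enumeration of the guesses -/

section enum

/-- The sublists of the reversal of a list. -/
def subs (K : List ℕ) : List (List ℕ) :=
  K.foldl (fun W k => W ++ W.map fun x => k :: x) [[]]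

/-- The words over the alphabet `A` with the length of `T`. -/
def wordsOver (A : List ℕ) (T : List (Half × Half)) : List (List ℕ) :=
  T.foldl (fun W _ => (A.product W).map fun x => x.1 :: x.2) [[]]

theorem length_subs (K : List ℕ) : (subs K).length = 2 ^ K.length := by
  induction K using List.reverseRecOn with
  | nil => rfl
  | append_singleton K k ih =>
    simp only [subs] at ih ⊢
    simp only [List.foldl_append, List.foldl_cons, List.foldl_nil, List.length_append,
      List.length_map, ih, List.length_singleton, pow_succ]
    omega

theorem mem_subs {K x : List ℕ} : x ∈ subs K ↔ x.Sublist K.reverse := by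
  induction K using List.reverseRecOn generalizing x with
  | nil => simp [subs]
  | append_singleton K k ih =>
    have : subs (K ++ [k]) = subs K ++ (subs K).map fun x => k :: x := by
      simp [subs]
    rw [this, List.mem_append, List.mem_map, List.reverse_append, List.reverse_singleton,
      List.singleton_append, List.sublist_cons_iff]
    simp only [ih, eq_comm]
    constructor
    · rintro (h | ⟨y, hy, rfl⟩)
      exacts [Or.inl h, Or.inr ⟨y, rfl, hy⟩]
    · rintro (h | ⟨y, rfl, hy⟩)
      exacts [Or.inl h, Or.inr ⟨y, hy, rfl⟩]

theorem length_wordsOver (A : List ℕ) (T : List (Half × Half)) :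
    (wordsOver A T).length = A.length ^ T.length := by
  induction T using List.reverseRecOn with
  | nil => rfl
  | append_singleton T k ih =>
    have : wordsOver A (T ++ [k]) = (A.product (wordsOver A T)).map fun x => x.1 :: x.2 := by
      simp [wordsOver]
    rw [this, List.length_map, List.length_append, List.length_singleton, pow_succ, ← ih, mul_comm]
    exact List.length_product _ _

theorem mem_wordsOver {A : List ℕ} {T : List (Half × Half)} {x : List ℕ} :
    x ∈ wordsOver A T ↔ x.length = T.length ∧ ∀ a ∈ x, a ∈ A := by
  induction T using List.reverseRecOn generalizing x with
  | nil =>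
    simp only [wordsOver, List.foldl_nil, List.mem_singleton, List.length_nil,
      List.length_eq_zero_iff]
    exact ⟨by rintro rfl; simp, fun h => h.1⟩
  | append_singleton T k ih =>
    have : wordsOver A (T ++ [k]) = (A.product (wordsOver A T)).map fun x => x.1 :: x.2 := by
      simp [wordsOver]
    rw [this, List.mem_map, List.length_append, List.length_singleton]
    constructor
    · rintro ⟨⟨a, y⟩, h, rfl⟩
      obtain ⟨h1, h2⟩ := List.pair_mem_product.1 h
      obtain ⟨h3, h4⟩ := ih.1 h2
      refine ⟨by simp [h3], fun b hb => ?_⟩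
      rcases List.mem_cons.1 hb with rfl | hb
      exacts [h1, h4 b hb]
    · rintro ⟨h1, h2⟩
      rcases x with _ | ⟨a, y⟩
      · simp at h1
      · exact ⟨(a, y), List.pair_mem_product.2 ⟨h2 a (by simp),
          ih.2 ⟨by simpa using h1, fun b hb => h2 b (by simp [hb])⟩⟩, rfl⟩

/-- The numbers of the options. -/
def Inst.alphabet (d : Inst) : List ℕ :=
  List.range (walkStates (halves d.keys) ++ walkStates (halves d.keys)).length

/-- All guesses. -/
def Inst.certs (d : Inst) : List Cert :=
  ((subs d.keys).product (subs d.keys)).product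
    ((subs d.keys).product (wordsOver d.alphabet ((halves d.keys).product (halves d.keys))))

/-- The algorithm. -/
def Inst.solve (d : Inst) : Bool := d.certs.any d.check

/-- A number that exceeds the numbers of subsets and of words. -/
def Inst.count (d : Inst) : ℕ :=
  2 ^ d.keys.length + d.alphabet.length ^ ((halves d.keys).product (halves d.keys)).length

/-- The measure in which the algorithm takes polynomial time. -/
def Inst.measure (d : Inst) : ℕ := esize d + d.count

theorem PT.toPTW {α β : Type} [Enc α] [Enc β] {f : α → β} {μ : α → ℕ} (hf : PT f)
    (hμ : PB μ esize) : PTW μ f :=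
  PTW.comp hf (PTW.of_expr (f := fun a : α => a) (.hd X0) hμ fun a r σ h => by
    simp [WExpr.eval, h, Data.hd])

variable {δ : Type} [Enc δ] {I : δ → Inst}

@[fun_prop] theorem PT.instAlphabet (hI : PT I) : PT (fun d => (I d).alphabet) := by
  unfold Inst.alphabet; fun_prop

theorem Inst.one_le_count (d : Inst) : 1 ≤ d.count :=
  Nat.one_le_two_pow.trans (Nat.le_add_right _ _)

theorem Inst.esize_le_measure : PB Inst.measure esize :=
  PB.self.mono fun _ => Nat.le_add_right _ _

theorem Inst.count_le_measure : PB Inst.measure Inst.count :=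
  PB.self.mono fun _ => Nat.le_add_left _ _

theorem PTW.subs : PTW Inst.measure fun d => subs d.keys := by
  have hk : PT Inst.keys := by fun_prop
  refine PTW.foldl Inst.esize_le_measure (hk.toPTW Inst.esize_le_measure) (PTW.const _)
    (by fun_prop) (M := fun d => d.count * (esize d.keys + 1) + 1)
    ((Inst.count_le_measure.mul ((PB.trans hk.size Inst.esize_le_measure).add (PB.const 1))).add
      (PB.const 1)) fun d l₁ l₂ h => ?_
  refine (esize_le_of_forall (M := esize d.keys) fun x hx => ?_).trans
    (Nat.add_le_add_right (Nat.mul_le_mul_right _ ?_) 1)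
  · have h1 := mem_subs.1 hx
    have h2 : l₁.reverse.Sublist d.keys.reverse := by
      rw [h, List.reverse_append]; exact List.sublist_append_right _ _
    exact (esize_sublist (h1.trans h2)).trans (esize_perm (List.reverse_perm _)).le
  · have h1 := length_subs l₁
    rw [_root_.subs] at h1
    rw [h1]
    refine (Nat.pow_le_pow_right (by norm_num) ?_).trans (Nat.le_add_right _ _)
    rw [h, List.length_append]
    omega

theorem PTW.wordsOver : PTW Inst.measure fun d =>
    wordsOver d.alphabet ((halves d.keys).product (halves d.keys)) := by
  have hA : PT Inst.alphabet := by fun_prop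
  have hT : PT fun d : Inst => (halves d.keys).product (halves d.keys) := by fun_prop
  refine PTW.foldl Inst.esize_le_measure (hT.toPTW Inst.esize_le_measure) (PTW.const _)
    (by fun_prop)
    (M := fun d => d.count * (esize ((halves d.keys).product (halves d.keys)) *
      (esize d.alphabet + 1) + 1 + 1) + 1)
    ((Inst.count_le_measure.mul ((((PB.trans hT.size Inst.esize_le_measure).mul
      ((PB.trans hA.size Inst.esize_le_measure).add (PB.const 1))).add (PB.const 1)).add
        (PB.const 1))).add (PB.const 1)) fun d l₁ l₂ h => ?_
  have hl : l₁.length ≤ ((halves d.keys).product (halves d.keys)).length := by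
    rw [h, List.length_append]; omega
  refine (esize_le_of_forall (M := esize ((halves d.keys).product (halves d.keys)) *
      (esize d.alphabet + 1) + 1) fun x hx => ?_).trans
    (Nat.add_le_add_right (Nat.mul_le_mul_right _ ?_) 1)
  · obtain ⟨h1, h2⟩ := mem_wordsOver.1 hx
    refine (esize_le_of_forall fun a ha => esize_mem_le (h2 a ha)).trans
      (Nat.add_le_add_right (Nat.mul_le_mul_right _ ?_) 1)
    have := length_lt_esize ((halves d.keys).product (halves d.keys))
    omega
  · have h1 := length_wordsOver d.alphabet l₁
    rw [_root_.wordsOver] at h1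
    rw [h1]
    rcases Nat.eq_zero_or_pos d.alphabet.length with h2 | h2
    · rw [h2]
      refine le_trans ?_ d.one_le_count
      rcases l₁.length with _ | m <;> simp
    · exact (Nat.pow_le_pow_right h2 hl).trans (Nat.le_add_left _ _)

theorem PTW.solve : PTW Inst.measure Inst.solve := by
  have h0 : PT fun p : (List (List ℕ) × List (List ℕ)) × (List (List ℕ) × List (List ℕ)) =>
      (p.1.1.product p.1.2).product (p.2.1.product p.2.2) := by fun_prop
  have h1 := PTW.comp h0 ((PTW.subs.pair PTW.subs).pair (PTW.subs.pair PTW.wordsOver))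
  have h2 : PTW Inst.measure fun d : Inst => d := PT.id.toPTW Inst.esize_le_measure
  have h3 : PT fun p : Inst × List Cert => p.2.any fun c => p.1.check c := by fun_prop
  have h4 := PTW.comp h3 (h2.pair h1)
  exact h4

/-- A Boolean function that is computed on top of a stack is decided by a program that reads its
input from variable `0`. -/
theorem PTW.exists_program {μ : Inst → ℕ} {f : Inst → Bool} (hf : PTW μ f) :
    ∃ (p : WProg) (C k : ℕ), ∀ d, p.DecidesWithin (enc d) (f d = true)
      ((C * (μ d + 1) ^ k : ℕ) : ℝ) := by
  obtain ⟨p, T, hT, -, hp⟩ := hf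
  let e1 : WExpr := .cons X0 .nil
  let e2 : WExpr := .hd X0
  obtain ⟨C, k, h⟩ := (PB.const (μ := μ) (e1.cost + 1)).add (hT.add (PB.const (e2.cost + 1)))
  refine ⟨.seq (.assign 0 e1) (.seq p (.assign 0 e2)), C, k, fun d => ?_⟩
  have h1 : Runs (.seq (.assign 0 e1) (.seq p (.assign 0 e2))) (enc d) (enc (f d)) _ :=
    Runs.seq (Runs.assign (d₁ := .cons (enc d) .nil) fun σ hσ => by simp [e1, WExpr.eval, hσ])
      (Runs.seq (hp d .nil) (Runs.assign fun σ hσ => by simp [e2, WExpr.eval, hσ, Data.hd]))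
  obtain ⟨τ, t, h2, h3, h4⟩ := h1 (WProg.input (enc d)) rfl
  refine ⟨τ, t, h2, by exact_mod_cast h4.trans (h d), ?_⟩
  rw [h3]
  cases f d <;> simp [enc, encodeBit]

end enum

/-! ### Segments of a rooted tree -/

section tree

/-- The vertices `0, …, n - 1` with the relation `L` ("is a descendant of, or equal to") form a
rooted tree, in which every vertex outside `K` has exactly one child. -/
structure TreeOrder (n : ℕ) (L : List (ℕ × ℕ)) (K : List ℕ) : Prop where
  refl : ∀ v < n, (v, v) ∈ L
  lt : ∀ u v, (u, v) ∈ L → u < n ∧ v < n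
  trans : ∀ u v w, (u, v) ∈ L → (v, w) ∈ L → (u, w) ∈ L
  antisymm : ∀ u v, (u, v) ∈ L → (v, u) ∈ L → u = v
  chain : ∀ u v w, (u, v) ∈ L → (u, w) ∈ L → (v, w) ∈ L ∨ (w, v) ∈ L
  join : ∀ u < n, ∀ w < n, ∃ y, (u, y) ∈ L ∧ (w, y) ∈ L ∧
    (∀ z, (u, z) ∈ L → (w, z) ∈ L → (y, z) ∈ L) ∧ (y = u ∨ y = w ∨ y ∈ K)
  bot : ∀ z < n, ∃ k ∈ K, (k, z) ∈ L

/-- The vertex `z` lies in the segment named by `k`. -/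
def InSegment (L : List (ℕ × ℕ)) (K : List ℕ) (k z : ℕ) : Prop :=
  k ∈ K ∧ z ∉ K ∧ (k, z) ∈ L ∧ ∀ k' ∈ K, (k, k') ∈ L → (k', z) ∈ L → k' = k

/-- The vertex `z`, not a key, lies on the path between `s` and `t`. -/
def Crossed (L : List (ℕ × ℕ)) (s t z : ℕ) : Prop :=
  z = s ∨ z = t ∨ ((s, z) ∈ L ∧ (t, z) ∉ L) ∨ ((s, z) ∉ L ∧ (t, z) ∈ L)

theorem Crossed.symm {L : List (ℕ × ℕ)} {s t z : ℕ} (h : Crossed L s t z) : Crossed L t s z := by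
  unfold Crossed at *; tauto

theorem crossed_comm {L : List (ℕ × ℕ)} {s t z : ℕ} : Crossed L s t z ↔ Crossed L t s z :=
  ⟨Crossed.symm, Crossed.symm⟩

variable {n : ℕ} {L : List (ℕ × ℕ)} {K : List ℕ} (hT : TreeOrder n L K)
include hT

/-- Below a vertex of a segment there is, down to the key, only one branch. -/
theorem TreeOrder.comparable {k z w u : ℕ} (hz : InSegment L K k z) (hkw : (k, w) ∈ L)
    (hwz : (w, z) ∈ L) (huz : (u, z) ∈ L) : (u, w) ∈ L ∨ (w, u) ∈ L := by
  obtain ⟨y, h1, h2, h3, h4⟩ := hT.join u (hT.lt _ _ huz).1 w (hT.lt _ _ hwz).1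
  rcases h4 with rfl | rfl | h4
  · exact Or.inr h2
  · exact Or.inl h1
  · have := hz.2.2.2 y h4 (hT.trans _ _ _ hkw h2) (h3 z huz hwz)
    subst this
    obtain rfl := hT.antisymm _ _ hkw h2
    exact Or.inl h1

theorem TreeOrder.between {k z w : ℕ} (hz : InSegment L K k z) (hkw : (k, w) ∈ L)
    (hwz : (w, z) ∈ L) (hne : w ≠ k) : InSegment L K k w :=
  ⟨hz.1, fun hw => hne (hz.2.2.2 w hw hkw hwz), hkw, fun k' hk' h1 h2 =>
    hz.2.2.2 k' hk' h1 (hT.trans _ _ _ h2 hwz)⟩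

theorem TreeOrder.segment_unique {k k' z : ℕ} (hz : InSegment L K k z) (hz' : InSegment L K k' z) :
    k = k' := by
  rcases hT.comparable hz (hT.refl k (hT.lt _ _ hz.2.2.1).1) hz.2.2.1 hz'.2.2.1 with h | h
  · exact hz'.2.2.2 k hz.1 h hz.2.2.1
  · exact (hz.2.2.2 k' hz'.1 h hz'.2.2.1).symm

theorem TreeOrder.exists_segment {z : ℕ} (hz : z < n) (hK : z ∉ K) : ∃ k, InSegment L K k z := by
  -- the key below `z` with the fewest ancestors
  classical
  obtain ⟨k₀, hk₀, h₀⟩ := hT.bot z hz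
  let f : ℕ → ℕ := fun k => ((Finset.range n).filter fun w => (k, w) ∈ L).card
  obtain ⟨k, hk, hmin⟩ := Finset.exists_min_image (K.toFinset.filter fun k => (k, z) ∈ L) f
    ⟨k₀, by simp [hk₀, h₀]⟩
  simp only [Finset.mem_filter, List.mem_toFinset] at hk hmin
  refine ⟨k, hk.1, hK, hk.2, fun k' hk' h1 h2 => ?_⟩
  by_contra hne
  have hlt : f k' < f k := by
    refine Finset.card_lt_card (Finset.ssubset_iff_of_subset (fun w hw => ?_) |>.2 ⟨k, ?_, ?_⟩)
    · simp only [Finset.mem_filter] at hw ⊢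
      exact ⟨hw.1, hT.trans _ _ _ h1 hw.2⟩
    · simp only [Finset.mem_filter, Finset.mem_range]
      exact ⟨(hT.lt _ _ hk.2).1, hT.refl _ (hT.lt _ _ hk.2).1⟩
    · simp only [Finset.mem_filter, not_and]
      exact fun _ h => hne (hT.antisymm _ _ h h1)
  exact absurd (hmin k' ⟨hk', h2⟩) (by omega)

theorem TreeOrder.segment_chain {k y z : ℕ} (hy : InSegment L K k y) (hz : InSegment L K k z) :
    (y, z) ∈ L ∨ (z, y) ∈ L := hT.chain _ _ _ hy.2.2.1 hz.2.2.1

theorem TreeOrder.segment_refl {k z : ℕ} (hz : InSegment L K k z) : (z, z) ∈ L :=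
  hT.refl z (hT.lt _ _ hz.2.2.1).2

/-- Above a vertex of the segment and below another one there are only vertices of the segment. -/
theorem TreeOrder.between' {k y z w : ℕ} (hy : InSegment L K k y) (hz : InSegment L K k z)
    (hyw : (y, w) ∈ L) (hwz : (w, z) ∈ L) : InSegment L K k w := by
  refine hT.between hz (hT.trans _ _ _ hy.2.2.1 hyw) hwz ?_
  rintro rfl
  obtain rfl := hT.antisymm _ _ hyw hy.2.2.1
  exact hy.2.1 hy.1

theorem TreeOrder.below_iff {k y z s : ℕ} (hy : InSegment L K k y) (hz : InSegment L K k z)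
    (hs : ¬ InSegment L K k s) : (s, y) ∈ L ↔ (s, z) ∈ L := by
  have key : ∀ {y z}, InSegment L K k y → InSegment L K k z → (s, z) ∈ L → (s, y) ∈ L := by
    intro y z hy hz h
    rcases hT.segment_chain hy hz with h1 | h1
    · rcases hT.comparable hz hy.2.2.1 h1 h with h2 | h2
      exacts [h2, absurd (hT.between' hy hz h2 h) hs]
    · exact hT.trans _ _ _ h h1
  exact ⟨key hz hy, key hy hz⟩

/-- A path that crosses a vertex of a segment, but does not end in it, crosses all of it. -/
theorem TreeOrder.crossed_segment {k y z s t : ℕ} (hy : InSegment L K k y)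
    (hz : InSegment L K k z) (hs : ¬ InSegment L K k s) (ht : ¬ InSegment L K k t)
    (h : Crossed L s t y) : Crossed L s t z := by
  have h1 := hT.below_iff hy hz hs
  have h2 := hT.below_iff hy hz ht
  rcases h with rfl | rfl | h
  · exact absurd hy hs
  · exact absurd hy ht
  · exact Or.inr (Or.inr (by rwa [h1, h2] at h))

/-- A path that starts in a segment and ends outside crosses the part of the segment on one side of
its start. -/
theorem TreeOrder.crossed_iff {k z s t : ℕ} (hs : InSegment L K k s) (hz : InSegment L K k z)
    (ht : ¬ InSegment L K k t) :
    Crossed L s t z ↔ ((t, s) ∈ L ∧ (z, s) ∈ L) ∨ ((t, s) ∉ L ∧ (s, z) ∈ L) := by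
  have hss := hT.segment_refl hs
  have hzt : z ≠ t := fun h => ht (h ▸ hz)
  have hch := hT.segment_chain hz hs
  by_cases hts : (t, s) ∈ L
  · simp only [hts, true_and, not_true, false_and, or_false]
    constructor
    · rintro (rfl | h | ⟨h1, h2⟩ | ⟨h1, h2⟩)
      · exact hss
      · exact absurd h hzt
      · exact absurd (hT.trans _ _ _ hts h1) h2
      · tauto
    · intro h
      by_cases hzs : z = s
      · exact Or.inl hzs
      refine Or.inr (Or.inr (Or.inr ⟨fun h' => hzs (hT.antisymm _ _ h h'), ?_⟩))
      rcases hT.comparable hs hz.2.2.1 h hts with h1 | h1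
      exacts [h1, absurd (hT.between' hz hs h1 hts) ht]
  · simp only [hts, false_and, not_false_iff, true_and, false_or]
    constructor
    · rintro (rfl | h | ⟨h1, h2⟩ | ⟨h1, h2⟩)
      · exact hss
      · exact absurd h hzt
      · exact h1
      · exact hch.resolve_left fun h => hts (hT.trans _ _ _ h2 h)
    · intro h
      refine Or.inr (Or.inr (Or.inl ⟨h, fun h' => ?_⟩))
      rcases hT.comparable hz hs.2.2.1 h h' with h1 | h1
      exacts [hts h1, ht (hT.between' hs hz h1 h')]

/-- A path crosses the vertices of a segment in the same direction. -/
theorem TreeOrder.direction {k z z' s t : ℕ} (hz : InSegment L K k z) (hz' : InSegment L K k z')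
    (h : Crossed L s t z) (h' : Crossed L s t z') (hst : s ≠ t) :
    (if z = t then (s, t) ∉ L else (t, z) ∈ L) ↔ (if z' = t then (s, t) ∉ L else (t, z') ∈ L) := by
  have hzz := hT.segment_refl hz
  have hzz' := hT.segment_refl hz'
  have hch := hT.segment_chain hz hz'
  have key1 : ∀ {z'}, (z', z') ∈ L → Crossed L s t z' → z' ≠ t → ((t, z') ∈ L ∨ (z', t) ∈ L) →
      ((s, t) ∉ L ↔ (t, z') ∈ L) := by
    intro z' h0 h' hne hch
    constructor
    · intro hs
      by_contra htz
      have h1 := hch.resolve_left htz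
      rcases h' with rfl | h' | ⟨h2, -⟩ | ⟨-, h2⟩
      exacts [hs h1, hne h', hs (hT.trans _ _ _ h2 h1), htz h2]
    · intro htz hs
      rcases h' with rfl | h' | ⟨h2, h3⟩ | ⟨h2, h3⟩
      exacts [hst (hT.antisymm _ _ hs htz), hne h', h3 htz, h2 (hT.trans _ _ _ hs htz)]
  have key2 : ∀ {z z'}, (z, z) ∈ L → Crossed L s t z → Crossed L s t z' → z ≠ t → z' ≠ t →
      (z, z') ∈ L → (t, z') ∈ L → (t, z) ∈ L := by
    intro z z' h0 h h' hne hne' h1 h2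
    by_contra htz
    have hsz : (s, z) ∈ L := by
      rcases h with rfl | h | h | h
      exacts [h0, absurd h hne, h.1, absurd h.2 htz]
    have h3 := hT.trans _ _ _ hsz h1
    rcases h' with rfl | h' | h' | h'
    · obtain rfl := hT.antisymm _ _ hsz h1
      exact htz h2
    exacts [hne' h', h'.2 h2, h'.1 h3]
  by_cases h1 : z = t
  · by_cases h2 : z' = t
    · simp [h1, h2]
    · subst h1
      simp only [if_true, h2, if_false]
      exact key1 hzz' h' h2 hch
  · by_cases h2 : z' = t
    · subst h2
      simp only [if_true, h1, if_false]
      exact (key1 hzz h h1 hch.symm).symm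
    · simp only [h1, h2, if_false]
      rcases hch with h3 | h3
      · exact ⟨fun h4 => hT.trans _ _ _ h4 h3, key2 hzz h h' h1 h2 h3⟩
      · exact ⟨key2 hzz' h' h h2 h1 h3, fun h4 => hT.trans _ _ _ h4 h3⟩

omit hT in
theorem has_iff {α : Type} [DecidableEq α] {l : List α} {a : α} : has l a = true ↔ a ∈ l := by
  simp [has]

omit hT in
theorem has_eq {α : Type} [DecidableEq α] {l : List α} {a : α} : has l a = decide (a ∈ l) := by
  rw [Bool.eq_iff_iff, has_iff, decide_eq_true_iff]

omit hT in
theorem length_filter_range (n : ℕ) (p : ℕ → Bool) :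
    ((List.range n).filter p).length = ((Finset.range n).filter fun w => p w = true).card := by
  rw [← List.toFinset_card_of_nodup (List.nodup_range.filter _), List.toFinset_filter,
    List.toFinset_range]

theorem TreeOrder.position_lt {u v : ℕ} (h : (u, v) ∈ L) (hne : u ≠ v) :
    position (List.range n) L true v < position (List.range n) L true u ∧
    position (List.range n) L false u < position (List.range n) L false v := by
  have hu := (hT.lt _ _ h).1
  have h1 : (u, u) ∈ L := hT.refl _ hu
  have h2 : (v, u) ∉ L := fun h' => hne (hT.antisymm _ _ h h')
  simp only [position, length_filter_range]
  constructor
  · refine Finset.card_lt_card ((Finset.ssubset_iff_of_subset fun w hw => ?_).2 ⟨u, ?_, ?_⟩)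
    · simp only [Finset.mem_filter, beq_true, has_iff] at hw ⊢
      exact ⟨hw.1, hT.trans _ _ _ h hw.2⟩
    · simpa [has_iff] using ⟨hu, h1⟩
    · simp [has_iff, h2]
  · refine Finset.card_lt_card ((Finset.ssubset_iff_of_subset fun w hw => ?_).2 ⟨u, ?_, ?_⟩)
    · simp only [Finset.mem_filter, beq_false, Bool.not_eq_true', Bool.eq_false_iff, ne_eq,
        has_iff] at hw ⊢
      exact ⟨hw.1, fun h' => hw.2 (hT.trans _ _ _ h h')⟩
    · simpa [Bool.eq_false_iff, has_iff] using ⟨hu, h2⟩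
    · simp [Bool.eq_false_iff, has_iff, h1]

theorem TreeOrder.position_true {k z s : ℕ} (hz : InSegment L K k z) (hs : InSegment L K k s) :
    position (List.range n) L true z ≤ position (List.range n) L true s ↔ (s, z) ∈ L := by
  by_cases h : s = z
  · subst h; simp [hT.segment_refl hs]
  constructor
  · intro h1
    refine (hT.segment_chain hs hz).resolve_right fun h2 => ?_
    have := (hT.position_lt h2 (Ne.symm h)).1
    omega
  · exact fun h1 => (hT.position_lt h1 h).1.le

theorem TreeOrder.position_false {k z s : ℕ} (hz : InSegment L K k z) (hs : InSegment L K k s) :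
    position (List.range n) L false z ≤ position (List.range n) L false s ↔ (z, s) ∈ L := by
  by_cases h : z = s
  · subst h; simp [hT.segment_refl hs]
  constructor
  · intro h1
    refine (hT.segment_chain hz hs).resolve_right fun h2 => ?_
    have := (hT.position_lt h2 (Ne.symm h)).2
    omega
  · exact fun h1 => (hT.position_lt h1 h).2.le

omit hT in
theorem position_le (n : ℕ) (L : List (ℕ × ℕ)) (d : Bool) (z : ℕ) :
    position (List.range n) L d z ≤ n := by
  rw [position]
  simpa using (List.filter_sublist (l := List.range n)).length_le

/-! ### Orientations -/

omit hT in
/-- The orientation (`true`: towards the root) of the segment `f` for a colouring of the ends of the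
segments in `K₁`. Up to a sign that depends only on the part of the tree between the segments, the
upper end of `f` gets its own colour, and that sign is corrected at each segment above `f` whose
ends have the same colour. -/
noncomputable def orient (L : List (ℕ × ℕ)) (K K₁ : List ℕ) (col : Half → Bool) (f : ℕ) : Bool :=
  open Classical in
  (col (f, true)).xor (K₁.toFinset.filter fun g => g ≠ f ∧ col (g, true) = col (g, false) ∧
    ∃ z, InSegment L K g z ∧ (f, z) ∈ L).card.bodd

theorem TreeOrder.key_below_iff {f s z g : ℕ} (hs : InSegment L K f s) (hz : InSegment L K g z)
    (hne : g ≠ f) : (f, z) ∈ L ↔ (s, z) ∈ L := by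
  constructor
  · intro h
    refine (hT.chain _ _ _ hs.2.2.1 h).resolve_right fun h1 => hne ?_
    exact hT.segment_unique hz (hT.between hs h h1 (by rintro rfl; exact hz.2.1 hs.1))
  · exact fun h => hT.trans _ _ _ hs.2.2.1 h

/-- If a path from the segment `f` to the segment `g` crosses no other segment, then `f` lies below
`g` exactly if the start of the path lies below its end. -/
theorem TreeOrder.exists_above_iff {f g s t : ℕ} (hs : InSegment L K f s) (ht : InSegment L K g t)
    (hne : f ≠ g) : (∃ z, InSegment L K g z ∧ (f, z) ∈ L) ↔ (s, t) ∈ L := by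
  constructor
  · rintro ⟨z, hz, h⟩
    have h1 := (hT.key_below_iff hs hz hne.symm).1 h
    refine (hT.below_iff ht hz fun h' => hne ?_).2 h1
    exact hT.segment_unique hs h'
  · exact fun h => ⟨t, ht, hT.trans _ _ _ hs.2.2.1 h⟩

theorem TreeOrder.orient_spec {K₁ : List ℕ} {col : Half → Bool} {f g s t : ℕ}
    (hs : InSegment L K f s) (ht : InSegment L K g t) (hne : f ≠ g) (hf : f ∈ K₁) (hg : g ∈ K₁)
    (hother : ∀ h ∈ K₁, h ≠ f → h ≠ g → ∀ z, InSegment L K h z → ((s, z) ∈ L ↔ (t, z) ∈ L))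
    (hcol : col (f, decide ((t, s) ∉ L)) ≠ col (g, decide ((s, t) ∉ L))) :
    (orient L K K₁ col f).xor (decide ((t, s) ∈ L)) =
      !(orient L K K₁ col g).xor (decide ((s, t) ∈ L)) := by
  classical
  have hcard : ∀ {f g s t}, InSegment L K f s → InSegment L K g t → f ≠ g → f ∈ K₁ → g ∈ K₁ →
      (K₁.toFinset.filter fun h => h ≠ f ∧ col (h, true) = col (h, false) ∧
        ∃ z, InSegment L K h z ∧ (f, z) ∈ L).card =
      (K₁.toFinset.filter fun h => h ≠ f ∧ h ≠ g ∧ col (h, true) = col (h, false) ∧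
        ∃ z, InSegment L K h z ∧ (f, z) ∈ L).card +
      if col (g, true) = col (g, false) ∧ (s, t) ∈ L then 1 else 0 := by
    intro f g s t hs ht hne hf hg
    have hex := hT.exists_above_iff hs ht hne
    split_ifs with h
    · rw [← Finset.card_insert_of_notMem (a := g) (by simp)]
      congr 1
      ext h'
      simp only [Finset.mem_filter, Finset.mem_insert, List.mem_toFinset]
      constructor
      · rintro ⟨h1, h2, h3, h4⟩
        by_cases h5 : h' = g
        exacts [Or.inl h5, Or.inr ⟨h1, h2, h5, h3, h4⟩]
      · rintro (rfl | ⟨h1, h2, -, h3, h4⟩)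
        exacts [⟨hg, hne.symm, h.1, hex.2 h.2⟩, ⟨h1, h2, h3, h4⟩]
    · rw [add_zero]
      congr 1
      ext h'
      simp only [Finset.mem_filter, List.mem_toFinset]
      constructor
      · rintro ⟨h1, h2, h3, h4⟩
        refine ⟨h1, h2, ?_, h3, h4⟩
        rintro rfl
        exact h ⟨h3, hex.1 h4⟩
      · rintro ⟨h1, h2, -, h3, h4⟩
        exact ⟨h1, h2, h3, h4⟩
  have heq : (K₁.toFinset.filter fun h => h ≠ f ∧ h ≠ g ∧ col (h, true) = col (h, false) ∧
        ∃ z, InSegment L K h z ∧ (f, z) ∈ L) =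
      (K₁.toFinset.filter fun h => h ≠ g ∧ h ≠ f ∧ col (h, true) = col (h, false) ∧
        ∃ z, InSegment L K h z ∧ (g, z) ∈ L) := by
    ext h
    simp only [Finset.mem_filter, List.mem_toFinset]
    constructor
    · rintro ⟨h1, h2, h3, h4, z, h5, h6⟩
      exact ⟨h1, h3, h2, h4, z, h5, (hT.key_below_iff ht h5 h3).2
        ((hother h h1 h2 h3 z h5).1 ((hT.key_below_iff hs h5 h2).1 h6))⟩
    · rintro ⟨h1, h3, h2, h4, z, h5, h6⟩
      exact ⟨h1, h2, h3, h4, z, h5, (hT.key_below_iff hs h5 h2).2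
        ((hother h h1 h2 h3 z h5).2 ((hT.key_below_iff ht h5 h3).1 h6))⟩
  have h1 := hcard hs ht hne hf hg
  have h2 := hcard ht hs hne.symm hg hf
  rw [heq] at h1
  unfold orient
  rw [h1, h2]
  generalize (K₁.toFinset.filter fun h => h ≠ g ∧ h ≠ f ∧ col (h, true) = col (h, false) ∧
        ∃ z, InSegment L K h z ∧ (g, z) ∈ L).card = m
  have hnot : ¬ ((s, t) ∈ L ∧ (t, s) ∈ L) := fun h => hne (by
    obtain rfl := hT.antisymm _ _ h.1 h.2
    exact hT.segment_unique hs ht)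
  clear h1 h2 heq hcard hother
  by_cases h3 : (s, t) ∈ L
  · have h4 : (t, s) ∉ L := fun h => hnot ⟨h3, h⟩
    simp only [h3, h4, not_true, not_false_iff, decide_true, decide_false, and_true, and_false,
      if_false, add_zero] at hcol ⊢
    revert hcol
    cases col (f, true) <;> cases col (g, true) <;> cases col (g, false) <;> cases h : m.bodd <;>
      simp [h]
  · by_cases h4 : (t, s) ∈ L
    · simp only [h3, h4, not_true, not_false_iff, decide_true, decide_false, and_true, and_false,
        if_false, add_zero] at hcol ⊢
      revert hcol
      cases col (f, true) <;> cases col (g, true) <;> cases col (f, false) <;> cases h : m.bodd <;>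
        simp [h]
    · simp only [h3, h4, not_false_iff, decide_true, decide_false, and_false,
        if_false, add_zero] at hcol ⊢
      revert hcol
      cases col (f, true) <;> cases col (g, true) <;> cases h : m.bodd <;> simp

end tree

/-! ### Crossing the chosen segments -/

section crossing
variable {n : ℕ} {L : List (ℕ × ℕ)} {K : List ℕ} (hT : TreeOrder n L K)
include hT

theorem TreeOrder.mem_segments {k z : ℕ} :
    (k, z) ∈ segments (List.range n) K L ↔ InSegment L K k z := by
  simp only [segments, List.mem_filter, List.pair_mem_product, List.mem_range, Bool.and_eq_true,
    Bool.not_eq_true', Bool.eq_false_iff, ne_eq, has_iff, List.all_eq_true, Bool.or_eq_true,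
    decide_eq_true_eq, InSegment]
  constructor
  · rintro ⟨⟨h1, h2⟩, ⟨h3, h4⟩, h5⟩
    exact ⟨h1, h3, h4, fun k' hk' h6 h7 => (h5 k' hk').resolve_right fun h => h ⟨h6, h7⟩⟩
  · rintro ⟨h1, h2, h3, h4⟩
    refine ⟨⟨h1, (hT.lt _ _ h3).2⟩, ⟨h2, h3⟩, fun k' hk' => ?_⟩
    by_cases h : (k, k') ∈ L ∧ (k', z) ∈ L
    exacts [Or.inl (h4 k' hk' h.1 h.2), Or.inr h]

theorem TreeOrder.mem_cutVertices {K₁ : List ℕ} {z : ℕ} :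
    z ∈ cutVertices (List.range n) (segments (List.range n) K L) K₁ ↔
      ∃ k ∈ K₁, InSegment L K k z := by
  simp only [cutVertices, List.mem_filter, List.mem_range, List.any_eq_true, Bool.and_eq_true,
    decide_eq_true_eq, has_iff]
  constructor
  · rintro ⟨-, ⟨k, z⟩, h1, rfl, h2⟩
    exact ⟨k, h2, hT.mem_segments.1 h1⟩
  · rintro ⟨k, hk, h⟩
    exact ⟨(hT.lt _ _ h.2.2.1).2, (k, z), hT.mem_segments.2 h, rfl, hk⟩

omit hT in
theorem onPath_iff {p : ℕ × ℕ} {z : ℕ} : onPath L p z = true ↔ Crossed L p.1 p.2 z := by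
  simp only [onPath, Bool.or_eq_true, decide_eq_true_eq, Crossed, or_assoc, has_eq]
  refine or_congr_right (or_congr_right ?_)
  by_cases h1 : (p.1, z) ∈ L <;> by_cases h2 : (p.2, z) ∈ L <;> simp [h1, h2]

theorem TreeOrder.inBound_iff {b : Bound} {z : ℕ} :
    inBound (List.range n) L (segments (List.range n) K L) b z = true ↔
      InSegment L K b.1.1 z ∧ position (List.range n) L b.1.2 z ≤ b.2 := by
  simp only [inBound, Bool.and_eq_true, has_iff, decide_eq_true_eq, hT.mem_segments]

theorem TreeOrder.orientation_eq {k z : ℕ} {O : List ℕ} (hz : InSegment L K k z) :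
    ((segments (List.range n) K L).any fun e => decide (e.2 = z) && has O e.1) = has O k := by
  rw [Bool.eq_iff_iff]
  simp only [List.any_eq_true, Bool.and_eq_true, decide_eq_true_eq]
  constructor
  · rintro ⟨⟨k', z⟩, h1, rfl, h2⟩
    rwa [hT.segment_unique hz (hT.mem_segments.1 h1)]
  · exact fun h => ⟨(k, z), hT.mem_segments.2 hz, rfl, h⟩

/-- A path from one segment to another that crosses no other segment: what it crosses is described
by two bounds. -/
theorem TreeOrder.crossed_iff_inBound {f g s t z : ℕ} {K₁ : List ℕ} (hs : InSegment L K f s)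
    (ht : InSegment L K g t) (hne : f ≠ g)
    (hother : ∀ h ∈ K₁, h ≠ f → h ≠ g → ∀ z, InSegment L K h z → ¬ Crossed L s t z)
    (hz : ∃ k ∈ K₁, InSegment L K k z) :
    Crossed L s t z ↔
      inBound (List.range n) L (segments (List.range n) K L) ((f, decide ((t, s) ∉ L)),
        position (List.range n) L (decide ((t, s) ∉ L)) s) z = true ∨
      inBound (List.range n) L (segments (List.range n) K L) ((g, decide ((s, t) ∉ L)),
        position (List.range n) L (decide ((s, t) ∉ L)) t) z = true := by
  have key : ∀ {f g s t}, InSegment L K f s → InSegment L K g t → f ≠ g → InSegment L K f z →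
      (Crossed L s t z ↔ position (List.range n) L (decide ((t, s) ∉ L)) z ≤
        position (List.range n) L (decide ((t, s) ∉ L)) s) := by
    intro f g s t hs ht hne hz
    rw [hT.crossed_iff hs hz fun h => hne (hT.segment_unique h ht)]
    by_cases h : (t, s) ∈ L
    · simp [h, hT.position_false hz hs]
    · simp [h, hT.position_true hz hs]
  obtain ⟨k, hk, hz⟩ := hz
  simp only [hT.inBound_iff]
  by_cases h1 : k = f
  · subst h1
    have h2 : ¬ InSegment L K g z := fun h => hne (hT.segment_unique hz h)
    simp only [hz, h2, true_and, false_and, or_false, key hs ht hne hz]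
  · have h2 : ¬ InSegment L K f z := fun h => h1 (hT.segment_unique hz h)
    by_cases h3 : k = g
    · subst h3
      simp only [hz, h2, true_and, false_and, false_or]
      rw [crossed_comm]
      exact key ht hs hne.symm hz
    · have h4 : ¬ InSegment L K g z := fun h => h3 (hT.segment_unique hz h)
      simp only [h2, h4, false_and, or_false, iff_false]
      exact hother k hk h1 h3 z hz

omit hT in
/-- The nodes at the ends of a path: they lie on different sides of exactly the vertices that the path
crosses. -/
theorem exists_end_nodes (L G : List (ℕ × ℕ)) (O : List ℕ) (s t : ℕ) : ∃ i j : Node, i.1 = s ∧ j.1 = t ∧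
    (∀ z, (Crossed L s t z → side L G O z i = !side L G O z j) ∧
      (¬ Crossed L s t z → side L G O z i = side L G O z j)) ∧
    (s ≠ t → ∀ z, side L G O z j = (decide (if z = t then (s, t) ∉ L else (t, z) ∈ L)).xor
      (G.any fun e => decide (e.2 = z) && has O e.1)) := by
  set ori : ℕ → Bool := fun z => G.any fun e => decide (e.2 = z) && has O e.1 with hori
  have hside : ∀ z (i : Node), side L G O z i = bif decide (i.1 = z) then i.2 else
    (has L (i.1, z)).xor (ori z) := fun _ _ => rfl
  by_cases hst : s = t
  · subst hst
    refine ⟨(s, false), (s, true), rfl, rfl, fun z => ⟨fun h => ?_, fun h => ?_⟩,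
      fun h => absurd rfl h⟩
    · have : s = z := by unfold Crossed at h; tauto
      simp [side, this]
    · have : s ≠ z := by rintro rfl; exact h (Or.inl rfl)
      simp [side, this]
  refine ⟨(s, !(has L (t, s)).xor (ori s)), (t, !(has L (s, t)).xor (ori t)), rfl, rfl,
    fun z => ?_, fun _ z => ?_⟩
  · rw [hside, hside]
    by_cases h1 : s = z
    · subst h1
      have : ¬ t = s := fun h => hst h.symm
      simp only [decide_true, cond_true, this, decide_false, cond_false]
      exact ⟨fun _ => trivial, fun h => absurd (Or.inl rfl) h⟩
    · by_cases h2 : t = z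
      · subst h2
        simp only [h1, decide_true, cond_true, decide_false, cond_false, Bool.not_not]
        exact ⟨fun _ => trivial, fun h => absurd (Or.inr (Or.inl rfl)) h⟩
      · simp only [h1, h2, decide_false, cond_false]
        have h3 : Crossed L s t z ↔ (has L (s, z) = !has L (t, z)) := by
          rw [← onPath_iff (p := (s, t))]
          simp [onPath, Ne.symm h1, Ne.symm h2]
          cases has L (s, z) <;> cases has L (t, z) <;> simp
        rw [h3]
        cases has L (s, z) <;> cases has L (t, z) <;> cases ori z <;> simp
  · rw [hside]
    change _ = (decide _).xor (ori z)
    by_cases h : t = z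
    · subst h
      simp only [decide_true, cond_true, if_true]
      rw [has_eq]
      by_cases h2 : (s, t) ∈ L <;> simp [h2]
    · simp [has_eq, h, Ne.symm h]

/-- The nodes `i` and `j` are separated by exactly the vertices of `T` among those of `Q`, all of
which are crossed forwards on the way from `i` to `j`. -/
def Forward (L G : List (ℕ × ℕ)) (O : List ℕ) (Q T : ℕ → Prop) (i j : Node) : Prop :=
  ∀ z, Q z → (T z → side L G O z i = false ∧ side L G O z j = true) ∧
    (¬ T z → side L G O z i = side L G O z j)

omit hT in
theorem exists_forward {L G : List (ℕ × ℕ)} {O : List ℕ} {Q T : ℕ → Prop} {i j : Node}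
    (h1 : ∀ z, (T z → side L G O z i = !side L G O z j) ∧ (¬ T z → side L G O z i = side L G O z j))
    (h2 : ∀ z z', Q z → Q z' → T z → T z' → side L G O z j = side L G O z' j) :
    Forward L G O Q T i j ∨ Forward L G O Q T j i := by
  by_cases hall : ∀ z, Q z → T z → side L G O z j = true
  · refine Or.inl fun z hz => ⟨fun h => ?_, (h1 z).2⟩
    have h3 := hall z hz h
    exact ⟨by rw [(h1 z).1 h, h3]; rfl, h3⟩
  · push Not at hall
    obtain ⟨z', hz', h', h3⟩ := hall
    refine Or.inr fun z hz => ⟨fun h => ?_, fun h => ((h1 z).2 h).symm⟩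
    have h4 : side L G O z j = false := by
      rw [h2 z z' hz hz' h h']; simpa using h3
    exact ⟨h4, by rw [(h1 z).1 h, h4]; rfl⟩

theorem TreeOrder.same_side {O : List ℕ} {j : Node} {s t k z z' : ℕ}
    (hE : s ≠ t → ∀ z, side L (segments (List.range n) K L) O z j =
      (decide (if z = t then (s, t) ∉ L else (t, z) ∈ L)).xor
        ((segments (List.range n) K L).any fun e => decide (e.2 = z) && has O e.1))
    (hz : InSegment L K k z) (hz' : InSegment L K k z') (h : Crossed L s t z)
    (h' : Crossed L s t z') : side L (segments (List.range n) K L) O z j =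
      side L (segments (List.range n) K L) O z' j := by
  by_cases hst : s = t
  · subst hst
    have h1 : z = s := by unfold Crossed at h; tauto
    have h2 : z' = s := by unfold Crossed at h'; tauto
    rw [h1, h2]
  rw [hE hst, hE hst, hT.orientation_eq hz, hT.orientation_eq hz']
  congr 1
  rw [decide_eq_decide]
  exact hT.direction hz hz' h h' hst

/-- If a path contains no complete chosen segment, then with a suitable orientation all chosen
segments are crossed in the same direction. -/
theorem TreeOrder.exists_monotone {K₁ O : List ℕ} {col : Half → Bool} {s t : ℕ}
    (hO : ∀ k ∈ K₁, has O k = orient L K K₁ col k)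
    (hfull : ∀ k ∈ K₁, ∃ z, InSegment L K k z ∧ ¬ Crossed L s t z)
    (hcol : ∀ f ∈ K₁, ∀ g ∈ K₁, ∀ d d' m m', m ≤ n → m' ≤ n →
      (∀ z, (∃ k ∈ K₁, InSegment L K k z) → (Crossed L s t z ↔
        inBound (List.range n) L (segments (List.range n) K L) ((f, d), m) z = true ∨
        inBound (List.range n) L (segments (List.range n) K L) ((g, d'), m') z = true)) →
      col (f, d) ≠ col (g, d')) :
    ∃ i j : Node, (i.1 = s ∨ i.1 = t) ∧ (j.1 = s ∨ j.1 = t) ∧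
      Forward L (segments (List.range n) K L) O (fun z => ∃ k ∈ K₁, InSegment L K k z)
        (Crossed L s t) i j := by
  obtain ⟨i₀, j₀, hi₀, hj₀, ha, hE⟩ := exists_end_nodes L (segments (List.range n) K L) O s t
  have hsame := fun {k z z'} => hT.same_side (k := k) (z := z) (z' := z') hE
  have hends : ∀ k ∈ K₁, ∀ z, InSegment L K k z → Crossed L s t z →
      InSegment L K k s ∨ InSegment L K k t := by
    intro k hk z hz h
    by_contra hc
    obtain ⟨y, hy, h'⟩ := hfull k hk
    exact h' (hT.crossed_segment hz hy (fun h => hc (Or.inl h)) (fun h => hc (Or.inr h)) h)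
  have htwo : ∀ {f g}, f ∈ K₁ → g ∈ K₁ → f ≠ g → InSegment L K f s → InSegment L K g t →
      side L (segments (List.range n) K L) O s j₀ = side L (segments (List.range n) K L) O t j₀ := by
    intro f g hf hg hne hs ht
    have hst : s ≠ t := by rintro rfl; exact hne (hT.segment_unique hs ht)
    have hother : ∀ h ∈ K₁, h ≠ f → h ≠ g → ∀ z, InSegment L K h z → ¬ Crossed L s t z := by
      intro h hh h1 h2 z hz hc
      rcases hends h hh z hz hc with h3 | h3
      exacts [h1 (hT.segment_unique h3 hs), h2 (hT.segment_unique h3 ht)]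
    have hc := hcol f hf g hg _ _ _ _ (position_le _ _ _ _) (position_le _ _ _ _)
      fun z hz => hT.crossed_iff_inBound hs ht hne hother hz
    have h1 := hT.orient_spec hs ht hne hf hg (fun h hh h1 h2 z hz => by
      have := hother h hh h1 h2 z hz
      unfold Crossed at this
      tauto) hc
    rw [hE hst, hE hst]
    simp only [hst, if_false, if_true]
    rw [hT.orientation_eq hs, hT.orientation_eq ht, hO f hf, hO g hg]
    revert h1
    by_cases h2 : (t, s) ∈ L <;> by_cases h3 : (s, t) ∈ L <;> simp [h2, h3]
  rcases exists_forward (Q := fun z => ∃ k ∈ K₁, InSegment L K k z) ha (by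
    rintro z z' ⟨k, hk, hz⟩ ⟨k', hk', hz'⟩ h h'
    by_cases hkk : k = k'
    · subst hkk; exact hsame hz hz' h h'
    have hcs : Crossed L s t s := Or.inl rfl
    have hct : Crossed L s t t := Or.inr (Or.inl rfl)
    rcases hends k hk z hz h with h1 | h1 <;> rcases hends k' hk' z' hz' h' with h2 | h2
    · exact absurd (hT.segment_unique h1 h2) hkk
    · rw [hsame hz h1 h hcs, hsame hz' h2 h' hct, htwo hk hk' hkk h1 h2]
    · rw [hsame hz h1 h hct, hsame hz' h2 h' hcs, htwo hk' hk (Ne.symm hkk) h2 h1]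
    · exact absurd (hT.segment_unique h1 h2) hkk) with h | h
  exacts [⟨i₀, j₀, Or.inl hi₀, Or.inr hj₀, h⟩, ⟨j₀, i₀, Or.inr hj₀, Or.inl hi₀, h⟩]

/-- The vertices of a segment that satisfy a bound are crossed in the same direction. -/
theorem TreeOrder.exists_forward_bound {K₁ O : List ℕ} {b : Bound} {y : ℕ}
    (hy : inBound (List.range n) L (segments (List.range n) K L) b y = true) :
    ∃ i j : Node, i.1 < n ∧ j.1 < n ∧
      Forward L (segments (List.range n) K L) O (fun z => ∃ k ∈ K₁, InSegment L K k z)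
        (fun z => inBound (List.range n) L (segments (List.range n) K L) b z = true) i j := by
  classical
  -- the ends of the set of these vertices
  have hlt : ∀ {z}, inBound (List.range n) L (segments (List.range n) K L) b z = true → z < n :=
    fun h => (hT.lt _ _ (hT.inBound_iff.1 h).1.2.2.1).2
  obtain ⟨s, hs, hs'⟩ := Finset.exists_min_image ((Finset.range n).filter fun z =>
    inBound (List.range n) L (segments (List.range n) K L) b z = true)
    (position (List.range n) L false) ⟨y, by simp [hlt hy, hy]⟩
  obtain ⟨t, ht, ht'⟩ := Finset.exists_min_image ((Finset.range n).filter fun z =>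
    inBound (List.range n) L (segments (List.range n) K L) b z = true)
    (position (List.range n) L true) ⟨y, by simp [hlt hy, hy]⟩
  simp only [Finset.mem_filter, Finset.mem_range] at hs ht hs' ht'
  have hsI := (hT.inBound_iff.1 hs.2).1
  have htI := (hT.inBound_iff.1 ht.2).1
  have hst : (s, t) ∈ L := (hT.position_false hsI htI).1 (hs' t ht)
  have hiff : ∀ z, Crossed L s t z ↔
      inBound (List.range n) L (segments (List.range n) K L) b z = true := by
    intro z
    constructor
    · rintro (rfl | rfl | ⟨h1, h2⟩ | ⟨h1, h2⟩)
      · exact hs.2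
      · exact ht.2
      · have h3 := (hT.chain _ _ _ h1 hst).resolve_right h2
        have h4 := hT.between' hsI htI h1 h3
        rw [hT.inBound_iff]
        refine ⟨h4, ?_⟩
        cases hd : b.1.2 with
        | true =>
          refine ((hT.position_true h4 hsI).2 h1).trans ?_
          rw [← hd]; exact (hT.inBound_iff.1 hs.2).2
        | false =>
          refine ((hT.position_false h4 htI).2 h3).trans ?_
          rw [← hd]; exact (hT.inBound_iff.1 ht.2).2
      · exact absurd (hT.trans _ _ _ hst h2) h1
    · intro h
      have hz := (hT.inBound_iff.1 h).1
      have h1 := (hT.position_false hsI hz).1 (hs' z ⟨hlt h, h⟩)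
      have h2 := (hT.position_true htI hz).1 (ht' z ⟨hlt h, h⟩)
      by_cases h3 : z = t
      · exact Or.inr (Or.inl h3)
      · exact Or.inr (Or.inr (Or.inl ⟨h1, fun h4 => h3 (hT.antisymm _ _ h2 h4)⟩))
  obtain ⟨i, j, hi, hj, ha, hE⟩ := exists_end_nodes L (segments (List.range n) K L) O s t
  simp only [hiff] at ha
  rcases exists_forward (Q := fun z => ∃ k ∈ K₁, InSegment L K k z) ha (fun z z' _ _ h h' =>
    hT.same_side hE (hT.inBound_iff.1 h).1 (hT.inBound_iff.1 h').1 ((hiff z).2 h)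
      ((hiff z').2 h')) with h | h
  exacts [⟨i, j, hi ▸ hs.1, hj ▸ ht.1, h⟩, ⟨j, i, hj ▸ ht.1, hi ▸ hs.1, h⟩]

/-- If `z` separates `i` from `j` and `z'` does not, then `z` lies on their side of `z'`. -/
theorem TreeOrder.side_convex {G : List (ℕ × ℕ)} {O : List ℕ} {z z' : ℕ} {i j : Node} (hz : z < n)
    (hne : z ≠ z') (h : side L G O z i ≠ side L G O z j) (h' : side L G O z' i = side L G O z' j)
    (b : Bool) : side L G O z' (z, b) = side L G O z' i := by
  set ori : ℕ → Bool := fun z => G.any fun e => decide (e.2 = z) && has O e.1 with hori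
  have hside : ∀ z (i : Node), side L G O z i = bif decide (i.1 = z) then i.2 else
    (has L (i.1, z)).xor (ori z) := fun _ _ => rfl
  have key : ∀ i j : Node, (side L G O z i).xor (ori z) = true →
      (side L G O z j).xor (ori z) = false → side L G O z' i = side L G O z' j →
      side L G O z' (z, b) = side L G O z' i := by
    intro i j hi hj hij
    have h1 : (i.1, z) ∈ L := by
      by_cases h : i.1 = z
      · rw [h]; exact hT.refl z hz
      · rw [hside] at hi
        simpa [h, has_iff] using hi
    have h2 : (j.1, z) ∉ L ∨ j.1 = z := by
      by_cases h : j.1 = z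
      · exact Or.inr h
      · rw [hside] at hj
        left
        simpa [h, has_eq] using hj
    have hz' : side L G O z' (z, b) = (has L (z, z')).xor (ori z') := by
      rw [hside]; simp [hne]
    rw [hz', has_eq]
    by_cases h3 : (z, z') ∈ L
    · have h4 : i.1 ≠ z' := by
        intro h
        exact hne (hT.antisymm _ _ h3 (h ▸ h1))
      rw [hside]
      simp [h3, h4, has_iff.2 (hT.trans _ _ _ h1 h3)]
    · by_contra hc
      have h5 : (side L G O z' i).xor (ori z') = true := by
        simp only [h3, decide_false, Bool.false_xor] at hc
        revert hc
        cases side L G O z' i <;> cases ori z' <;> simp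
      have hle : ∀ i : Node, (side L G O z' i).xor (ori z') = true → i.1 = z' ∨ (i.1, z') ∈ L := by
        intro i h
        by_cases h6 : i.1 = z'
        · exact Or.inl h6
        · rw [hside] at h
          right
          simpa [h6, has_iff] using h
      have h6 : (z', z) ∈ L := by
        rcases hle i h5 with h | h
        · rwa [h] at h1
        · exact (hT.chain _ _ _ h1 h).resolve_left h3
      rw [hij] at h5
      rcases hle j h5 with h | h
      · rcases h2 with h7 | h7
        · exact h7 (h ▸ h6)
        · exact hne (h7.symm.trans h)
      · rcases h2 with h7 | h7
        · exact h7 (hT.trans _ _ _ h h6)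
        · exact h3 (h7 ▸ h)
  cases h1 : (side L G O z i).xor (ori z) with
  | true =>
    refine key i j h1 ?_ h'
    revert h h1
    cases side L G O z i <;> cases side L G O z j <;> cases ori z <;> simp
  | false =>
    rw [h']
    refine key j i ?_ h1 h'.symm
    revert h h1
    cases side L G O z i <;> cases side L G O z j <;> cases ori z <;> simp

end crossing

/-! ### Every solution gives rise to a successful guess -/

section complete

/-- The graph with the edges `E` on `0, …, n - 1` is a tree with the keys `K`, and `L` is its order. -/
structure TreeCuts (n : ℕ) (E L : List (ℕ × ℕ)) (K : List ℕ) : Prop extends TreeOrder n L K where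
  key_lt : ∀ k ∈ K, k < n
  cut : ∀ X z s t, z ∉ K → Crossed L s t z → z ∈ X → conn (List.range n) E X s t = false
  hit : ∀ X Y s t, s < n → t < n → conn (List.range n) E X s t = true →
    conn (List.range n) E Y s t = false → (∀ v ∈ Y, v ∈ K → v ∈ X) →
    ∃ z ∈ Y, z < n ∧ z ∉ K ∧ Crossed L s t z
  mono : ∀ X Y s t, conn (List.range n) E X s t = false → (∀ v ∈ X, v ∈ Y) →
    conn (List.range n) E Y s t = false

variable {n : ℕ} {E L : List (ℕ × ℕ)} {K : List ℕ}

theorem mem_flowNodes {i : Node} : i ∈ flowNodes (List.range n) ↔ i.1 < n := by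
  obtain ⟨v, b⟩ := i
  simp only [flowNodes, List.pair_mem_product, List.mem_range]
  cases b <;> simp

theorem nodup_product {α β : Type} {l : List α} {m : List β} (hl : l.Nodup) (hm : m.Nodup) :
    (l.product m).Nodup := List.Nodup.product hl hm

theorem nodup_flowItems {G : List (ℕ × ℕ)} {O Q : List ℕ} {D : List (List ℕ)} :
    (flowItems (List.range n) L G O Q D).Nodup := by
  have hn : (flowNodes (List.range n)).Nodup := nodup_product List.nodup_range (by simp)
  exact List.Nodup.filter _ (nodup_product (nodup_product hn hn) (by simp))

theorem mem_flowItems {G : List (ℕ × ℕ)} {O Q : List ℕ} {D : List (List ℕ)} {i j : Node} {c : Bool} :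
    ((i, j), c) ∈ flowItems (List.range n) L G O Q D ↔ i.1 < n ∧ j.1 < n ∧
      (∀ z ∈ Q, side L G O z i = true → side L G O z j = true) ∧
      (c = true → ∃ T ∈ D, ∀ z ∈ T, side L G O z i = false ∧ side L G O z j = true) := by
  have h : (c = true ∨ c = false) := by cases c <;> simp
  simp only [flowItems, List.mem_filter, List.pair_mem_product, mem_flowNodes, List.mem_cons,
    List.not_mem_nil, or_false, and_true, Bool.and_eq_true, List.all_eq_true, Bool.or_eq_true,
    Bool.not_eq_true', List.any_eq_true, and_assoc, h.symm]
  refine and_congr_right fun _ => and_congr_right fun _ => and_congr ?_ ?_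
  · refine forall₂_congr fun z _ => ?_
    cases side L G O z i <;> simp
  · cases c <;> simp

/-- The set selected by the flow computation weighs at most as much as any set that meets all
demands, and meets each demand that is crossed forwards. -/
theorem TreeOrder.selection_spec (hT : TreeOrder n L K) {G ω : List (ℕ × ℕ)} {O Q : List ℕ}
    {D : List (List ℕ)} (hQ : ∀ z ∈ Q, z < n) (hD : ∀ T ∈ D, ∀ z ∈ T, z ∈ Q)
    (S : Finset ℕ) (hS : ∀ T ∈ D, ∃ z ∈ T, z ∈ S) :
    (∑ z ∈ Q.toFinset with potLT (gainTable (List.range n) L G O Q ω D) (z, false) (z, true) = true,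
      weight ω z) ≤ ∑ z ∈ Q.toFinset with z ∈ S, weight ω z ∧
    ∀ T ∈ D, ∀ i j : Node, i.1 < n → j.1 < n → Forward L G O (· ∈ Q) (· ∈ T) i j →
      ∃ z ∈ Q, z ∈ T ∧
        potLT (gainTable (List.range n) L G O Q ω D) (z, false) (z, true) = true := by
  classical
  have hside : ∀ z z' b b', z ≠ z' → side L G O z' (z, b) = side L G O z' (z, b') := by
    intro z z' b b' h
    simp [side, h]
  have hself : ∀ z b, side L G O z (z, b) = b := by
    intro z b
    simp [side]
  -- the potential of the given set
  set p : Node → ℤ := fun i => ∑ z ∈ Q.toFinset with z ∈ S, if side L G O z i = true then 1 else 0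
    with hp
  have hfeas : ∀ a ∈ flowItems (List.range n) L G O Q D, a.req ≤ p a.1.2 - p a.1.1 := by
    rintro ⟨⟨i, j⟩, c⟩ ha
    obtain ⟨-, -, h3, h4⟩ := mem_flowItems.1 ha
    rw [hp]
    simp only
    rw [← Finset.sum_sub_distrib]
    have hnn : ∀ z ∈ Q.toFinset.filter (· ∈ S), (0 : ℤ) ≤
        (if side L G O z j = true then 1 else 0) - if side L G O z i = true then 1 else 0 := by
      intro z hz
      have := h3 z (by simpa using (Finset.mem_filter.1 hz).1)
      by_cases h5 : side L G O z i = true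
      · simp [h5, this h5]
      · rw [if_neg h5, sub_zero]
        split_ifs <;> simp
    cases c with
    | false => simpa [Item.req] using Finset.sum_nonneg hnn
    | true =>
      obtain ⟨T, hT', h5⟩ := h4 rfl
      obtain ⟨z, h6, h8⟩ := hS T hT'
      have h7 := hD T hT' z h6
      refine le_trans ?_ (Finset.single_le_sum hnn (a := z) (by simp [h7, h8]))
      simp [Item.req, h5 z h6]
  obtain ⟨π, h1, h2, h3⟩ := exists_optimal_potential (nodes := flowNodes (List.range n))
    nodup_flowItems (fun a ha => by
      obtain ⟨⟨i, j⟩, c⟩ := a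
      obtain ⟨h1, h2, -⟩ := mem_flowItems.1 ha
      exact ⟨mem_flowNodes.2 h1, mem_flowNodes.2 h2⟩) (itemWeight Q ω) hfeas
  have hpot : ∀ z ∈ Q, (potLT (gainTable (List.range n) L G O Q ω D) (z, false) (z, true) = true ↔
      π (z, false) < π (z, true)) := fun z hz =>
    h3 _ (mem_flowNodes.2 (hQ z hz)) _ (mem_flowNodes.2 (hQ z hz))
  have hitem : ∀ z ∈ Q, ((((z, false), (z, true)), false) : Item) ∈
      flowItems (List.range n) L G O Q D := by
    intro z hz
    refine mem_flowItems.2 ⟨hQ z hz, hQ z hz, fun z' _ h => ?_, by simp⟩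
    by_cases h' : z = z'
    · subst h'; rw [hself]
    · rwa [hside z z' true false h']
  -- only the items of the vertices contribute to the objective
  have hobj : ∀ q : Node → ℤ, ∑ a ∈ (flowItems (List.range n) L G O Q D).toFinset,
      (itemWeight Q ω a : ℤ) * (q a.1.2 - q a.1.1) =
      ∑ z ∈ Q.toFinset, (weight ω z : ℤ) * (q (z, true) - q (z, false)) := by
    intro q
    symm
    refine Finset.sum_of_injOn (fun z => (((z, false), (z, true)), false)) ?_ ?_ ?_ ?_
    · intro z _ z' _ h
      simpa using h
    · intro z hz
      simpa using hitem z (by simpa using hz)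
    · rintro ⟨⟨i, j⟩, c⟩ ha hni
      have : itemWeight Q ω ((i, j), c) = 0 := by
        unfold itemWeight
        cases hc : (!c && has Q i.1 && decide ((i, j) = ((i.1, false), (i.1, true)))) with
        | false => simp only [cond_false]
        | true =>
          simp only [Bool.and_eq_true, Bool.not_eq_true', has_iff, decide_eq_true_eq] at hc
          obtain ⟨⟨rfl, h4⟩, h5⟩ := hc
          refine absurd ⟨i.1, by simpa using h4, ?_⟩ hni
          rw [h5]
      rw [this]; simp
    · intro z hz
      have : itemWeight Q ω (((z, false), (z, true)), false) = weight ω z := by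
        have hz' : has Q z = true := has_iff.2 (by simpa using hz)
        simp [itemWeight, hz']
      rw [this]
  rw [hobj, hobj] at h2
  constructor
  · have h4 : ∑ z ∈ Q.toFinset, (weight ω z : ℤ) * (p (z, true) - p (z, false)) =
        ((∑ z ∈ Q.toFinset with z ∈ S, weight ω z : ℕ) : ℤ) := by
      rw [Finset.sum_filter]
      push_cast
      refine Finset.sum_congr rfl fun z hz => ?_
      have h5 : p (z, true) - p (z, false) = if z ∈ S then 1 else 0 := by
        rw [hp]
        simp only
        rw [← Finset.sum_sub_distrib, Finset.sum_filter]
        rw [Finset.sum_eq_single z]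
        · simp [hself]
        · intro z' _ hne
          rw [hside z z' true false (Ne.symm hne)]
          simp
        · exact fun h => absurd hz h
      rw [h5]
      split_ifs <;> simp
    rw [h4] at h2
    have h5 : ((∑ z ∈ Q.toFinset with
        potLT (gainTable (List.range n) L G O Q ω D) (z, false) (z, true) = true,
        weight ω z : ℕ) : ℤ) ≤
        ∑ z ∈ Q.toFinset, (weight ω z : ℤ) * (π (z, true) - π (z, false)) := by
      rw [Finset.sum_filter]
      push_cast
      refine Finset.sum_le_sum fun z hz => ?_
      have hz' : z ∈ Q := by simpa using hz
      have h6 : (0 : ℤ) ≤ π (z, true) - π (z, false) := h1 _ (hitem z hz')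
      have h7 : (0 : ℤ) ≤ weight ω z := Int.natCast_nonneg _
      split_ifs with h
      · have h8 := (hpot z hz').1 h
        nlinarith
      · positivity
    exact_mod_cast h5.trans h2
  · intro T hT' i j hi hj hf
    by_contra hno
    push Not at hno
    have hle : ∀ m : ℕ, ∀ i j : Node, i.1 < n → j.1 < n →
        (∀ z ∈ Q, side L G O z i = true → side L G O z j = true) →
        (∀ z ∈ Q, side L G O z i ≠ side L G O z j → π (z, true) ≤ π (z, false)) →
        (Q.toFinset.filter fun z => side L G O z i ≠ side L G O z j).card = m → π j ≤ π i := by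
      intro m
      induction m using Nat.strong_induction_on with
      | _ m ih =>
        intro i j hi hj hm hz hcard
        by_cases hex : ∃ z ∈ Q, side L G O z i ≠ side L G O z j
        · obtain ⟨z, hzQ, hne⟩ := hex
          have hi' : side L G O z i = false := by
            cases h : side L G O z i
            · rfl
            · rw [h, hm z hzQ h] at hne; exact absurd rfl hne
          have hj' : side L G O z j = true := by
            rw [hi'] at hne
            simpa using hne.symm
          have hconv : ∀ z' b, z ≠ z' → side L G O z' i = side L G O z' j →
              side L G O z' (z, b) = side L G O z' i := fun z' b h h' =>
            hT.side_convex (hQ z hzQ) h hne h' b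
          have hbetween : ∀ z' ∈ Q, z ≠ z' → side L G O z' i ≠ side L G O z' j →
              side L G O z' i = false ∧ side L G O z' j = true := by
            intro z' hz' h h'
            cases h4 : side L G O z' i
            · rw [h4] at h'
              exact ⟨rfl, by simpa using h'.symm⟩
            · rw [h4, hm z' hz' h4] at h'; exact absurd rfl h'
          have hsub1 : ∀ z' ∈ Q, side L G O z' i ≠ side L G O z' (z, false) → z ≠ z' ∧
              side L G O z' i ≠ side L G O z' j := by
            intro z' hz' h
            have h4 : z ≠ z' := by
              rintro rfl
              rw [hself, hi'] at h; exact h rfl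
            exact ⟨h4, fun h5 => h (hconv z' false h4 h5).symm⟩
          have hsub2 : ∀ z' ∈ Q, side L G O z' (z, true) ≠ side L G O z' j → z ≠ z' ∧
              side L G O z' i ≠ side L G O z' j := by
            intro z' hz' h
            have h4 : z ≠ z' := by
              rintro rfl
              rw [hself, hj'] at h; exact h rfl
            exact ⟨h4, fun h5 => h ((hconv z' true h4 h5).trans h5)⟩
          have hsm : ∀ P : ℕ → Prop, [DecidablePred P] → (∀ z' ∈ Q, P z' → z ≠ z' ∧
              side L G O z' i ≠ side L G O z' j) → (Q.toFinset.filter P).card < m := by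
            intro P _ hP
            rw [← hcard]
            refine Finset.card_lt_card ((Finset.ssubset_iff_of_subset fun z' hz' => ?_).2
              ⟨z, by simp [hzQ, hne], ?_⟩)
            · simp only [Finset.mem_filter, List.mem_toFinset] at hz' ⊢
              exact ⟨hz'.1, (hP z' hz'.1 hz'.2).2⟩
            · simp only [Finset.mem_filter, not_and]
              exact fun _ h => (hP z hzQ h).1 rfl
          have e1 := ih _ (hsm _ hsub1) i (z, false) hi (hQ z hzQ) (fun z' hz' h => by
            by_contra h4
            obtain ⟨h5, h6⟩ := hsub1 z' hz' (by rw [h]; exact fun h => h4 h.symm)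
            rw [(hbetween z' hz' h5 h6).1] at h
            exact Bool.false_ne_true h) (fun z' hz' h => hz z' hz' (hsub1 z' hz' h).2) rfl
          have e2 := ih _ (hsm _ hsub2) (z, true) j (hQ z hzQ) hj (fun z' hz' h => by
            by_contra h4
            obtain ⟨h5, h6⟩ := hsub2 z' hz' (by rw [h]; exact fun h => h4 h.symm)
            exact h4 (hbetween z' hz' h5 h6).2) (fun z' hz' h => hz z' hz' (hsub2 z' hz' h).2)
            rfl
          exact e2.trans ((hz z hzQ hne).trans e1)
        · push Not at hex
          have := h1 ((j, i), false) (mem_flowItems.2 ⟨hj, hi,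
            fun z hz h => by rw [hex z hz]; exact h, by simp⟩)
          simp only [Item.req, Bool.false_eq_true, if_false] at this
          omega
    have h4 := hle _ i j hi hj (fun z hz h => by
      by_cases hzT : z ∈ T
      · exact ((hf z hz).1 hzT).2
      · rw [← (hf z hz).2 hzT]; exact h) (fun z hz h => by
      have hzT : z ∈ T := by
        by_contra h5
        exact h ((hf z hz).2 h5)
      have := hno z hz hzT
      rw [ne_eq, hpot z hz] at this
      omega) rfl
    have hTQ : ∀ z ∈ T, side L G O z i = false ∧ side L G O z j = true :=
      fun z hz => (hf z (hD T hT' z hz)).1 hz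
    have h5 := h1 ((i, j), true) (mem_flowItems.2 ⟨hi, hj, fun z hz h => by
      by_cases hzT : z ∈ T
      · exact ((hf z hz).1 hzT).2
      · rw [← (hf z hz).2 hzT]; exact h, fun _ => ⟨T, hT', hTQ⟩⟩)
    simp only [Item.req, if_true] at h5
    omega

theorem mem_halves {K₁ : List ℕ} {h : Half} : h ∈ halves K₁ ↔ h.1 ∈ K₁ := by
  obtain ⟨k, b⟩ := h
  simp only [halves, List.pair_mem_product]
  cases b <;> simp

theorem map_fst_zip_append {α β : Type} (l l' : List α) (m : List β) (h : l.length = m.length) :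
    ((l ++ l').zip m).map Prod.fst = l := by
  induction l generalizing m with
  | nil =>
    obtain rfl : m = [] := List.length_eq_zero_iff.1 h.symm
    simp
  | cons a l ih =>
    rcases m with _ | ⟨b, m⟩
    · simp at h
    · simp [ih m (by simpa using h)]

theorem mem_alternatives {G P : List (ℕ × ℕ)} {K₁ Q : List ℕ} {c : Bound × Bound} :
    c ∈ alternatives (List.range n) L G P K₁ Q ↔
      (c.1.1.1 ∈ K₁ ∧ c.1.2 ≤ n) ∧ (c.2.1.1 ∈ K₁ ∧ c.2.2 ≤ n) ∧ ∃ p ∈ P, ∀ z ∈ Q,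
        (Crossed L p.1 p.2 z ↔ inBound (List.range n) L G c.1 z = true ∨
          inBound (List.range n) L G c.2 z = true) := by
  obtain ⟨⟨h, m⟩, ⟨h', m'⟩⟩ := c
  simp only [alternatives, List.mem_filter, List.pair_mem_product, mem_halves, List.length_cons,
    List.length_range, List.mem_range, Nat.lt_succ_iff, List.any_eq_true, List.all_eq_true, beq_iff_eq,
    and_assoc]
  refine and_congr_right fun _ => and_congr_right fun _ => and_congr_right fun _ =>
    and_congr_right fun _ => exists_congr fun p => and_congr_right fun _ => forall₂_congr fun z _ => ?_
  rw [Bool.eq_iff_iff, onPath_iff, Bool.or_eq_true]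

/-- For every solution there is a guess that leads to a solution of at most the same weight. -/
theorem TreeCuts.exists_candidate (hT : TreeCuts n E L K) (P ω : List (ℕ × ℕ))
    (hP : ∀ p ∈ P, p.1 < n ∧ p.2 < n) (Y : List ℕ)
    (hYP : ∀ p ∈ P, conn (List.range n) E Y p.1 p.2 = false) :
    ∃ X ∈ subs K, ∃ K₁ ∈ subs K, ∃ O ∈ subs K,
      ∃ w ∈ wordsOver (List.range (walkStates (halves K) ++ walkStates (halves K)).length)
        ((halves K).product (halves K)),
      let S := candidate (List.range n) E L (segments (List.range n) K L) P ω ((X, K₁), (O, w))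
      (∀ p ∈ P, conn (List.range n) E S p.1 p.2 = false) ∧
      (S.map (weight ω)).sum ≤ ∑ v ∈ Y.toFinset with v < n, weight ω v := by
  classical
  set V := List.range n with hV
  set G := segments V K L with hG
  -- the guess
  have hsub : ∀ p : ℕ → Prop, ∃ X ∈ subs K, ∀ k, k ∈ X ↔ k ∈ K ∧ p k := fun p =>
    ⟨K.reverse.filter fun k => decide (p k), mem_subs.2 List.filter_sublist, fun k => by simp⟩
  obtain ⟨X, hX, hXm⟩ := hsub (· ∈ Y)
  obtain ⟨K₁, hK₁, hK₁m⟩ := hsub fun k => ∃ z ∈ Y, InSegment L K k z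
  set Q := cutVertices V G K₁ with hQ
  have hQm : ∀ z, z ∈ Q ↔ ∃ k ∈ K₁, InSegment L K k z := fun z => hT.mem_cutVertices
  have hQlt : ∀ z ∈ Q, z < n := fun z hz => by
    obtain ⟨k, -, h⟩ := (hQm z).1 hz
    exact (hT.lt _ _ h.2.2.1).2
  have hQK : ∀ z ∈ Q, z ∉ K := fun z hz => by
    obtain ⟨k, -, h⟩ := (hQm z).1 hz
    exact h.2.1
  have hYQ : ∀ z ∈ Y, z < n → z ∉ K → z ∈ Q := by
    intro z hz hzn hzK
    obtain ⟨k, hk⟩ := hT.exists_segment hzn hzK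
    exact (hQm z).2 ⟨k, (hK₁m k).2 ⟨hk.1, z, hz, hk⟩, hk⟩
  set P' := unhit V E P X with hP'
  have hP'm : ∀ p, p ∈ P' ↔ p ∈ P ∧ conn V E X p.1 p.2 = true := fun p => by
    simp only [hP', unhit, List.mem_filter]
  have hhit : ∀ p ∈ P', ∃ z ∈ Y, z ∈ Q ∧ Crossed L p.1 p.2 z := by
    intro p hp
    obtain ⟨h1, h2⟩ := (hP'm p).1 hp
    obtain ⟨z, h3, h4, h5, h6⟩ := hT.hit X Y p.1 p.2 (hP p h1).1 (hP p h1).2 h2 (hYP p h1)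
      fun v hv hvK => (hXm v).2 ⟨hvK, hv⟩
    exact ⟨z, h3, hYQ z h3 h4 h5, h6⟩
  set C := alternatives V L G P' K₁ Q with hC
  -- the positions of the outermost members of the solution
  set x : Half → ℕ := fun h => sInf {m | ∃ z ∈ Y, InSegment L K h.1 z ∧ position V L h.2 z = m} with hx
  have hxle : ∀ h z, z ∈ Y → InSegment L K h.1 z → x h ≤ position V L h.2 z := fun h z h1 h2 =>
    Nat.sInf_le ⟨z, h1, h2, rfl⟩
  have hxmem : ∀ h : Half, h.1 ∈ K₁ → ∃ z ∈ Y, InSegment L K h.1 z ∧ position V L h.2 z = x h := by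
    intro h hh
    obtain ⟨-, z, h1, h2⟩ := (hK₁m _).1 hh
    exact Nat.sInf_mem (s := {m | ∃ z ∈ Y, InSegment L K h.1 z ∧ position V L h.2 z = m})
      ⟨_, z, h1, h2, rfl⟩
  have halt : Alternatives (halves K₁) C n x := by
    refine ⟨fun c hc => ?_, fun c hc => ?_, fun h hh => ?_, fun c hc => ?_⟩
    · obtain ⟨h1, h2, p, h3, h4⟩ := mem_alternatives.1 hc
      exact mem_alternatives.2 ⟨h2, h1, p, h3, fun z hz => (h4 z hz).trans or_comm⟩
    · obtain ⟨h1, h2, -⟩ := mem_alternatives.1 hc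
      exact ⟨mem_halves.2 h1.1, mem_halves.2 h2.1⟩
    · obtain ⟨z, -, -, h3⟩ := hxmem h (mem_halves.1 hh)
      rw [← h3]; exact position_le _ _ _ _
    · obtain ⟨-, -, p, h3, h4⟩ := mem_alternatives.1 hc
      obtain ⟨z, h5, h6, h7⟩ := hhit p h3
      rcases (h4 z h6).1 h7 with h8 | h8
      · obtain ⟨h9, h10⟩ := hT.inBound_iff.1 h8
        exact Or.inl ((hxle _ z h5 h9).trans h10)
      · obtain ⟨h9, h10⟩ := hT.inBound_iff.1 h8
        exact Or.inr ((hxle _ z h5 h9).trans h10)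
  obtain ⟨w₀, hw₀, hw₀A, hB1, hB2, col, hcol⟩ := halt.exists_branches
  obtain ⟨O, hO, hOm⟩ := hsub fun k => orient L K K₁ col k = true
  have hOhas : ∀ k ∈ K₁, has O k = orient L K K₁ col k := by
    intro k hk
    rw [Bool.eq_iff_iff, has_iff, hOm]
    exact ⟨fun h => h.2, fun h => ⟨((hK₁m k).1 hk).1, h⟩⟩
  have hlenK : K₁.length ≤ K.length := by
    simpa using (mem_subs.1 hK₁).length_le
  have hlen : ∀ K : List ℕ, (halves K).length = K.length * 2 := fun K => List.length_product _ _
  have hlen2 : ∀ H : List Half, (H.product H).length = H.length * H.length := fun H =>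
    List.length_product _ _
  have hlen3 : ∀ H : List Half, (walkStates H).length = H.length * (H.length * 2) := fun H =>
    (List.length_product _ _).trans (congrArg _ (List.length_product _ _))
  have hHle : (halves K₁).length ≤ (halves K).length := by rw [hlen, hlen]; omega
  set w := w₀ ++ List.replicate (((halves K).product (halves K)).length - w₀.length) 0 with hw
  have hwlen : w.length = ((halves K).product (halves K)).length := by
    have : w₀.length ≤ ((halves K).product (halves K)).length := by
      rw [hw₀, hlen2, hlen2]; exact Nat.mul_le_mul hHle hHle
    rw [hw, List.length_append, List.length_replicate]
    omega
  have hwmem : w ∈ wordsOver (List.range (walkStates (halves K) ++ walkStates (halves K)).length)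
      ((halves K).product (halves K)) := by
    refine mem_wordsOver.2 ⟨hwlen, fun a ha => ?_⟩
    have h1 : (walkStates (halves K₁)).length ≤ (walkStates (halves K)).length := by
      rw [hlen3, hlen3]; exact Nat.mul_le_mul hHle (Nat.mul_le_mul_right _ hHle)
    rw [List.mem_range, List.length_append]
    rcases List.mem_append.1 ha with ha | ha
    · have := hw₀A a ha
      omega
    · obtain ⟨h2, rfl⟩ := List.mem_replicate.1 ha
      rw [hlen2] at h2
      rw [hlen3]
      have : 0 < (halves K).length := by
        rcases Nat.eq_zero_or_pos (halves K).length with h | h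
        · rw [h] at h2; simp at h2
        · exact h
      positivity
  set B := chosenBounds V L G P' K₁ Q w with hB
  have hBeq : B = branches (halves K₁) C (List.range (n + 1)).reverse
      (List.range (2 * (walkStates (halves K₁)).length)) w₀ := by
    rw [hB, chosenBounds, hw, map_fst_zip_append _ _ _ hw₀, List.length_append, ← two_mul,
      List.length_cons, hV, List.length_range]
  simp only [← hBeq] at hB1 hB2 hcol
  set D := demands V L G P' Q B with hD
  have hDm : ∀ T, T ∈ D ↔ (∃ p ∈ P', Q.filter (fun z => onPath L p z) = T) ∨
      ∃ b ∈ B, Q.filter (fun z => inBound V L G b z) = T := fun T => by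
    simp only [hD, demands, List.mem_append, List.mem_map]
  obtain ⟨hweight, hmeet⟩ := hT.selection_spec (G := G) (ω := ω) (O := O) hQlt (D := D)
    (fun T hT' z hz => by
      rcases (hDm T).1 hT' with ⟨p, -, rfl⟩ | ⟨b, -, rfl⟩ <;> exact (List.mem_filter.1 hz).1)
    Y.toFinset (fun T hT' => by
      rcases (hDm T).1 hT' with ⟨p, hp, rfl⟩ | ⟨b, hb, rfl⟩
      · obtain ⟨z, h1, h2, h3⟩ := hhit p hp
        exact ⟨z, List.mem_filter.2 ⟨h2, onPath_iff.2 h3⟩, List.mem_toFinset.2 h1⟩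
      · obtain ⟨h1, h2, -⟩ := hB1 b hb
        obtain ⟨z, h3, h4, h5⟩ := hxmem b.1 (mem_halves.1 h1)
        exact ⟨z, List.mem_filter.2 ⟨(hQm z).2 ⟨_, mem_halves.1 h1, h4⟩,
          hT.inBound_iff.2 ⟨h4, h5.trans_le h2⟩⟩, List.mem_toFinset.2 h3⟩)
  set R := gainTable V L G O Q ω D with hR
  have hS : candidate V E L G P ω ((X, K₁), (O, w)) = selection V Q X R := rfl
  have hSm : ∀ z, z ∈ selection V Q X R ↔ z < n ∧
      (z ∈ X ∨ (z ∈ Q ∧ potLT R (z, false) (z, true) = true)) := fun z => by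
    simp only [selection, List.mem_filter, hV, List.mem_range, Bool.or_eq_true, Bool.and_eq_true,
      has_iff]
  have hXK : ∀ k ∈ X, k < n := fun k hk => hT.key_lt k ((hXm k).1 hk).1
  refine ⟨X, hX, K₁, hK₁, O, hO, w, hwmem, ?_⟩
  rw [hS]
  constructor
  · intro p hp
    cases hpX : conn V E X p.1 p.2 with
    | false => exact hT.mono X _ _ _ hpX fun v hv => (hSm v).2 ⟨hXK v hv, Or.inl hv⟩
    | true =>
      have hpP : p ∈ P' := (hP'm p).2 ⟨hp, hpX⟩
      suffices h : ∃ z ∈ Q, Crossed L p.1 p.2 z ∧ potLT R (z, false) (z, true) = true by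
        obtain ⟨z, h1, h2, h3⟩ := h
        exact hT.cut _ z _ _ (hQK z h1) h2 ((hSm z).2 ⟨hQlt z h1, Or.inr ⟨h1, h3⟩⟩)
      by_cases hcase : ∃ b ∈ B, ∀ z ∈ Q, inBound V L G b z = true → Crossed L p.1 p.2 z
      · -- the path contains all vertices of some bound
        obtain ⟨b, hb, hbp⟩ := hcase
        obtain ⟨h1, h2, -⟩ := hB1 b hb
        obtain ⟨y, h3, h4, h5⟩ := hxmem b.1 (mem_halves.1 h1)
        obtain ⟨i, j, hi, hj, hf⟩ := hT.exists_forward_bound (K₁ := K₁) (O := O) (b := b) (y := y)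
          (hT.inBound_iff.2 ⟨h4, h5.trans_le h2⟩)
        obtain ⟨z, h6, h7, h8⟩ := hmeet _ ((hDm _).2 (Or.inr ⟨b, hb, rfl⟩)) i j hi hj
          (fun z hz => ⟨fun h => (hf z ((hQm z).1 hz)).1 (List.mem_filter.1 h).2,
            fun h => (hf z ((hQm z).1 hz)).2 fun h' => h (List.mem_filter.2 ⟨hz, h'⟩)⟩)
        exact ⟨z, h6, hbp z h6 (List.mem_filter.1 h7).2, h8⟩
      · -- the path crosses all chosen segments in the same direction
        push Not at hcase
        obtain ⟨i, j, hi, hj, hf⟩ := hT.exists_monotone (K₁ := K₁) (O := O) (col := col) (s := p.1)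
          (t := p.2) hOhas (fun k hk => by
            obtain ⟨z, -, h1, h2⟩ := hcase _ (hB2 (k, true) (mem_halves.2 hk))
            exact ⟨z, (hT.inBound_iff.1 h1).1, h2⟩)
          (fun f hf g hg d d' m m' hm hm' hiff => by
            refine hcol _ _ (isEdge_iff.2 ⟨(((f, d), m), ((g, d'), m')), mem_alternatives.2
              ⟨⟨hf, hm⟩, ⟨hg, hm'⟩, p, hpP, fun z hz => hiff z ((hQm z).1 hz)⟩, rfl, rfl, ?_, ?_⟩)
            · by_contra himp
              simp only [implied, Bool.not_eq_false, List.any_eq_true, Bool.and_eq_true,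
                decide_eq_true_eq] at himp
              obtain ⟨b, hb, h1, h2⟩ := himp
              obtain ⟨z, h3, h4, h5⟩ := hcase b hb
              obtain ⟨h6, h7⟩ := hT.inBound_iff.1 h4
              refine h5 ((hiff z ((hQm z).1 h3)).2 (Or.inl (hT.inBound_iff.2 ?_)))
              rw [h1] at h6 h7
              exact ⟨h6, h7.trans h2⟩
            · by_contra himp
              simp only [implied, Bool.not_eq_false, List.any_eq_true, Bool.and_eq_true,
                decide_eq_true_eq] at himp
              obtain ⟨b, hb, h1, h2⟩ := himp
              obtain ⟨z, h3, h4, h5⟩ := hcase b hb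
              obtain ⟨h6, h7⟩ := hT.inBound_iff.1 h4
              refine h5 ((hiff z ((hQm z).1 h3)).2 (Or.inr (hT.inBound_iff.2 ?_)))
              rw [h1] at h6 h7
              exact ⟨h6, h7.trans h2⟩)
        have hlt := hP p hp
        obtain ⟨z, h6, h7, h8⟩ := hmeet _ ((hDm _).2 (Or.inl ⟨p, hpP, rfl⟩)) i j
          (by rcases hi with h | h <;> rw [h]; exacts [hlt.1, hlt.2])
          (by rcases hj with h | h <;> rw [h]; exacts [hlt.1, hlt.2])
          (fun z hz => ⟨fun h => (hf z ((hQm z).1 hz)).1 (onPath_iff.1 (List.mem_filter.1 h).2),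
            fun h => (hf z ((hQm z).1 hz)).2 fun h' => h (List.mem_filter.2 ⟨hz, onPath_iff.2 h'⟩)⟩)
        exact ⟨z, h6, onPath_iff.1 (List.mem_filter.1 h7).2, h8⟩
  · have hnd : (selection V Q X R).Nodup := List.nodup_range.filter _
    rw [← List.sum_toFinset _ hnd]
    have h1 : (selection V Q X R).toFinset ⊆ X.toFinset ∪
        (Q.toFinset.filter fun z => potLT R (z, false) (z, true) = true) := by
      intro z hz
      obtain ⟨-, h | ⟨h, h'⟩⟩ := (hSm z).1 (List.mem_toFinset.1 hz)
      · exact Finset.mem_union_left _ (List.mem_toFinset.2 h)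
      · exact Finset.mem_union_right _ (Finset.mem_filter.2 ⟨List.mem_toFinset.2 h, h'⟩)
    have hdis : Disjoint X.toFinset (Q.toFinset.filter fun z => z ∈ Y.toFinset) := by
      rw [Finset.disjoint_left]
      intro z hz hz'
      exact hQK z (List.mem_toFinset.1 (Finset.mem_filter.1 hz').1)
        ((hXm z).1 (List.mem_toFinset.1 hz)).1
    refine (Finset.sum_le_sum_of_subset h1).trans
      ((Nat.le_add_right _ _).trans (Finset.sum_union_inter.le.trans ?_))
    refine (Nat.add_le_add_left hweight _).trans ?_
    rw [← Finset.sum_union hdis]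
    refine Finset.sum_le_sum_of_subset fun z hz => ?_
    rcases Finset.mem_union.1 hz with h | h
    · have h := List.mem_toFinset.1 h
      exact Finset.mem_filter.2 ⟨List.mem_toFinset.2 ((hXm z).1 h).2, hXK z h⟩
    · obtain ⟨h2, h3⟩ := Finset.mem_filter.1 h
      exact Finset.mem_filter.2 ⟨h3, hQlt z (List.mem_toFinset.1 h2)⟩

end complete

/-! ### Paths in trees -/

section paths
variable {V : Type*} {T : SimpleGraph V} (hT : T.IsTree)

/-- The path between two vertices of a tree. -/
noncomputable def treePath (u v : V) : T.Walk u v := (hT.existsUnique_path u v).choose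

theorem treePath_isPath (u v : V) : (treePath hT u v).IsPath :=
  (hT.existsUnique_path u v).choose_spec.1

theorem eq_treePath {u v : V} {q : T.Walk u v} (hq : q.IsPath) : q = treePath hT u v :=
  (hT.existsUnique_path u v).choose_spec.2 q hq

theorem mem_of_mem_treePath {u v x : V} (hx : x ∈ (treePath hT u v).support) (q : T.Walk u v) :
    x ∈ q.support := by
  classical
  rw [← eq_treePath hT q.bypass_isPath] at hx
  exact q.support_bypass_subset_support hx

theorem treePath_append {u v x : V} (hx : x ∈ (treePath hT u v).support) :
    (treePath hT u x).append (treePath hT x v) = treePath hT u v := by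
  classical
  have h1 := eq_treePath hT ((treePath_isPath hT u v).takeUntil hx)
  have h2 := eq_treePath hT ((treePath_isPath hT u v).dropUntil hx)
  rw [← h1, ← h2]
  exact (treePath hT u v).take_spec hx

theorem mem_treePath_start (u v : V) : u ∈ (treePath hT u v).support := SimpleGraph.Walk.start_mem_support _

theorem mem_treePath_end (u v : V) : v ∈ (treePath hT u v).support := SimpleGraph.Walk.end_mem_support _

variable {r u v w x y z : V}

theorem mem_treePath_trans (h1 : v ∈ (treePath hT u r).support) (h2 : w ∈ (treePath hT v r).support) :
    w ∈ (treePath hT u r).support := by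
  rw [← treePath_append hT h1, SimpleGraph.Walk.mem_support_append_iff]
  exact Or.inr h2

theorem mem_treePath_left (h1 : v ∈ (treePath hT u r).support) (h2 : x ∈ (treePath hT u v).support) :
    x ∈ (treePath hT u r).support := by
  rw [← treePath_append hT h1, SimpleGraph.Walk.mem_support_append_iff]
  exact Or.inl h2

theorem length_treePath (h : v ∈ (treePath hT u r).support) : (treePath hT u r).length =
    (treePath hT u v).length + (treePath hT v r).length := by
  rw [← treePath_append hT h, SimpleGraph.Walk.length_append]

theorem mem_treePath_antisymm (h1 : v ∈ (treePath hT u r).support)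
    (h2 : u ∈ (treePath hT v r).support) : u = v := by
  have h3 := length_treePath hT h1
  have h4 := length_treePath hT h2
  exact SimpleGraph.Walk.eq_of_length_eq_zero (p := treePath hT u v) (by omega)

theorem mem_treePath_right (h1 : v ∈ (treePath hT u r).support)
    (h2 : x ∈ (treePath hT u v).support) : v ∈ (treePath hT x r).support := by
  have h3 := treePath_append hT h1
  rw [← treePath_append hT h2, ← SimpleGraph.Walk.append_assoc] at h3
  have h4 : ((treePath hT x v).append (treePath hT v r)).IsPath :=
    SimpleGraph.Walk.IsPath.of_append_right (h3 ▸ treePath_isPath hT u r)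
  rw [← eq_treePath hT h4, SimpleGraph.Walk.mem_support_append_iff]
  exact Or.inl (mem_treePath_end hT _ _)

theorem mem_treePath_chain (h1 : v ∈ (treePath hT u r).support)
    (h2 : w ∈ (treePath hT u r).support) :
    w ∈ (treePath hT v r).support ∨ v ∈ (treePath hT w r).support := by
  rw [← treePath_append hT h1, SimpleGraph.Walk.mem_support_append_iff] at h2
  rcases h2 with h2 | h2
  exacts [Or.inr (mem_treePath_right hT h1 h2), Or.inl h2]

theorem treePath_not_nil (h : u ≠ v) : ¬ (treePath hT u v).Nil := fun h' => h h'.eq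

/-- The parent of a vertex other than the root. -/
theorem exists_parent (h : y ≠ r) : T.Adj y (treePath hT y r).snd ∧
    (treePath hT y r).snd ∈ (treePath hT y r).support :=
  ⟨SimpleGraph.Walk.adj_snd (treePath_not_nil hT h), SimpleGraph.Walk.getVert_mem_support _ _⟩

/-- The child of `y` on the path from `u`. -/
theorem exists_child (h : y ∈ (treePath hT u r).support) (hne : u ≠ y) : ∃ a, T.Adj a y ∧
    a ∈ (treePath hT u r).support ∧ y ∈ (treePath hT a r).support := by
  have h1 : (treePath hT u y).penultimate ∈ (treePath hT u y).support :=
    SimpleGraph.Walk.getVert_mem_support _ _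
  exact ⟨_, SimpleGraph.Walk.adj_penultimate (treePath_not_nil hT hne), mem_treePath_left hT h h1,
    mem_treePath_right hT h h1⟩

/-- A neighbour other than the parent is a child. -/
theorem mem_treePath_of_adj {a : V} (ha : T.Adj y a) (hne : a ≠ (treePath hT y r).snd) :
    y ∈ (treePath hT a r).support := by
  by_cases h : a ∈ (treePath hT y r).support
  · exfalso
    have h1 : (SimpleGraph.Walk.cons ha SimpleGraph.Walk.nil).IsPath := by
      simp [SimpleGraph.Walk.cons_isPath_iff, ha.ne]
    rw [← treePath_append hT h, ← eq_treePath hT h1] at hne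
    simp at hne
  · have h1 : (SimpleGraph.Walk.cons ha.symm (treePath hT y r)).IsPath :=
      (SimpleGraph.Walk.cons_isPath_iff _ _).2 ⟨treePath_isPath hT y r, h⟩
    rw [← eq_treePath hT h1]
    simp

variable [Fintype V]

/-- The lowest common ancestor. -/
theorem exists_join (r u w : V) : ∃ y, y ∈ (treePath hT u r).support ∧
    y ∈ (treePath hT w r).support ∧ ∀ z, z ∈ (treePath hT u r).support →
      z ∈ (treePath hT w r).support → z ∈ (treePath hT y r).support := by
  classical
  obtain ⟨y, hy, hmax⟩ := Finset.exists_max_image (Finset.univ.filter fun y : V =>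
    y ∈ (treePath hT u r).support ∧ y ∈ (treePath hT w r).support)
    (fun y => (treePath hT y r).length) ⟨r, by simp⟩
  simp only [Finset.mem_filter, Finset.mem_univ, true_and] at hy hmax
  refine ⟨y, hy.1, hy.2, fun z h1 h2 => ?_⟩
  rcases mem_treePath_chain hT hy.1 h1 with h | h
  · exact h
  · have h3 := length_treePath hT h
    have h4 := hmax z ⟨h1, h2⟩
    rw [SimpleGraph.Walk.eq_of_length_eq_zero (p := treePath hT z y) (by omega)]
    exact mem_treePath_start hT _ _

/-- A lowest common ancestor of two vertices, neither of which lies on the path from the other to the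
root, has at least three neighbours or is the root. -/
theorem degree_join [DecidableRel T.Adj] (h1 : y ∈ (treePath hT u r).support)
    (h2 : y ∈ (treePath hT w r).support)
    (h3 : ∀ z, z ∈ (treePath hT u r).support → z ∈ (treePath hT w r).support →
      z ∈ (treePath hT y r).support) (hu : u ≠ y) (hw : w ≠ y) (hr : y ≠ r) : 2 < T.degree y := by
  classical
  obtain ⟨a, a1, a2, a3⟩ := exists_child hT h1 hu
  obtain ⟨b, b1, b2, b3⟩ := exists_child hT h2 hw
  obtain ⟨c1, c2⟩ := exists_parent hT hr
  have hab : a ≠ b := by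
    rintro rfl
    exact a1.ne (mem_treePath_antisymm hT a3 (h3 a a2 b2))
  have hac : a ≠ (treePath hT y r).snd := fun h =>
    a1.ne (mem_treePath_antisymm hT a3 (h ▸ c2))
  have hbc : b ≠ (treePath hT y r).snd := fun h =>
    b1.ne (mem_treePath_antisymm hT b3 (h ▸ c2))
  rw [← SimpleGraph.card_neighborFinset_eq_degree]
  refine lt_of_lt_of_le (b := ({a, b, (treePath hT y r).snd} : Finset V).card) ?_
    (Finset.card_le_card ?_)
  · rw [Finset.card_eq_three.2 ⟨a, b, _, hab, hac, hbc, rfl⟩]; norm_num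
  · intro v hv
    simp only [Finset.mem_insert, Finset.mem_singleton] at hv
    rw [SimpleGraph.mem_neighborFinset]
    rcases hv with rfl | rfl | rfl
    exacts [a1.symm, b1.symm, c1]

/-- Below each vertex there is one whose degree is not two, if the root is such a vertex. -/
theorem exists_key_below [DecidableRel T.Adj] (hr : T.degree r ≠ 2) (z : V) :
    ∃ k, T.degree k ≠ 2 ∧ z ∈ (treePath hT k r).support := by
  classical
  obtain ⟨k, hk, hmax⟩ := Finset.exists_max_image (Finset.univ.filter fun y : V =>
    z ∈ (treePath hT y r).support) (fun y => (treePath hT y r).length) ⟨z, by simp⟩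
  simp only [Finset.mem_filter, Finset.mem_univ, true_and] at hk hmax
  refine ⟨k, fun hdeg => ?_, hk⟩
  have hkr : k ≠ r := by rintro rfl; exact hr hdeg
  obtain ⟨c1, c2⟩ := exists_parent hT hkr
  obtain ⟨a, ha, hne⟩ : ∃ a ∈ T.neighborFinset k, a ≠ (treePath hT k r).snd := by
    refine Finset.exists_mem_ne ?_ _
    rw [SimpleGraph.card_neighborFinset_eq_degree, hdeg]; norm_num
  rw [SimpleGraph.mem_neighborFinset] at ha
  have h1 := mem_treePath_of_adj hT ha hne
  have h2 := hmax a (mem_treePath_trans hT h1 hk)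
  have h3 := length_treePath hT h1
  exact ha.ne' (SimpleGraph.Walk.eq_of_length_eq_zero (p := treePath hT a k) (by omega))

/-- A vertex of degree two lies on the path between `s` and `t` only if it is an end or separates
exactly one of them from the root. -/
theorem crossed_of_mem_treePath [DecidableRel T.Adj] {s t : V} (hr : T.degree r ≠ 2)
    (hy : y ∈ (treePath hT s t).support) (hdeg : T.degree y = 2) : y = s ∨ y = t ∨
      (y ∈ (treePath hT s r).support ∧ y ∉ (treePath hT t r).support) ∨
      (y ∉ (treePath hT s r).support ∧ y ∈ (treePath hT t r).support) := by
  by_contra hc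
  push Not at hc
  obtain ⟨hs, ht, h1, h2⟩ := hc
  by_cases hys : y ∈ (treePath hT s r).support
  · have hyt := h1 hys
    obtain ⟨j, j1, j2, j3⟩ := exists_join hT r s t
    have hjy := j3 y hys hyt
    by_cases hj : j = y
    · subst hj
      have := degree_join hT j1 j2 j3 hs.symm ht.symm (by rintro rfl; exact hr hdeg)
      omega
    · have h3 : ∀ {s}, j ∈ (treePath hT s r).support → y ∉ (treePath hT s j).support :=
        fun h4 h5 => hj (mem_treePath_antisymm hT hjy (mem_treePath_right hT h4 h5))
      have := mem_of_mem_treePath hT hy ((treePath hT s j).append (treePath hT t j).reverse)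
      rw [SimpleGraph.Walk.mem_support_append_iff, SimpleGraph.Walk.support_reverse,
        List.mem_reverse] at this
      exact this.elim (h3 j1) (h3 j2)
  · have hyt := h2 hys
    have := mem_of_mem_treePath hT hy ((treePath hT s r).append (treePath hT t r).reverse)
    rw [SimpleGraph.Walk.mem_support_append_iff, SimpleGraph.Walk.support_reverse,
      List.mem_reverse] at this
    exact this.elim hys hyt

include hT

/-- There are at most `2 ℓ + 1` vertices whose degree is not two, where `ℓ` is the number of
leaves. -/
theorem card_keys_le [DecidableRel T.Adj] : (Finset.univ.filter fun v => T.degree v ≠ 2).card ≤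
    2 * (Finset.univ.filter fun v => T.degree v = 1).card + 1 := by
  classical
  have h1 := T.sum_degrees_eq_twice_card_edges
  have h2 := hT.card_edgeFinset
  have h0 : (Finset.univ.filter fun v => T.degree v = 0).card ≤ 1 := by
    refine Finset.card_le_one.2 fun a ha b _ => ?_
    by_contra hab
    have hd := (Finset.mem_filter.1 ha).2
    have h3 := SimpleGraph.Walk.adj_snd (treePath_not_nil hT hab)
    have : 0 < T.degree a := (T.degree_pos_iff_exists_adj a).2 ⟨_, h3⟩
    omega
  have h3 : ∑ v : V, ((if T.degree v ≠ 2 then 1 else 0) + 2) ≤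
      ∑ v : V, (T.degree v + 2 * (if T.degree v = 1 then 1 else 0) +
        3 * (if T.degree v = 0 then 1 else 0)) := by
    refine Finset.sum_le_sum fun v _ => ?_
    split_ifs <;> omega
  simp only [Finset.sum_add_distrib, ← Finset.mul_sum, ← Finset.card_filter, Finset.sum_const,
    Finset.card_univ, smul_eq_mul, h1] at h3
  omega

theorem exists_key [DecidableRel T.Adj] : ∃ v, T.degree v ≠ 2 := by
  classical
  by_contra hc
  push Not at hc
  have h1 := T.sum_degrees_eq_twice_card_edges
  have h2 := hT.card_edgeFinset
  simp only [hc, Finset.sum_const, Finset.card_univ, smul_eq_mul] at h1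
  omega

end paths

/-! ### The tables of a tree -/

section tables
variable {n : ℕ} {T : SimpleGraph (Fin n)} {E : List (ℕ × ℕ)}

/-- The list `E` describes the graph `T`. -/
def Describes (E : List (ℕ × ℕ)) (T : SimpleGraph (Fin n)) : Prop :=
  ∀ u v : ℕ, adj E u v = true ↔ ∃ (hu : u < n) (hv : v < n), T.Adj ⟨u, hu⟩ ⟨v, hv⟩

variable (hE : Describes E T)
include hE

theorem exists_walk_of_steps {X w : List ℕ} {u v : ℕ} (hu : u < n) (hX : u ∉ X)
    (h : Steps ((List.range n).filter fun v => !has X v) (adj E) u w v) :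
    ∃ (hv : v < n) (q : T.Walk ⟨u, hu⟩ ⟨v, hv⟩), ∀ x ∈ q.support, (x : ℕ) ∉ X := by
  induction w generalizing u with
  | nil => cases h; exact ⟨hu, .nil, by simpa using hX⟩
  | cons y w ih =>
    obtain ⟨h1, h2, h3⟩ := h
    simp only [List.mem_filter, List.mem_range, has_eq, Bool.not_eq_true', decide_eq_false_iff_not]
      at h2
    obtain ⟨hv, q, hq⟩ := ih h2.1 h2.2 h3
    obtain ⟨_, _, h4⟩ := (hE _ _).1 h1
    refine ⟨hv, .cons h4 q, fun x hx => ?_⟩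
    rw [SimpleGraph.Walk.support_cons, List.mem_cons] at hx
    rcases hx with rfl | hx
    exacts [hX, hq x hx]

theorem steps_of_walk {X : List ℕ} {s t : Fin n} (q : T.Walk s t)
    (hq : ∀ x ∈ q.support, (x : ℕ) ∉ X) :
    ∃ w, Steps ((List.range n).filter fun v => !has X v) (adj E) s w t := by
  induction q with
  | nil => exact ⟨[], rfl⟩
  | @cons u v _ h q ih =>
    obtain ⟨w, hw⟩ := ih fun x hx => hq x (by simp [hx])
    refine ⟨v :: w, (hE _ _).2 ⟨u.2, v.2, h⟩, ?_, hw⟩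
    have := hq v (by simp)
    simpa [has_eq] using this

theorem conn_iff {X : List ℕ} {s t : ℕ} : conn (List.range n) E X s t = true ↔
    ∃ (hs : s < n) (ht : t < n) (q : T.Walk ⟨s, hs⟩ ⟨t, ht⟩), ∀ x ∈ q.support, (x : ℕ) ∉ X := by
  rw [conn, has_iff, mem_reachable]
  constructor
  · rintro ⟨u, w, hu, hi, h⟩
    obtain rfl := decide_eq_true_iff.1 hi
    simp only [List.mem_filter, List.mem_range, has_eq, Bool.not_eq_true', decide_eq_false_iff_not]
      at hu
    obtain ⟨ht, q, hq⟩ := exists_walk_of_steps hE hu.1 hu.2 h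
    exact ⟨hu.1, ht, q, hq⟩
  · rintro ⟨hs, ht, q, hq⟩
    obtain ⟨w, hw⟩ := steps_of_walk hE q hq
    refine ⟨s, w, ?_, by simp, hw⟩
    have := hq _ q.start_mem_support
    simpa [has_eq, hs] using this

theorem conn_eq_false_iff (hT : T.IsTree) {X : List ℕ} (s t : Fin n) :
    conn (List.range n) E X s t = false ↔ ∃ x ∈ (treePath hT s t).support, (x : ℕ) ∈ X := by
  rw [← Bool.not_eq_true, conn_iff hE]
  constructor
  · intro h
    by_contra hc
    push Not at hc
    exact h ⟨s.2, t.2, treePath hT s t, hc⟩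
  · rintro ⟨x, hx, hX⟩ ⟨_, _, q, hq⟩
    exact hq x (mem_of_mem_treePath hT hx q) hX

theorem mem_ancestors (hT : T.IsTree) (r : Fin n) {u z : ℕ} :
    (u, z) ∈ ancestors (List.range n) E r ↔
      ∃ (hu : u < n) (hz : z < n), ⟨z, hz⟩ ∈ (treePath hT ⟨u, hu⟩ r).support := by
  simp only [ancestors, List.mem_filter, List.pair_mem_product, List.mem_range, Bool.or_eq_true,
    decide_eq_true_eq, Bool.not_eq_true']
  constructor
  · rintro ⟨⟨hu, hz⟩, rfl | h⟩
    · exact ⟨hu, hu, mem_treePath_start hT _ _⟩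
    · obtain ⟨x, hx, hxz⟩ := (conn_eq_false_iff hE hT ⟨u, hu⟩ r).1 h
      rw [List.mem_singleton] at hxz
      subst hxz
      exact ⟨hu, hz, hx⟩
  · rintro ⟨hu, hz, h⟩
    exact ⟨⟨hu, hz⟩, Or.inr ((conn_eq_false_iff hE hT ⟨u, hu⟩ r).2 ⟨_, h, by simp⟩)⟩

omit hE in
theorem length_filter_range_fin (p : ℕ → Bool) (q : Fin n → Prop) [DecidablePred q]
    (h : ∀ i : Fin n, p i = true ↔ q i) :
    ((List.range n).filter p).length = (Finset.univ.filter q).card := by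
  rw [length_filter_range, ← Finset.card_map Fin.valEmbedding]
  congr 1
  ext i
  simp only [Finset.mem_filter, Finset.mem_range, Finset.mem_map, Finset.mem_univ, true_and,
    Fin.valEmbedding_apply]
  constructor
  · rintro ⟨hi, hp⟩
    exact ⟨⟨i, hi⟩, (h ⟨i, hi⟩).1 hp, rfl⟩
  · rintro ⟨j, hj, rfl⟩
    exact ⟨j.2, (h j).2 hj⟩

variable [DecidableRel T.Adj]

theorem length_neighbours (v : Fin n) :
    ((List.range n).filter (adj E v)).length = T.degree v := by
  rw [length_filter_range_fin _ (fun w => T.Adj v w), ← SimpleGraph.card_neighborFinset_eq_degree,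
    SimpleGraph.neighborFinset_eq_filter]
  intro i
  rw [hE]
  exact ⟨fun ⟨_, _, h⟩ => h, fun h => ⟨v.2, i.2, h⟩⟩

theorem mem_keys {k : ℕ} : k ∈ keys (List.range n) E ↔ ∃ h : k < n, T.degree ⟨k, h⟩ ≠ 2 := by
  simp only [keys, List.mem_filter, List.mem_range, Bool.not_eq_true', decide_eq_false_iff_not]
  constructor
  · rintro ⟨h, h1⟩
    exact ⟨h, by rwa [← length_neighbours hE]⟩
  · rintro ⟨h, h1⟩
    exact ⟨h, by rwa [← length_neighbours hE] at h1⟩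

theorem length_keys : (keys (List.range n) E).length =
    (Finset.univ.filter fun v => T.degree v ≠ 2).card :=
  length_filter_range_fin _ _ fun i => by
    rw [length_neighbours hE i, Bool.not_eq_true', decide_eq_false_iff_not]

/-- If the root is a key, the tables have the properties on which the algorithm relies. -/
theorem treeCuts (hT : T.IsTree) {r : Fin n} (hr : T.degree r ≠ 2) :
    TreeCuts n E (ancestors (List.range n) E r) (keys (List.range n) E) := by
  have hL := @mem_ancestors n T E hE hT r
  have hKn : ∀ y : Fin n, (y : ℕ) ∉ keys (List.range n) E → T.degree y = 2 := fun y h => by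
    by_contra hc
    exact h ((mem_keys hE).2 ⟨y.2, hc⟩)
  refine
    { refl := fun v hv => hL.2 ⟨hv, hv, mem_treePath_start hT _ _⟩
      lt := fun u v h => ?_
      trans := fun u v w h1 h2 => ?_
      antisymm := fun u v h1 h2 => ?_
      chain := fun u v w h1 h2 => ?_
      join := fun u hu w hw => ?_
      bot := fun z hz => ?_
      key_lt := fun k hk => ((mem_keys hE).1 hk).1
      cut := fun X z s t _ hc hX => ?_
      hit := fun X Y s t hs ht hX hY hXY => ?_
      mono := fun X Y s t hX hXY => ?_ }
  · obtain ⟨hu, hv, -⟩ := hL.1 h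
    exact ⟨hu, hv⟩
  · obtain ⟨hu, hv, h1⟩ := hL.1 h1
    obtain ⟨_, hw, h2⟩ := hL.1 h2
    exact hL.2 ⟨hu, hw, mem_treePath_trans hT h1 h2⟩
  · obtain ⟨hu, hv, h1⟩ := hL.1 h1
    obtain ⟨_, _, h2⟩ := hL.1 h2
    exact congrArg Fin.val (mem_treePath_antisymm hT h1 h2)
  · obtain ⟨hu, hv, h1⟩ := hL.1 h1
    obtain ⟨_, hw, h2⟩ := hL.1 h2
    exact (mem_treePath_chain hT h1 h2).imp (fun h => hL.2 ⟨_, _, h⟩) fun h => hL.2 ⟨_, _, h⟩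
  · obtain ⟨y, h1, h2, h3⟩ := exists_join hT r ⟨u, hu⟩ ⟨w, hw⟩
    refine ⟨y, hL.2 ⟨_, y.2, h1⟩, hL.2 ⟨_, y.2, h2⟩, fun z hz hz' => ?_, ?_⟩
    · obtain ⟨_, _, hz⟩ := hL.1 hz
      obtain ⟨_, _, hz'⟩ := hL.1 hz'
      exact hL.2 ⟨_, _, h3 _ hz hz'⟩
    · by_contra hc
      push Not at hc
      have hd := hKn y hc.2.2
      have := degree_join hT h1 h2 h3 (fun h => hc.1 (by rw [← h]))
        (fun h => hc.2.1 (by rw [← h])) (by rintro rfl; exact hr hd)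
      omega
  · obtain ⟨k, h1, h2⟩ := exists_key_below hT hr ⟨z, hz⟩
    exact ⟨k, (mem_keys hE).2 ⟨k.2, h1⟩, hL.2 ⟨_, _, h2⟩⟩
  · rw [← Bool.not_eq_true, conn_iff hE]
    rintro ⟨hs, ht, q, hq⟩
    -- a walk that avoids `z` extends to a walk to the root
    have key : ∀ {s t : Fin n} (q : T.Walk s t), (∀ x ∈ q.support, (x : ℕ) ∉ X) →
        ((s : ℕ), z) ∈ ancestors (List.range n) E r →
        ((t : ℕ), z) ∈ ancestors (List.range n) E r := by
      intro s t q hq h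
      obtain ⟨_, hz, h⟩ := hL.1 h
      have := mem_of_mem_treePath hT h (q.append (treePath hT t r))
      rw [SimpleGraph.Walk.mem_support_append_iff] at this
      exact hL.2 ⟨t.2, hz, this.resolve_left fun h' => hq _ h' hX⟩
    rcases hc with rfl | rfl | ⟨h1, h2⟩ | ⟨h1, h2⟩
    · exact hq _ q.start_mem_support hX
    · exact hq _ q.end_mem_support hX
    · exact h2 (key q hq h1)
    · exact h1 (key q.reverse (by simpa using hq) h2)
  · obtain ⟨y, hy, hyY⟩ := (conn_eq_false_iff hE hT ⟨s, hs⟩ ⟨t, ht⟩).1 hY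
    have hyX : (y : ℕ) ∉ X := fun h => by
      have := (conn_eq_false_iff hE hT ⟨s, hs⟩ ⟨t, ht⟩).2 ⟨y, hy, h⟩
      rw [hX] at this
      cases this
    have hyK : (y : ℕ) ∉ keys (List.range n) E := fun h => hyX (hXY _ hyY h)
    refine ⟨y, hyY, y.2, hyK, ?_⟩
    have hLn : ∀ s (hs : s < n), (s, (y : ℕ)) ∈ ancestors (List.range n) E r ↔
      y ∈ (treePath hT ⟨s, hs⟩ r).support := fun s hs => hL.trans
        ⟨fun ⟨_, _, h⟩ => h, fun h => ⟨hs, y.2, h⟩⟩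
    unfold Crossed
    rw [hLn s hs, hLn t ht]
    exact (crossed_of_mem_treePath hT hr hy (hKn y hyK)).imp (fun h => by rw [h])
      (Or.imp_left fun h => by rw [h])
  · rw [← Bool.not_eq_true, conn_iff hE] at hX ⊢
    rintro ⟨hs, ht, q, hq⟩
    exact hX ⟨hs, ht, q, fun x hx h => hq x hx (hXY _ h)⟩

end tables

/-! ### Correctness and running time -/

namespace UwMCTree
variable (I : UwMCTree)

/-- The instance `I` as the program reads it. -/
def inst : Inst :=
  (I.order, (I.edges.map fun p => ((p.1 : ℕ), (p.2 : ℕ)),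
    (I.pairs.map fun p => ((p.1 : ℕ), (p.2 : ℕ)), (List.ofFn I.wt, (I.bound, ())))))

theorem enc_inst : enc I.inst = I.encode := by
  have h : (fun p : Fin I.order × Fin I.order => enc ((p.1 : ℕ), (p.2 : ℕ))) = encodePair := rfl
  rw [encode, ← h]
  simp [enc, inst, encodeList, Function.comp_def, List.map_ofFn]

theorem inst_verts : I.inst.verts = List.range I.order := by simp [Inst.verts, inst]

theorem describes : Describes I.inst.2.1 I.tree := by
  intro u v
  simp only [adj, has_eq, inst, tree, SimpleGraph.fromEdgeSet_adj, Set.mem_ofPred_eq, List.mem_map,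
    Prod.mk.injEq, Bool.and_eq_true, Bool.or_eq_true, decide_eq_true_eq, Bool.not_eq_true',
    decide_eq_false_iff_not, Sym2.eq_iff, ne_eq, Fin.mk.injEq]
  constructor
  · rintro ⟨⟨p, hp, rfl, rfl⟩ | ⟨p, hp, rfl, rfl⟩, hne⟩
    · exact ⟨p.1.2, p.2.2, ⟨p, hp, Or.inl ⟨rfl, rfl⟩⟩, hne⟩
    · exact ⟨p.2.2, p.1.2, ⟨p, hp, Or.inr ⟨rfl, rfl⟩⟩, hne⟩
  · rintro ⟨hu, hv, ⟨p, hp, ⟨h1, h2⟩ | ⟨h1, h2⟩⟩, hne⟩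
    · exact ⟨Or.inl ⟨p, hp, by rw [← h1], by rw [← h2]⟩, hne⟩
    · exact ⟨Or.inr ⟨p, hp, by rw [← h2], by rw [← h1]⟩, hne⟩

theorem weight_inst (v : Fin I.order) : weight I.inst.wts v = I.wt v := by
  have h : I.inst.wts = (List.finRange I.order).map fun i : Fin I.order => (Fin.val i, I.wt i) := by
    rw [Inst.wts, inst_verts, ← List.map_coe_finRange_eq_range]
    simp only [inst]
    rw [List.ofFn_eq_map, List.zip_map']
  rw [weight, h, List.filter_map, List.map_map,
    ← List.sum_toFinset _ ((List.nodup_finRange _).filter _)]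
  simp [List.toFinset_filter, Finset.sum_filter, Fin.val_inj, Function.comp_def]

theorem sum_weight (S : Finset (Fin I.order)) :
    ∑ v ∈ S.map Fin.valEmbedding, weight I.inst.wts v = ∑ v ∈ S, I.wt v := by
  rw [Finset.sum_map]
  exact Finset.sum_congr rfl fun v _ => I.weight_inst v

/-- The tables that the program computes have the properties on which it relies. -/
theorem treeCuts : TreeCuts I.order I.inst.2.1 I.inst.anc I.inst.keys := by
  classical
  have hK : I.inst.keys = keys (List.range I.order) I.inst.2.1 := by rw [Inst.keys, inst_verts]
  obtain ⟨k, hk⟩ := exists_key (T := I.tree) I.isTree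
  have hm : I.inst.keys.headD 0 ∈ I.inst.keys := by
    have : (k : ℕ) ∈ I.inst.keys := by
      rw [hK]; exact (mem_keys I.describes).2 ⟨k.2, hk⟩
    cases h : I.inst.keys with
    | nil => rw [h] at this; cases this
    | cons a l => simp
  obtain ⟨hr, hd⟩ := (mem_keys I.describes).1 (hK ▸ hm)
  have := _root_.treeCuts I.describes I.isTree hd
  rwa [Inst.anc, inst_verts, hK]

/-- The Boolean test agrees with the definition of a multicut. -/
theorem conn_inst_eq_false_iff (X : List ℕ) (p : Fin I.order × Fin I.order) :
    conn (List.range I.order) I.inst.2.1 X p.1 p.2 = false ↔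
      ∀ q : I.tree.Walk p.1 p.2, q.IsPath → ∃ v ∈ q.support, (v : ℕ) ∈ X := by
  rw [conn_eq_false_iff I.describes I.isTree]
  constructor
  · intro h q hq
    rwa [eq_treePath I.isTree hq]
  · intro h
    exact h _ (treePath_isPath _ _ _)

/-- The algorithm accepts exactly the yes-instances. -/
theorem solve_iff : I.inst.solve = true ↔ I.IsYes := by
  classical
  have hP : ∀ p, p ∈ I.inst.2.2.1 ↔ ∃ q ∈ I.pairs, ((q.1 : ℕ), (q.2 : ℕ)) = p := fun p => by
    simp [inst]
  have hb : I.inst.2.2.2.2.1 = I.bound := rfl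
  simp only [Inst.solve, List.any_eq_true, Inst.check, isSolution, Bool.and_eq_true,
    List.all_eq_true, Bool.not_eq_true', decide_eq_true_eq, inst_verts, hb]
  constructor
  · rintro ⟨c, -, h1, h2⟩
    set S := candidate (List.range I.order) I.inst.2.1 I.inst.anc I.inst.segs I.inst.2.2.1 I.inst.wts c
      with hS
    have hSn : S.Nodup := List.nodup_range.filter _
    have hlt : ∀ v ∈ S, v < I.order := fun v hv => by
      simpa using (List.mem_filter.1 hv).1
    refine ⟨Finset.univ.filter fun v => (v : ℕ) ∈ S, ?_, fun p hp q hq => ?_⟩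
    · rw [← sum_weight]
      refine le_of_eq_of_le ?_ h2
      rw [← List.sum_toFinset _ hSn]
      refine Finset.sum_congr ?_ fun _ _ => rfl
      ext v
      simp only [Finset.mem_map, Finset.mem_filter, Finset.mem_univ, true_and, List.mem_toFinset,
        Fin.valEmbedding_apply]
      exact ⟨by rintro ⟨i, hi, rfl⟩; exact hi, fun h => ⟨⟨v, hlt v h⟩, h, rfl⟩⟩
    · obtain ⟨v, hv, hvS⟩ := (I.conn_inst_eq_false_iff S p).1 (h1 _ ((hP _).2 ⟨p, hp, rfl⟩)) q hq
      exact ⟨v, by simpa using hvS, hv⟩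
  · rintro ⟨S, h1, h2⟩
    have hY : ∀ v, v ∈ S.toList.map Fin.val ↔ v ∈ S.map Fin.valEmbedding := fun v => by simp
    obtain ⟨X, hX, K₁, hK, O, hO, w, hw, h3, h4⟩ := I.treeCuts.exists_candidate I.inst.2.2.1
      I.inst.wts (fun p hp => by
        obtain ⟨q, -, rfl⟩ := (hP p).1 hp
        exact ⟨q.1.2, q.2.2⟩) (S.toList.map Fin.val) (fun p hp => by
        obtain ⟨q, hq, rfl⟩ := (hP p).1 hp
        refine (I.conn_inst_eq_false_iff _ q).2 fun π hπ => ?_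
        obtain ⟨v, hv, hv'⟩ := h2 q hq π hπ
        exact ⟨v, hv', (hY v).2 (Finset.mem_map_of_mem _ hv)⟩)
    have hseg : I.inst.segs = segments (List.range I.order) I.inst.keys I.inst.anc := by
      rw [Inst.segs, inst_verts]
    refine ⟨((X, K₁), (O, w)), ?_, ?_, ?_⟩
    · simp only [Inst.certs, List.pair_mem_product]
      exact ⟨⟨hX, hK⟩, hO, hw⟩
    · rw [hseg]; exact h3
    · rw [hseg]
      refine h4.trans (le_trans ?_ h1)
      rw [← sum_weight]
      exact Finset.sum_le_sum_of_subset fun v hv =>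
        (hY v).1 (List.mem_toFinset.1 (Finset.mem_filter.1 hv).1)

theorem length_keys_le : I.inst.keys.length ≤ 2 * numLeaves I.tree + 1 := by
  classical
  rw [Inst.keys, inst_verts, length_keys I.describes]
  refine (card_keys_le (T := I.tree) I.isTree).trans (le_of_eq ?_)
  congr 2
  rw [numLeaves, Set.ncard_eq_toFinset_card']
  congr 1
  ext v
  simp only [Finset.mem_filter, Finset.mem_univ, true_and, Set.mem_toFinset, Set.mem_ofPred_eq]
  rw [Set.ncard_eq_toFinset_card', ← SimpleGraph.card_neighborFinset_eq_degree,
    SimpleGraph.neighborFinset]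

end UwMCTree

theorem length_product' {α β : Type} (l : List α) (m : List β) :
    (l.product m).length = l.length * m.length := List.length_product l m

theorem length_halves (K : List ℕ) : (halves K).length = 2 * K.length := by
  rw [halves, length_product']; simp [mul_comm]

theorem Inst.count_eq (d : Inst) : d.count = 2 ^ d.keys.length +
    (16 * d.keys.length ^ 2) ^ (4 * d.keys.length ^ 2) := by
  simp only [Inst.count, Inst.alphabet, walkStates, List.length_range, List.length_append,
    length_product', length_halves, List.length_cons, List.length_nil]
  ring_nf

/-- The numbers of subsets of keys and of words are `2 ^ O(ℓ² log ℓ)`, if there are at most `2 ℓ + 1` keys. -/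
theorem Inst.count_le {d : Inst} {l : ℕ} (h : d.keys.length ≤ 2 * l + 1) : (d.count : ℝ) ≤
    ((2 ^ 3 + 144 ^ 36 : ℕ) : ℝ) * (2 : ℝ) ^ ((360 : ℝ) * (l : ℝ) ^ 2 * Real.logb 2 l) := by
  rw [d.count_eq]
  set k := d.keys.length
  rcases Nat.lt_or_ge l 2 with hl | hl
  · have h0 : Real.logb 2 l = 0 := by interval_cases l <;> simp
    rw [h0, mul_zero, Real.rpow_zero, mul_one]
    -- the count is bounded by its value for three keys
    have hk : k ≤ 3 := by omega
    have hk2 : k ^ 2 ≤ 9 := by nlinarith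
    refine Nat.cast_le.2 (Nat.add_le_add (Nat.pow_le_pow_right (by norm_num) hk) ?_)
    calc (16 * k ^ 2) ^ (4 * k ^ 2) ≤ 144 ^ (4 * k ^ 2) := Nat.pow_le_pow_left (by omega) _
      _ ≤ 144 ^ 36 := Nat.pow_le_pow_right (by norm_num) (by omega)
  · -- both summands are at most `(l ^ 10) ^ (36 * l ^ 2)`, as `16 * (3 * l) ^ 2 ≤ l ^ 10`
    have hk : k ≤ 3 * l := by omega
    have hk2 : k ^ 2 ≤ 9 * l ^ 2 := by nlinarith
    have hl8 : 2 ^ 8 ≤ l ^ 8 := Nat.pow_le_pow_left hl 8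
    have hl2 : l ≤ l ^ 2 := by nlinarith
    have h1 : 2 ^ k ≤ l ^ (360 * l ^ 2) :=
      (Nat.pow_le_pow_left hl k).trans (Nat.pow_le_pow_right (by omega) (by omega))
    have h2 : (16 * k ^ 2) ^ (4 * k ^ 2) ≤ l ^ (360 * l ^ 2) := by
      calc (16 * k ^ 2) ^ (4 * k ^ 2) ≤ (l ^ 10) ^ (4 * k ^ 2) :=
            Nat.pow_le_pow_left (by nlinarith [show l ^ 10 = l ^ 8 * l ^ 2 by ring]) _
        _ ≤ (l ^ 10) ^ (36 * l ^ 2) :=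
            Nat.pow_le_pow_right (Nat.pow_pos (by omega)) (by omega)
        _ = l ^ (360 * l ^ 2) := by rw [← pow_mul]; ring_nf
    have h3 : (2 : ℝ) ^ ((360 : ℝ) * (l : ℝ) ^ 2 * Real.logb 2 l) =
        ((l ^ (360 * l ^ 2) : ℕ) : ℝ) := by
      rw [mul_comm, Real.rpow_mul (by norm_num), Real.rpow_logb (by norm_num) (by norm_num)
        (by exact_mod_cast (by omega : 0 < l))]
      rw [Nat.cast_pow, ← Real.rpow_natCast (l : ℝ) (360 * l ^ 2)]
      push_cast
      rfl
    rw [h3]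
    norm_cast
    have h4 : 2 ≤ 2 ^ 3 + 144 ^ 36 := by norm_num
    calc _ ≤ 2 * l ^ (360 * l ^ 2) := by omega
      _ ≤ _ := Nat.mul_le_mul_right _ h4

theorem theorem2 :
    ∃ (p : WProg) (a b c : ℕ), ∀ I : UwMCTree,
      p.DecidesWithin I.encode I.IsYes
        ((a : ℝ) *
          (2 : ℝ) ^ ((b : ℝ) * (numLeaves I.tree : ℝ) ^ 2 * Real.logb 2 (numLeaves I.tree : ℝ)) *
          (I.encode.size : ℝ) ^ c) := by
  obtain ⟨p, C, k, hp⟩ := PTW.exists_program PTW.solve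
  refine ⟨p, C * (3 * (2 ^ 3 + 144 ^ 36)) ^ k, 360 * k, k, fun I => ?_⟩
  obtain ⟨τ, t, h1, h2, h3⟩ := hp I.inst
  rw [I.enc_inst] at h1
  rw [I.solve_iff] at h3
  refine ⟨τ, t, h1, h2.trans ?_, h3⟩
  have hs : esize I.inst = I.encode.size := by rw [esize, I.enc_inst]
  have hc := Inst.count_le I.length_keys_le
  set D := 2 ^ 3 + 144 ^ 36
  set B := (2 : ℝ) ^ ((360 : ℝ) * (numLeaves I.tree : ℝ) ^ 2 * Real.logb 2 (numLeaves I.tree)) with hB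
  have hm : I.inst.measure + 1 ≤ 3 * (I.encode.size * I.inst.count) := by
    have h4 := I.inst.one_le_count
    have h5 := I.encode.size_pos
    rw [Inst.measure, hs]
    nlinarith
  have hBk : (2 : ℝ) ^ (((360 * k : ℕ) : ℝ) * (numLeaves I.tree : ℝ) ^ 2 *
      Real.logb 2 (numLeaves I.tree)) = B ^ k := by
    rw [hB, ← Real.rpow_mul_natCast (by norm_num)]
    push_cast
    ring_nf
  rw [hBk]
  calc ((C * (I.inst.measure + 1) ^ k : ℕ) : ℝ)
      ≤ ((C * (3 * (I.encode.size * I.inst.count)) ^ k : ℕ) : ℝ) :=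
        Nat.cast_le.2 (Nat.mul_le_mul_left _ (Nat.pow_le_pow_left hm k))
    _ = C * (3 * (I.encode.size * (I.inst.count : ℝ))) ^ k := by push_cast; ring
    _ ≤ C * (3 * (I.encode.size * (D * B))) ^ k := by gcongr
    _ = ((C * (3 * D) ^ k : ℕ) : ℝ) * B ^ k * (I.encode.size : ℝ) ^ k := by push_cast; ring
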